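/- Let $\Bbbk$ be a field, $V$ a finite-dimensional $\Bbbk$-vector space and $G\le GL(V)$ a finite group. **Reflections.** Let $\mathcal S=\{s\in G:\dim(1-s)V=1\}$. For $s\in\mathcal S$ choose $\alpha_s\in V^*$, $\check\alpha_s\in V$ with $s(v)=v-\langle\alpha_s,v\rangle\check\alpha_s$ for all $v\in V$, and let $\lambda(g,s)\in\Bbbk$ be defined by $g(\check\alpha_s)=\lambda(g,s)\check\alpha_{gsg^{-1}}$. Let $t\in\Bbbk$, and let $c\colon\mathcal S\to\Bbbk$, $s\mapsto c_s$, satisfy $c_{gsg^{-1}}=c_s$ for all $g\in G$, $s\in\mathcal S$. **Braided doubles.** A finite-dimensional quasi-Yetter–Drinfeld module over $G$ is a finite-dimensional $G$-module $W$ with a linear map $\delta\colon W\to\Bbbk G\otimes W$, $\delta(w)=w^{[-1]}\otimes w^{[0]}$, such that $(gw)^{[-1]}g\otimes(gw)^{[0]}=g\,w^{[-1]}\otimes g(w^{[0]})$ for $g\in G$; it is a Yetter–Drinfeld module if $\delta$ is a coaction. Let $\widetilde A(W,\delta)$ be the algebra generated by $W$, $\Bbbk G$ and $W^*$ subject to the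 relations of $\Bbbk G$ and $g\cdot w=g(w)\cdot g$, $f\cdot g=g\cdot(f\circ g)$, $f\cdot w-w\cdot f=w^{[-1]}\langle f,w^{[0]}\rangle$ for $g\in G$, $w\in W$, $f\in W^*$; multiplication gives a linear isomorphism $T(W)\otimes\Bbbk G\otimes T(W^*)\cong\widetilde A(W,\delta)$. A triangular ideal is a two-sided ideal of the form $I^-\otimes\Bbbk G\otimes T(W^*)+T(W)\otimes\Bbbk G\otimes I^+$ with subspaces $I^-\subset T^{>0}(W)$, $I^+\subset T^{>0}(W^*)$; the quotient by it is called a braided double and written $T(W)/I^-\rtimes\Bbbk G\ltimes T(W^*)/I^+$. The quotient by the sum of all triangular ideals is the minimal double; for a Yetter–Drinfeld module it is called the braided Heisenberg double $\mathcal H_W$. A morphism from $T(V)/I^-\rtimes\Bbbk G\ltimes T(V^*)/I^+$ to $T(W)/K^-\rtimes\Bbbk G\ltimes T(W^*)/K^+$ is an algebra homomorphism of the form $\overline{T(\mu)}\otimes\mathrm{id}_{\Bbbk G}\otimes\overline{T(\nu^*)}$ induced by $G$-module maps $\mu\colon V\to W$, $\nu\colon W\to V$. **Nichols–Woronowicz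 algebras.** For a braided space $(W,\Psi)$ put $\mathcal B(W,\Psi)=\bigoplus_n W^{\otimes n}/\ker[n]!_\Psi$, where $[n]_\Psi=\mathrm{id}+\Psi_{n-1,n}+\Psi_{n-1,n}\Psi_{n-2,n-1}+\dots+\Psi_{n-1,n}\cdots\Psi_{1,2}$, $[0]!_\Psi=1$ and $[n]!_\Psi=([n-1]!_\Psi\otimes\mathrm{id})\circ[n]_\Psi$. A Yetter–Drinfeld module has the braiding $\Psi(x\otimes y)=x^{[-1]}(y)\otimes x^{[0]}$, and $\mathcal B(W)=\mathcal B(W,\Psi)$, $\mathcal B(W^*)=\mathcal B(W^*,\Psi^*)$, where $\Psi^*$ is the adjoint of $\Psi$ for $\langle f\otimes f',x\otimes y\rangle=\langle f,x\rangle\langle f',y\rangle$. **The two doubles.** The rational Cherednik algebra $H_{t,c}(G)$ is the quotient of $\widetilde A(V,\delta_{t,c})$, $\delta_{t,c}(v)=1\otimes tv+\sum_{s\in\mathcal S}c_s\,s\otimes(v-s(v))$, by the relations $vv'=v'v$ ($v,v'\in V$) and $ff'=f'f$ ($f,f'\in V^*$). Let $Y_{\mathcal S}(G)=V\oplus\bigoplus_{s\in\mathcal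 S}\Bbbk[s]$, with the given $G$-action and the coaction $v\mapsto1\otimes v$ on $V$, and with $g([s])=\lambda(g,s)[gsg^{-1}]$, $[s]\mapsto s\otimes[s]$. Let $[s]^*$ denote the functional on $Y_{\mathcal S}(G)$ that vanishes on $V$ and on $[r]$, $r\neq s$, and is $1$ on $[s]$. **Theorem.** $Y_{\mathcal S}(G)$ is a Yetter–Drinfeld module over $G$; $H_{t,c}(G)$ is a braided double of the form $S(V)\rtimes\Bbbk G\ltimes S(V^*)$; the braided Heisenberg double of $Y_{\mathcal S}(G)$ is of the form $\mathcal B(Y_{\mathcal S}(G))\rtimes\Bbbk G\ltimes\mathcal B(Y_{\mathcal S}(G)^*)$. The maps $$\mu\colon V\to Y_{\mathcal S}(G),\quad \mu(v)=tv\oplus\bigoplus_{s\in\mathcal S}c_s\langle\alpha_s,v\rangle[s],\qquad \nu^*\colon V^*\to Y_{\mathcal S}(G)^*,\quad \nu^*(f)=f\oplus\bigoplus_{s\in\mathcal S}\langle f,\check\alpha_s\rangle[s]^*$$ induce a morphism of braided doubles $$H_{t,c}(G)\longrightarrow\mathcal B(Y_{\mathcal S}(G))\rtimes\Bbbk G\ltimes\mathcal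 B(Y_{\mathcal S}(G)^*).$$ If $t\ne0$ and $\operatorname{char}\Bbbk=0$, this morphism is injective. -/

import Mathlib

open scoped TensorProduct

noncomputable section

namespace BraidedDouble

universe u v w

/-! ### Quasi-Yetter-Drinfeld modules over a group algebra -/

section General

variable {k : Type u} [Field k] {G : Type v} [Group G] {W : Type w} [AddCommGroup W] [Module k W]

/-- A quasicoaction of the group algebra on `W`: an arbitrary linear map `W → kG ⊗ W`. -/
abbrev Quasicoaction (k : Type u) [Field k] (G : Type v) [Group G]
    (W : Type w) [AddCommGroup W] [Module k W] :=
  W →ₗ[k] MonoidAlgebra k G ⊗[k] W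

/-- The Yetter-Drinfeld compatibility condition
`(h₁ ▷ v)^[-1] h₂ ⊗ (h₁ ▷ v)^[0] = h₁ v^[-1] ⊗ h₂ ▷ v^[0]`, on the basis `h = g ∈ G` of `kG`. -/
def IsQuasiYetterDrinfeld (ρ : Representation k G W) (δ : Quasicoaction k G W) : Prop :=
  ∀ (g : G) (v : W),
    TensorProduct.map (LinearMap.mulRight k (MonoidAlgebra.of k G g)) LinearMap.id (δ (ρ g v)) =
      TensorProduct.map (LinearMap.mulLeft k (MonoidAlgebra.of k G g)) (ρ g) (δ v)

/-- A Yetter-Drinfeld module: the quasicoaction is moreover a (coassociative, counital) coaction. -/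
structure IsYetterDrinfeld (ρ : Representation k G W) (δ : Quasicoaction k G W) : Prop where
  compat : IsQuasiYetterDrinfeld ρ δ
  coassoc : ∀ v : W, TensorProduct.assoc k _ _ _
      ((Coalgebra.comul (R := k) (A := MonoidAlgebra k G)).rTensor W (δ v)) = δ.lTensor _ (δ v)
  counit : ∀ v : W,
    (Coalgebra.counit (R := k) (A := MonoidAlgebra k G)).rTensor W (δ v) = 1 ⊗ₜ[k] v

/-- The `kG`-valued pairing `β(f, v) = v^[-1] ⟨f, v^[0]⟩` attached to a quasicoaction. -/
def pairing (δ : Quasicoaction k G W) (f : Module.Dual k W) (v : W) : MonoidAlgebra k G :=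
  TensorProduct.rid k _ (f.lTensor (MonoidAlgebra k G) (δ v))

/-! ### The algebra generated by `W`, `kG`, `W*` and its quotients -/

/-- The space of generators of the free double. -/
abbrev Gen (k : Type u) [Field k] (G : Type v) [Group G]
    (W : Type w) [AddCommGroup W] [Module k W] :=
  W × MonoidAlgebra k G × Module.Dual k W

/-- The generator `v ∈ W`. -/
def genV (v : W) : TensorAlgebra k (Gen k G W) := TensorAlgebra.ι k (v, 0, 0)

/-- The generator `h ∈ kG`. -/
def genH (h : MonoidAlgebra k G) : TensorAlgebra k (Gen k G W) := TensorAlgebra.ι k (0, h, 0)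

/-- The generator `f ∈ W*`. -/
def genF (f : Module.Dual k W) : TensorAlgebra k (Gen k G W) := TensorAlgebra.ι k (0, 0, f)

/-- The defining relations of the free double: all relations of `kG`, the two semidirect product
relations `g v = g(v) g` and `f g = g (f ◁ g)` with `⟨f ◁ g, v⟩ = ⟨f, g(v)⟩`, and the commutator
relation `f v - v f = β(f, v)`. -/
inductive Rel (ρ : Representation k G W) (δ : Quasicoaction k G W) :
    TensorAlgebra k (Gen k G W) → TensorAlgebra k (Gen k G W) → Prop
  | one : Rel ρ δ (genH 1) 1
  | mul (a b : MonoidAlgebra k G) : Rel ρ δ (genH (a * b)) (genH a * genH b)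
  | left (g : G) (v : W) :
      Rel ρ δ (genH (MonoidAlgebra.of k G g) * genV v) (genV (ρ g v) * genH (MonoidAlgebra.of k G g))
  | right (f : Module.Dual k W) (g : G) :
      Rel ρ δ (genF f * genH (MonoidAlgebra.of k G g))
        (genH (MonoidAlgebra.of k G g) * genF (f ∘ₗ ρ g))
  | comm (f : Module.Dual k W) (v : W) :
      Rel ρ δ (genF f * genV v) (genV v * genF f + genH (pairing δ f v))

/-- The algebra `Ã(W, δ)` generated by `W`, `kG` and `W*` subject to `Rel`. -/
abbrev FreeDouble (ρ : Representation k G W) (δ : Quasicoaction k G W) := RingQuot (Rel ρ δ)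

variable (ρ : Representation k G W) (δ : Quasicoaction k G W)

/-- The quotient map onto `Ã(W, δ)` from the free algebra on the space of generators. -/
def FreeDouble.proj : TensorAlgebra k (Gen k G W) →ₐ[k] FreeDouble ρ δ :=
  RingQuot.mkAlgHom k (Rel ρ δ)

/-- The homomorphism `T(W) → Ã(W, δ)`. -/
def lower : TensorAlgebra k W →ₐ[k] FreeDouble ρ δ :=
  TensorAlgebra.lift k
    ((FreeDouble.proj ρ δ).toLinearMap ∘ₗ TensorAlgebra.ι k ∘ₗ LinearMap.inl k _ _)

/-- The map `kG → Ã(W, δ)`. -/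
def mid : MonoidAlgebra k G →ₗ[k] FreeDouble ρ δ :=
  (FreeDouble.proj ρ δ).toLinearMap ∘ₗ TensorAlgebra.ι k ∘ₗ LinearMap.inr k _ _ ∘ₗ
    LinearMap.inl k _ _

/-- The homomorphism `T(W*) → Ã(W, δ)`. -/
def upper : TensorAlgebra k (Module.Dual k W) →ₐ[k] FreeDouble ρ δ :=
  TensorAlgebra.lift k
    ((FreeDouble.proj ρ δ).toLinearMap ∘ₗ TensorAlgebra.ι k ∘ₗ LinearMap.inr k _ _ ∘ₗ
      LinearMap.inr k _ _)

/-- The product `a · h · b` in `Ã(W, δ)` of `a ∈ T(W)`, `h ∈ kG`, `b ∈ T(W*)`. -/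
def tri (a : TensorAlgebra k W) (h : MonoidAlgebra k G) (b : TensorAlgebra k (Module.Dual k W)) :
    FreeDouble ρ δ :=
  lower ρ δ a * mid ρ δ h * upper ρ δ b

/-- The quotient algebra `Ã(W, δ) / J`. -/
abbrev QuotAlg (J : TwoSidedIdeal (FreeDouble ρ δ)) := J.ringCon.Quotient

/-- The quotient map `Ã(W, δ) → Ã(W, δ) / J`. -/
def toQuot (J : TwoSidedIdeal (FreeDouble ρ δ)) : FreeDouble ρ δ →ₐ[k] QuotAlg ρ δ J :=
  J.ringCon.mkₐ k

/-- Multiplication induces a linear isomorphism `T(W)/I⁻ ⊗ kG ⊗ T(W*)/I⁺ → Ã(W, δ)/J`. -/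
def HasTriangularDecomposition (Im : Submodule k (TensorAlgebra k W))
    (Ip : Submodule k (TensorAlgebra k (Module.Dual k W)))
    (J : TwoSidedIdeal (FreeDouble ρ δ)) : Prop :=
  ∃ e : (TensorAlgebra k W ⧸ Im) ⊗[k] MonoidAlgebra k G ⊗[k]
      (TensorAlgebra k (Module.Dual k W) ⧸ Ip) ≃ₗ[k] QuotAlg ρ δ J,
    ∀ a h b, e (Im.mkQ a ⊗ₜ h ⊗ₜ Ip.mkQ b) = toQuot ρ δ J (tri ρ δ a h b)

/-- The ideal `T^{>0}(M)` of the tensor algebra. -/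
def positivePart (k : Type u) [Field k] (M : Type w) [AddCommGroup M] [Module k M] :
    Submodule k (TensorAlgebra k M) :=
  LinearMap.ker (TensorAlgebra.algebraMapInv (R := k) (M := M)).toLinearMap

/-- `J` is the triangular ideal `I⁻ ⊗ kG ⊗ T(W*) + T(W) ⊗ kG ⊗ I⁺` of `Ã(W, δ)`, where `I⁻` and
`I⁺` are subspaces of `T^{>0}(W)` and `T^{>0}(W*)`. -/
structure IsTriangularIdeal (Im : Submodule k (TensorAlgebra k W))
    (Ip : Submodule k (TensorAlgebra k (Module.Dual k W)))
    (J : TwoSidedIdeal (FreeDouble ρ δ)) : Prop where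
  lower_pos : Im ≤ positivePart k W
  upper_pos : Ip ≤ positivePart k (Module.Dual k W)
  carrier_eq : (J : Set (FreeDouble ρ δ)) =
    Submodule.span k {x | ∃ a h b, (a ∈ Im ∨ b ∈ Ip) ∧ x = tri ρ δ a h b}

/-- `Ã(W, δ)/J` is a `(W, δ)`-braided double `T(W)/I⁻ ⋊ kG ⋉ T(W*)/I⁺`: the quotient of a free
braided double by a triangular ideal. -/
structure IsBraidedDouble (Im : Submodule k (TensorAlgebra k W))
    (Ip : Submodule k (TensorAlgebra k (Module.Dual k W)))
    (J : TwoSidedIdeal (FreeDouble ρ δ)) : Prop where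
  compat : IsQuasiYetterDrinfeld ρ δ
  free : HasTriangularDecomposition ρ δ ⊥ ⊥ ⊥
  triangular : IsTriangularIdeal ρ δ Im Ip J
  decomposition : HasTriangularDecomposition ρ δ Im Ip J

/-- The sum of all triangular ideals of `Ã(W, δ)`. -/
def maximalTriangularIdeal : TwoSidedIdeal (FreeDouble ρ δ) :=
  sSup {J | ∃ Im Ip, IsTriangularIdeal ρ δ Im Ip J}

/-- The minimal double `Ā(W, δ)`; for a finite-dimensional Yetter-Drinfeld module `(W, δ)` this is
the braided Heisenberg double of `(W, δ)`. -/
abbrev MinimalDouble := QuotAlg ρ δ (maximalTriangularIdeal ρ δ)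

end General

/-! ### Morphisms of braided doubles -/

/-- The algebra homomorphism `T(μ) : T(V) → T(W)`. -/
def tensorMap {k V W : Type*} [Field k] [AddCommGroup V] [Module k V] [AddCommGroup W] [Module k W]
    (μ : V →ₗ[k] W) : TensorAlgebra k V →ₐ[k] TensorAlgebra k W :=
  TensorAlgebra.lift k (TensorAlgebra.ι k ∘ₗ μ)

/-- `Φ` is the morphism `T(μ) ⊗ id ⊗ T(η)` from the braided double
`Ã(V, δV)/J = T(V)/I⁻ ⋊ kG ⋉ T(V*)/I⁺` to the braided double
`Ã(W, δW)/L = T(W)/K⁻ ⋊ kG ⋉ T(W*)/K⁺`, induced by `μ : V → W` and by `η = ν*` for some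
`ν : W → V`, where `μ` and `ν` are `G`-module maps. -/
structure IsMorphism {k G V W : Type*} [Field k] [Group G]
    [AddCommGroup V] [Module k V] [AddCommGroup W] [Module k W]
    (ρV : Representation k G V) (δV : Quasicoaction k G V)
    (Im : Submodule k (TensorAlgebra k V)) (Ip : Submodule k (TensorAlgebra k (Module.Dual k V)))
    (J : TwoSidedIdeal (FreeDouble ρV δV))
    (ρW : Representation k G W) (δW : Quasicoaction k G W)
    (Km : Submodule k (TensorAlgebra k W)) (Kp : Submodule k (TensorAlgebra k (Module.Dual k W)))
    (L : TwoSidedIdeal (FreeDouble ρW δW))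
    (μ : V →ₗ[k] W) (η : Module.Dual k V →ₗ[k] Module.Dual k W)
    (Φ : QuotAlg ρV δV J →ₐ[k] QuotAlg ρW δW L) : Prop where
  source : IsBraidedDouble ρV δV Im Ip J
  target : IsBraidedDouble ρW δW Km Kp L
  equivariant : ∀ g, μ ∘ₗ ρV g = ρW g ∘ₗ μ
  adjoint : ∃ ν : W →ₗ[k] V, (∀ g, ν ∘ₗ ρW g = ρV g ∘ₗ ν) ∧ ν.dualMap = η
  map_lower : ∀ a ∈ Im, tensorMap μ a ∈ Km
  map_upper : ∀ b ∈ Ip, tensorMap η b ∈ Kp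
  map_tri : ∀ a h b, Φ (toQuot ρV δV J (tri ρV δV a h b)) =
    toQuot ρW δW L (tri ρW δW (tensorMap μ a) h (tensorMap η b))

/-! ### Nichols-Woronowicz algebras -/

section Nichols

variable {k : Type u} [Field k] {M : Type v} [AddCommGroup M] [Module k M]

/-- `(b ⊗ x) ⊗ y ↦ b · Ψ(x ⊗ y)`, that is, `Ψ` on the last two legs; here and below the tensor
power `M^{⊗ n}` is the degree `n` part of `T(M)`. -/
def lastLegs (Ψ : M ⊗[k] M →ₗ[k] M ⊗[k] M) :
    (TensorAlgebra k M ⊗[k] M) ⊗[k] M →ₗ[k] TensorAlgebra k M ⊗[k] M :=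
  (LinearMap.mul' k (TensorAlgebra k M) ∘ₗ (TensorAlgebra.ι k).lTensor _).rTensor M ∘ₗ
    (TensorProduct.assoc k (TensorAlgebra k M) M M).symm.toLinearMap ∘ₗ
    Ψ.lTensor (TensorAlgebra k M) ∘ₗ (TensorProduct.assoc k (TensorAlgebra k M) M M).toLinearMap

/-- One step of the recursion for braided integers: `y` sends `(b, x)` to
`(b y, b ⊗ y + Ψ_{n-1,n}(x ⊗ y))`. -/
def braidedStep (Ψ : M ⊗[k] M →ₗ[k] M ⊗[k] M) :
    M →ₗ[k] Module.End k (TensorAlgebra k M × TensorAlgebra k M ⊗[k] M) :=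
  LinearMap.mk₂ k
    (fun y p => (p.1 * TensorAlgebra.ι k y, p.1 ⊗ₜ[k] y + lastLegs Ψ (p.2 ⊗ₜ[k] y)))
    (fun y y' p => by
      ext1
      · simp [mul_add]
      · simp only [TensorProduct.tmul_add, map_add, Prod.snd_add]; abel)
    (fun c y p => by ext1 <;> simp)
    (fun y p p' => by
      ext1
      · simp [add_mul]
      · simp only [TensorProduct.add_tmul, map_add, Prod.snd_add, Prod.fst_add]; abel)
    (fun c y p => by ext1 <;> simp [← TensorProduct.smul_tmul'])

/-- The braided integers `[n]_Ψ = id + Ψ_{n-1,n} + Ψ_{n-1,n} Ψ_{n-2,n-1} + ⋯`, for all `n` at once,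
as a map `T(M) → T(M) ⊗ M` with degree `n` component `M^{⊗ n} → M^{⊗ (n-1)} ⊗ M`. It is given by
`[0] = 0` and `[n] = id + Ψ_{n-1,n} ([n-1] ⊗ id)`. -/
def braidedInteger (Ψ : M ⊗[k] M →ₗ[k] M ⊗[k] M) :
    TensorAlgebra k M →ₗ[k] TensorAlgebra k M ⊗[k] M :=
  LinearMap.snd k _ _ ∘ₗ
    LinearMap.applyₗ ((1, 0) : TensorAlgebra k M × TensorAlgebra k M ⊗[k] M) ∘ₗ
    (MulOpposite.opLinearEquiv k).symm.toLinearMap ∘ₗ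
    (TensorAlgebra.lift k
      ((MulOpposite.opLinearEquiv k).toLinearMap ∘ₗ braidedStep Ψ)).toLinearMap

/-- The braided factorial `[n]!_Ψ = ([n-1]!_Ψ ⊗ id) ∘ [n]_Ψ` on `M^{⊗ n}`, extended by zero to the
other homogeneous components of `T(M)`. -/
def braidedFactorial (Ψ : M ⊗[k] M →ₗ[k] M ⊗[k] M) :
    ℕ → TensorAlgebra k M →ₗ[k] TensorAlgebra k M
  | 0 => Algebra.linearMap k _ ∘ₗ TensorAlgebra.algebraMapInv.toLinearMap
  | n + 1 => LinearMap.mul' k _ ∘ₗ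
      TensorProduct.map (braidedFactorial Ψ n) (TensorAlgebra.ι k) ∘ₗ braidedInteger Ψ

/-- The kernel of the Woronowicz symmetriser `Wor(Ψ)`, whose restriction to `M^{⊗ n}` is `[n]!_Ψ`.
The Nichols-Woronowicz algebra is `B(M, Ψ) = T(M) / ker Wor(Ψ)`. -/
def worKer (Ψ : M ⊗[k] M →ₗ[k] M ⊗[k] M) : Submodule k (TensorAlgebra k M) :=
  ⨅ n, LinearMap.ker (braidedFactorial Ψ n)

/-- The adjoint `Ψ*`, with `⟨f ⊗ g, v ⊗ w⟩ = ⟨f, v⟩ ⟨g, w⟩`. -/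
def dualBraiding [FiniteDimensional k M] (Ψ : M ⊗[k] M →ₗ[k] M ⊗[k] M) :
    Module.Dual k M ⊗[k] Module.Dual k M →ₗ[k] Module.Dual k M ⊗[k] Module.Dual k M :=
  (TensorProduct.dualDistribEquiv k M M).symm.toLinearMap ∘ₗ Ψ.dualMap ∘ₗ
    (TensorProduct.dualDistribEquiv k M M).toLinearMap

/-- The braiding `Ψ(x ⊗ y) = x^(-1) ▷ y ⊗ x^(0)` of a Yetter-Drinfeld module. -/
def braiding {G : Type w} [Group G] (ρ : Representation k G M) (δ : Quasicoaction k G M) :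
    M ⊗[k] M →ₗ[k] M ⊗[k] M :=
  (TensorProduct.lift ρ.asAlgebraHom.toLinearMap).rTensor M ∘ₗ
    (TensorProduct.assoc k (MonoidAlgebra k G) M M).symm.toLinearMap ∘ₗ
    (TensorProduct.comm k M M).toLinearMap.lTensor (MonoidAlgebra k G) ∘ₗ
    (TensorProduct.assoc k (MonoidAlgebra k G) M M).toLinearMap ∘ₗ δ.rTensor M

/-- The kernel of `T(M) → S(M)`. -/
def symKer (k : Type u) [Field k] (M : Type v) [AddCommGroup M] [Module k M] :
    Submodule k (TensorAlgebra k M) :=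
  LinearMap.ker (SymmetricAlgebra.algHom k M).toLinearMap

end Nichols

/-! ### Linear groups, complex reflections, rational Cherednik algebras -/

section Cherednik

variable {k : Type u} [Field k] {V : Type v} [AddCommGroup V] [Module k V]
variable (G : Subgroup (LinearMap.GeneralLinearGroup k V))

/-- The tautological representation of `G ≤ GL(V)` on `V`. -/
def tautRep : Representation k G V :=
  (Units.coeHom (V →ₗ[k] V)).comp G.subtype

/-- The set of complex reflections (pseudoreflections): the `s ∈ G` with `dim (1 - s) V = 1`. -/
abbrev Refl : Type v :=
  {s : G // Module.finrank k (LinearMap.range (1 - tautRep G s)) = 1}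

variable {G}

/-- Conjugation `s ↦ g s g⁻¹` on complex reflections. -/
def Refl.conj (g : G) (s : Refl G) : Refl G :=
  ⟨g * s.1 * g⁻¹, by
    have hg : tautRep G g ∘ₗ tautRep G g⁻¹ = LinearMap.id := by
      change tautRep G g * tautRep G g⁻¹ = 1
      rw [← map_mul, mul_inv_cancel, map_one]
    have hg' : tautRep G g⁻¹ ∘ₗ tautRep G g = LinearMap.id := by
      change tautRep G g⁻¹ * tautRep G g = 1
      rw [← map_mul, inv_mul_cancel, map_one]
    let e : V ≃ₗ[k] V := LinearEquiv.ofLinearMap _ _ hg hg'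
    have h1 : (1 - tautRep G (g * s.1 * g⁻¹) : V →ₗ[k] V) =
        e.toLinearMap ∘ₗ (1 - tautRep G s.1) ∘ₗ e.symm.toLinearMap := by
      change _ = tautRep G g * ((1 - tautRep G s.1) * tautRep G g⁻¹)
      rw [sub_mul, mul_sub, one_mul, ← map_mul, ← map_mul, ← map_mul, mul_inv_cancel, map_one,
        mul_assoc]
    rw [h1, LinearMap.range_comp, LinearMap.range_comp_of_range_eq_top _ e.symm.range,
      LinearEquiv.finrank_map_eq]
    exact s.2⟩

variable (G)

/-- A choice of a root `α_s ∈ V*` and a coroot `α̌_s ∈ V` for every complex reflection `s`: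
`s(v) = v - ⟨α_s, v⟩ α̌_s`. -/
structure RootData where
  root : Refl G → Module.Dual k V
  coroot : Refl G → V
  refl_apply : ∀ (s : Refl G) (v : V), tautRep G s.1 v = v - root s v • coroot s

variable {G}

theorem RootData.exists_root_ne (R : RootData G) (s : Refl G) : ∃ v, R.root s v ≠ 0 := by
  by_contra! h
  have h0 : (1 - tautRep G s.1 : V →ₗ[k] V) = 0 := by
    ext v
    simp [R.refl_apply, h]
  have h1 := s.2
  rw [h0, LinearMap.range_zero, finrank_bot] at h1
  exact zero_ne_one h1

theorem RootData.coroot_ne (R : RootData G) (s : Refl G) : R.coroot s ≠ 0 := by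
  intro h
  have h0 : (1 - tautRep G s.1 : V →ₗ[k] V) = 0 := by
    ext v
    simp [R.refl_apply, h]
  have h1 := s.2
  rw [h0, LinearMap.range_zero, finrank_bot] at h1
  exact zero_ne_one h1

theorem RootData.nonempty : Nonempty (RootData G) := by
  have key : ∀ s : Refl G, ∃ p : Module.Dual k V × V,
      ∀ v, tautRep G s.1 v = v - p.1 v • p.2 := by
    intro s
    let b := Module.basisUnique Unit s.2
    refine ⟨(b.coord () ∘ₗ (1 - tautRep G s.1 : V →ₗ[k] V).rangeRestrict, (b ()).1), fun v => ?_⟩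
    have h := b.sum_repr ((1 - tautRep G s.1 : V →ₗ[k] V).rangeRestrict v)
    have h2 := congrArg Subtype.val h
    simp only [Finset.univ_unique, Finset.sum_singleton] at h2
    change b.repr _ () • (b ()).1 = v - tautRep G s.1 v at h2
    change _ = v - b.repr _ () • (b ()).1
    rw [h2]; abel
  choose p hp using key
  exact ⟨⟨fun s => (p s).1, fun s => (p s).2, hp⟩⟩

theorem tautRep_mul_apply (g h : G) (v : V) :
    tautRep G (g * h) v = tautRep G g (tautRep G h v) := by
  rw [map_mul]; rfl

theorem tautRep_inv_apply (g : G) (v : V) : tautRep G g⁻¹ (tautRep G g v) = v := by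
  rw [← tautRep_mul_apply, inv_mul_cancel, map_one]; rfl

theorem RootData.exists_cocycle (R : RootData G) (g : G) (s : Refl G) :
    ∃ l : k, tautRep G g (R.coroot s) = l • R.coroot (s.conj g) := by
  obtain ⟨v, hv⟩ := R.exists_root_ne s
  have h := R.refl_apply (s.conj g) (tautRep G g v)
  change tautRep G (g * s.1 * g⁻¹) (tautRep G g v) = _ at h
  rw [tautRep_mul_apply, tautRep_inv_apply, tautRep_mul_apply, R.refl_apply s v, map_sub, map_smul,
    sub_right_inj] at h
  refine ⟨(R.root s v)⁻¹ * R.root (s.conj g) (tautRep G g v), ?_⟩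
  rw [mul_smul, ← h, smul_smul, inv_mul_cancel₀ hv, one_smul]

/-- The scalar `λ(g, s)` with `g(α̌_s) = λ(g, s) α̌_{gsg⁻¹}` (unique, as `α̌_{gsg⁻¹} ≠ 0`). -/
def RootData.cocycle (R : RootData G) (g : G) (s : Refl G) : k := (R.exists_cocycle g s).choose

theorem RootData.cocycle_spec (R : RootData G) (g : G) (s : Refl G) :
    tautRep G g (R.coroot s) = R.cocycle g s • R.coroot (s.conj g) :=
  (R.exists_cocycle g s).choose_spec

theorem RootData.cocycle_unique (R : RootData G) {g : G} {s r : Refl G} (hr : s.conj g = r) {l : k}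
    (h : tautRep G g (R.coroot s) = l • R.coroot r) : R.cocycle g s = l := by
  subst hr
  rw [R.cocycle_spec] at h
  exact smul_left_injective k (R.coroot_ne _) h

theorem Refl.conj_one (s : Refl G) : s.conj 1 = s := Subtype.ext (by simp [Refl.conj])

theorem Refl.conj_mul (g h : G) (s : Refl G) : s.conj (g * h) = (s.conj h).conj g :=
  Subtype.ext (by simp [Refl.conj, mul_assoc])

theorem RootData.cocycle_one (R : RootData G) (s : Refl G) : R.cocycle 1 s = 1 :=
  R.cocycle_unique s.conj_one (by rw [map_one, one_smul]; rfl)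

theorem RootData.cocycle_mul (R : RootData G) (g h : G) (s : Refl G) :
    R.cocycle (g * h) s = R.cocycle h s * R.cocycle g (s.conj h) :=
  R.cocycle_unique (s.conj_mul g h) (by
    rw [tautRep_mul_apply, R.cocycle_spec h, map_smul, R.cocycle_spec g, smul_smul])

/-! ### The Yetter-Drinfeld module `Y_S(G) = V₁ ⊕ ⊕_s k [s]` -/

variable (G) in
/-- The underlying space of `Y_S(G)`; the symbol `[s]` is `(0, Finsupp.single s 1)`. -/
abbrev YSpace := V × (Refl G →₀ k)

/-- The `G`-action on `Y_S(G)`: the given one on `V₁ = V`, and `g([s]) = λ(g, s) [gsg⁻¹]`. -/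
def RootData.yRep (R : RootData G) : Representation k G (YSpace G) where
  toFun g := (tautRep G g).prodMap
    (Finsupp.lsum k fun s => R.cocycle g s • Finsupp.lsingle (s.conj g))
  map_one' := by
    ext <;> simp [Refl.conj_one, R.cocycle_one]
  map_mul' g h := by
    ext <;> simp [Refl.conj_mul, R.cocycle_mul, mul_comm]

variable (G) in
/-- The `kG`-coaction on `Y_S(G)`: `v ↦ 1 ⊗ v` on `V₁` and `[s] ↦ s ⊗ [s]`. -/
def yCoaction : Quasicoaction k G (YSpace G) :=
  LinearMap.coprod
    (TensorProduct.mk k (MonoidAlgebra k G) (YSpace G) 1 ∘ₗ LinearMap.inl k V (Refl G →₀ k))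
    (Finsupp.lsum k fun s =>
      TensorProduct.mk k (MonoidAlgebra k G) (YSpace G) (MonoidAlgebra.of k G s.1) ∘ₗ
        LinearMap.inr k V (Refl G →₀ k) ∘ₗ Finsupp.lsingle s)

/-- The braiding on `Y_S(G)`. -/
def RootData.yBraiding (R : RootData G) :
    YSpace G ⊗[k] YSpace G →ₗ[k] YSpace G ⊗[k] YSpace G :=
  braiding R.yRep (yCoaction G)

/-- The braided Heisenberg double of `Y_S(G)`. -/
abbrev RootData.HeisenbergDouble (R : RootData G) := MinimalDouble R.yRep (yCoaction G)

variable (G) in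
/-- The quasicoaction `δ_{t,c}(v) = 1 ⊗ t v + ∑_s c_s s ⊗ (v - s(v))` on `V`
(for finite `G`, the sum is finite). -/
def cherednikCoaction (t : k) (c : Refl G → k) : Quasicoaction k G V :=
  t • TensorProduct.mk k (MonoidAlgebra k G) V 1 +
    ∑ᶠ s : Refl G, c s • TensorProduct.mk k (MonoidAlgebra k G) V (MonoidAlgebra.of k G s.1) ∘ₗ
      (1 - tautRep G s.1 : V →ₗ[k] V)

variable (G) in
/-- The ideal of `Ã(V, δ_{t,c})` generated by the commutators `[v, v']` and `[f, f']`. -/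
def cherednikIdeal (t : k) (c : Refl G → k) :
    TwoSidedIdeal (FreeDouble (tautRep G) (cherednikCoaction G t c)) :=
  TwoSidedIdeal.span
    ({x | ∃ v v' : V, x = lower _ _ (TensorAlgebra.ι k v * TensorAlgebra.ι k v' -
        TensorAlgebra.ι k v' * TensorAlgebra.ι k v)} ∪
      {x | ∃ f f' : Module.Dual k V, x = upper _ _ (TensorAlgebra.ι k f * TensorAlgebra.ι k f' -
        TensorAlgebra.ι k f' * TensorAlgebra.ι k f)})

variable (G) in
/-- The rational Cherednik algebra `H_{t,c}(G)`. -/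
abbrev CherednikAlgebra (t : k) (c : Refl G → k) :=
  QuotAlg (tautRep G) (cherednikCoaction G t c) (cherednikIdeal G t c)

/-- `μ(v) = t v ⊕ ⊕_s c_s ⟨α_s, v⟩ [s]`. -/
def RootData.mu [Finite G] (R : RootData G) (t : k) (c : Refl G → k) : V →ₗ[k] YSpace G :=
  (t • LinearMap.id).prod
    ((Finsupp.linearEquivFunOnFinite k k (Refl G)).symm.toLinearMap ∘ₗ
      LinearMap.pi fun s => c s • R.root s)

/-- `ν*(f) = f ⊕ ⊕_s ⟨f, α̌_s⟩ [s]*`: the functional on `Y_S(G)` that equals `f` on `V₁` and takes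
the value `⟨f, α̌_s⟩` at `[s]`. -/
def RootData.nuStar (R : RootData G) : Module.Dual k V →ₗ[k] Module.Dual k (YSpace G) where
  toFun f := LinearMap.coprod f (Finsupp.linearCombination k fun s => f (R.coroot s))
  map_add' f f' := by ext <;> simp
  map_smul' a f := by ext <;> simp

end Cherednik

end BraidedDouble

end

open scoped TensorProduct

noncomputable section

namespace BraidedDouble

/-! Every triangular ideal of `Ã(W, δ) = T(W) ⊗ kG ⊗ T(W*)` lies in the one spanned by the radicals
of the Harish-Chandra form `⟨b, a⟩ = (ε ⊗ ε ⊗ ε)(b a)` on `T(W*) × T(W)`. For a Yetter-Drinfeld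
module, the commutator of `f ∈ W*` with `a ∈ T(W)` is governed by the braided derivative of `a`
along `f`, so these radicals are the kernels of the braided factorials. The maps `μ` and `ν*`
preserve the `kG`-valued pairings, hence extend to the free doubles, and they send commutators to
elements of degree two killed by `1 + Ψ`, so the extension descends to the quotients.

The pairing of `μ(v)` with `f ⊕ 0 ∈ Y_S(G)*` is `t ⟨f, v⟩ 1`, so the commutator with `f ⊕ 0` acts on
the image of `T(V)` as `t` times the derivative along `f`. In characteristic zero no nonzero
subspace of `S(V)` without constant terms is stable under all partial derivatives; hence for `t ≠ 0`
no element of `S(V)` is lost under `μ`, and likewise none of `S(V*)` under `ν*`. -/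

/-! ### Tensor algebras -/

section TensorAlgebraInduction

variable {R M : Type*} [CommSemiring R] [AddCommMonoid M] [Module R M]

theorem mul_mem_of_ι_mul_mem {S : Submodule R (TensorAlgebra R M)}
    (h : ∀ m, ∀ a ∈ S, TensorAlgebra.ι R m * a ∈ S) (b : TensorAlgebra R M) :
    ∀ a ∈ S, b * a ∈ S := by
  induction b using TensorAlgebra.induction with
  | algebraMap r => intro a ha; rw [← Algebra.smul_def]; exact S.smul_mem _ ha
  | ι m => exact h m
  | mul b c hb hc => intro a ha; rw [mul_assoc]; exact hb _ (hc _ ha)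
  | add b c hb hc => intro a ha; rw [add_mul]; exact S.add_mem (hb _ ha) (hc _ ha)

theorem mul_mem_of_mul_ι_mem {S : Submodule R (TensorAlgebra R M)}
    (h : ∀ m, ∀ a ∈ S, a * TensorAlgebra.ι R m ∈ S) (b : TensorAlgebra R M) :
    ∀ a ∈ S, a * b ∈ S := by
  induction b using TensorAlgebra.induction with
  | algebraMap r =>
    intro a ha; rw [← Algebra.commutes, ← Algebra.smul_def]; exact S.smul_mem _ ha
  | ι m => exact h m
  | mul b c hb hc => intro a ha; rw [← mul_assoc]; exact hc _ (hb _ ha)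
  | add b c hb hc => intro a ha; rw [mul_add]; exact S.add_mem (hb _ ha) (hc _ ha)

theorem tensorAlgebra_induction_left {P : TensorAlgebra R M → Prop}
    (add : ∀ a b, P a → P b → P (a + b)) (smul : ∀ (r : R) a, P a → P (r • a)) (one : P 1)
    (ι_mul : ∀ m a, P a → P (TensorAlgebra.ι R m * a)) (a : TensorAlgebra R M) : P a :=
  mul_one a ▸ mul_mem_of_ι_mul_mem (S :=
    { carrier := {a | P a}, add_mem' := fun ha hb => add _ _ ha hb
      zero_mem' := by simpa using smul 0 1 one, smul_mem' := fun r _ ha => smul r _ ha })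
    ι_mul a 1 one

theorem tensorAlgebra_induction_right {P : TensorAlgebra R M → Prop}
    (add : ∀ a b, P a → P b → P (a + b)) (smul : ∀ (r : R) a, P a → P (r • a)) (one : P 1)
    (mul_ι : ∀ m a, P a → P (a * TensorAlgebra.ι R m)) (a : TensorAlgebra R M) : P a :=
  one_mul a ▸ mul_mem_of_mul_ι_mem (S :=
    { carrier := {a | P a}, add_mem' := fun ha hb => add _ _ ha hb
      zero_mem' := by simpa using smul 0 1 one, smul_mem' := fun r _ ha => smul r _ ha })
    mul_ι a 1 one

@[simp]
theorem algebraMapInv_ι (m : M) :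
    TensorAlgebra.algebraMapInv (R := R) (TensorAlgebra.ι R m) = 0 := by
  simp [TensorAlgebra.algebraMapInv]

end TensorAlgebraInduction

section TensorMap

variable {k M N P : Type*} [Field k] [AddCommGroup M] [Module k M] [AddCommGroup N] [Module k N]
  [AddCommGroup P] [Module k P]

@[simp]
theorem tensorMap_ι (φ : M →ₗ[k] N) (m : M) :
    tensorMap φ (TensorAlgebra.ι k m) = TensorAlgebra.ι k (φ m) := by
  simp [tensorMap]

@[simp]
theorem algebraMapInv_tensorMap (φ : M →ₗ[k] N) (a : TensorAlgebra k M) :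
    TensorAlgebra.algebraMapInv (tensorMap φ a) = TensorAlgebra.algebraMapInv (R := k) a := by
  have : (TensorAlgebra.algebraMapInv (R := k) (M := N)).comp (tensorMap φ) =
      TensorAlgebra.algebraMapInv := by
    ext m; simp
  exact DFunLike.congr_fun this a

theorem tensorMap_tensorMap (φ : M →ₗ[k] N) (ψ : N →ₗ[k] P) (a : TensorAlgebra k M) :
    tensorMap ψ (tensorMap φ a) = tensorMap (ψ ∘ₗ φ) a := by
  have : (tensorMap ψ).comp (tensorMap φ) = tensorMap (ψ ∘ₗ φ) := by ext m; simp
  exact DFunLike.congr_fun this a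

theorem tensorMap_id (a : TensorAlgebra k M) :
    tensorMap (LinearMap.id (R := k) (M := M)) a = a := by
  have : tensorMap (LinearMap.id (R := k) (M := M)) = AlgHom.id k _ := by ext m; simp
  exact DFunLike.congr_fun this a

end TensorMap

/-! ### The free double -/

section Pairing

variable {k G W : Type*} [Field k] [Group G] [AddCommGroup W] [Module k W]

/-- The pairing `β` as a bilinear map. -/
def pairingₗ (δ : Quasicoaction k G W) : Module.Dual k W →ₗ[k] W →ₗ[k] MonoidAlgebra k G :=
  LinearMap.mk₂ k (pairing δ)
    (fun f f' v => by simp [pairing, LinearMap.lTensor_add])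
    (fun r f v => by simp [pairing, LinearMap.lTensor_smul])
    (fun f v v' => by simp [pairing])
    (fun r f v => by simp [pairing])

@[simp]
theorem pairingₗ_apply (δ : Quasicoaction k G W) (f : Module.Dual k W) (v : W) :
    pairingₗ δ f v = pairing δ f v := rfl

theorem IsQuasiYetterDrinfeld.pairing_mul {ρ : Representation k G W} {δ : Quasicoaction k G W}
    (h : IsQuasiYetterDrinfeld ρ δ) (f : Module.Dual k W) (g : G) (v : W) :
    pairing δ f (ρ g v) * MonoidAlgebra.of k G g =
      MonoidAlgebra.of k G g * pairing δ (f ∘ₗ ρ g) v := by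
  let contract (f : Module.Dual k W) : MonoidAlgebra k G ⊗[k] W →ₗ[k] MonoidAlgebra k G :=
    (TensorProduct.rid k _).toLinearMap ∘ₗ f.lTensor (MonoidAlgebra k G)
  have hright : contract f ∘ₗ
      TensorProduct.map (LinearMap.mulRight k (MonoidAlgebra.of k G g)) LinearMap.id =
      LinearMap.mulRight k (MonoidAlgebra.of k G g) ∘ₗ contract f :=
    TensorProduct.ext' fun x y => by simp [contract]
  have hleft : contract f ∘ₗ
      TensorProduct.map (LinearMap.mulLeft k (MonoidAlgebra.of k G g)) (ρ g) =
      LinearMap.mulLeft k (MonoidAlgebra.of k G g) ∘ₗ contract (f ∘ₗ ρ g) :=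
    TensorProduct.ext' fun x y => by simp [contract]
  calc pairing δ f (ρ g v) * MonoidAlgebra.of k G g
      = contract f (TensorProduct.map (LinearMap.mulRight k (MonoidAlgebra.of k G g)) LinearMap.id
          (δ (ρ g v))) := (LinearMap.congr_fun hright _).symm
    _ = contract f (TensorProduct.map (LinearMap.mulLeft k (MonoidAlgebra.of k G g)) (ρ g)
          (δ v)) := congrArg (contract f) (h g v)
    _ = MonoidAlgebra.of k G g * pairing δ (f ∘ₗ ρ g) v := LinearMap.congr_fun hleft _

end Pairing

section Relations

variable {k G W : Type*} [Field k] [Group G] [AddCommGroup W] [Module k W]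
  (ρ : Representation k G W) (δ : Quasicoaction k G W)

theorem lower_ι (v : W) : lower ρ δ (TensorAlgebra.ι k v) = FreeDouble.proj ρ δ (genV v) :=
  TensorAlgebra.lift_ι_apply _ _

theorem upper_ι (f : Module.Dual k W) :
    upper ρ δ (TensorAlgebra.ι k f) = FreeDouble.proj ρ δ (genF f) :=
  TensorAlgebra.lift_ι_apply _ _

theorem mid_eq (h : MonoidAlgebra k G) : mid ρ δ h = FreeDouble.proj ρ δ (genH h) := rfl

@[simp]
theorem mid_one : mid ρ δ 1 = 1 := by
  rw [mid_eq, ← map_one (FreeDouble.proj ρ δ)]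
  exact RingQuot.mkAlgHom_rel k Rel.one

theorem mid_mul (a b : MonoidAlgebra k G) : mid ρ δ (a * b) = mid ρ δ a * mid ρ δ b := by
  rw [mid_eq, mid_eq, mid_eq, ← map_mul]
  exact RingQuot.mkAlgHom_rel k (Rel.mul a b)

theorem mid_mul_lower_ι (g : G) (v : W) :
    mid ρ δ (MonoidAlgebra.of k G g) * lower ρ δ (TensorAlgebra.ι k v) =
      lower ρ δ (TensorAlgebra.ι k (ρ g v)) * mid ρ δ (MonoidAlgebra.of k G g) := by
  rw [mid_eq, lower_ι, lower_ι, ← map_mul, ← map_mul]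
  exact RingQuot.mkAlgHom_rel k (Rel.left g v)

theorem upper_ι_mul_mid (f : Module.Dual k W) (g : G) :
    upper ρ δ (TensorAlgebra.ι k f) * mid ρ δ (MonoidAlgebra.of k G g) =
      mid ρ δ (MonoidAlgebra.of k G g) * upper ρ δ (TensorAlgebra.ι k (f ∘ₗ ρ g)) := by
  rw [mid_eq, upper_ι, upper_ι, ← map_mul, ← map_mul]
  exact RingQuot.mkAlgHom_rel k (Rel.right f g)

theorem upper_ι_mul_lower_ι (f : Module.Dual k W) (v : W) :
    upper ρ δ (TensorAlgebra.ι k f) * lower ρ δ (TensorAlgebra.ι k v) =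
      lower ρ δ (TensorAlgebra.ι k v) * upper ρ δ (TensorAlgebra.ι k f) +
        mid ρ δ (pairing δ f v) := by
  rw [mid_eq, upper_ι, lower_ι, ← map_mul, ← map_mul, ← map_add]
  exact RingQuot.mkAlgHom_rel k (Rel.comm f v)

theorem mid_mul_lower (g : G) (a : TensorAlgebra k W) :
    mid ρ δ (MonoidAlgebra.of k G g) * lower ρ δ a =
      lower ρ δ (tensorMap (ρ g) a) * mid ρ δ (MonoidAlgebra.of k G g) := by
  induction a using TensorAlgebra.induction with
  | algebraMap r => simp [Algebra.commutes]
  | ι m => rw [mid_mul_lower_ι, tensorMap_ι]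
  | mul a b ha hb => rw [map_mul, map_mul, map_mul, ← mul_assoc, ha, mul_assoc, hb, mul_assoc]
  | add a b ha hb => simp only [map_add, mul_add, add_mul, ha, hb]

/-- The right action of `g ∈ G` on `T(W*)`, which extends `f ↦ f ∘ g`. -/
abbrev dualAct (ρ : Representation k G W) (g : G) :
    TensorAlgebra k (Module.Dual k W) →ₐ[k] TensorAlgebra k (Module.Dual k W) :=
  tensorMap (ρ g).dualMap

theorem upper_mul_mid (b : TensorAlgebra k (Module.Dual k W)) (g : G) :
    upper ρ δ b * mid ρ δ (MonoidAlgebra.of k G g) =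
      mid ρ δ (MonoidAlgebra.of k G g) * upper ρ δ (dualAct ρ g b) := by
  induction b using TensorAlgebra.induction with
  | algebraMap r => simp [Algebra.commutes]
  | ι f => rw [upper_ι_mul_mid, tensorMap_ι]; rfl
  | mul a b ha hb => rw [map_mul, map_mul, map_mul, mul_assoc, hb, ← mul_assoc, ha, mul_assoc]
  | add a b ha hb => simp only [map_add, mul_add, add_mul, ha, hb]

theorem FreeDouble.induction {P : FreeDouble ρ δ → Prop} (add : ∀ x y, P x → P y → P (x + y))
    (mul : ∀ x y, P x → P y → P (x * y)) (algebraMap : ∀ r : k, P (algebraMap k _ r))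
    (lower_ι : ∀ v, P (lower ρ δ (TensorAlgebra.ι k v)))
    (mid_of : ∀ g, P (mid ρ δ (MonoidAlgebra.of k G g)))
    (upper_ι : ∀ f, P (upper ρ δ (TensorAlgebra.ι k f))) (x : FreeDouble ρ δ) : P x := by
  have hmid : ∀ h, P (mid ρ δ h) := by
    intro h
    induction h using MonoidAlgebra.induction_on with
    | of g => exact mid_of g
    | add a b ha hb => rw [map_add]; exact add _ _ ha hb
    | smul r a ha => rw [map_smul, Algebra.smul_def]; exact mul _ _ (algebraMap r) ha
  obtain ⟨y, rfl⟩ : ∃ y, FreeDouble.proj ρ δ y = x := RingQuot.mkAlgHom_surjective k _ x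
  induction y using TensorAlgebra.induction with
  | algebraMap r => rw [AlgHom.commutes]; exact algebraMap r
  | ι m =>
    obtain ⟨v, h, f⟩ := m
    have : TensorAlgebra.ι k ((v, h, f) : Gen k G W) = genV v + genH h + genF f := by
      simp [genV, genH, genF, ← map_add]
    rw [this, map_add, map_add, ← BraidedDouble.lower_ι, ← mid_eq, ← BraidedDouble.upper_ι]
    exact add _ _ (add _ _ (lower_ι v) (hmid h)) (upper_ι f)
  | mul a b ha hb => rw [map_mul]; exact mul _ _ ha hb
  | add a b ha hb => rw [map_add]; exact add _ _ ha hb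

theorem FreeDouble.mul_mem_left {S : Submodule k (FreeDouble ρ δ)}
    (lower_ι : ∀ v, ∀ x ∈ S, lower ρ δ (TensorAlgebra.ι k v) * x ∈ S)
    (mid_of : ∀ g, ∀ x ∈ S, mid ρ δ (MonoidAlgebra.of k G g) * x ∈ S)
    (upper_ι : ∀ f, ∀ x ∈ S, upper ρ δ (TensorAlgebra.ι k f) * x ∈ S) (y : FreeDouble ρ δ) :
    ∀ x ∈ S, y * x ∈ S := by
  induction y using FreeDouble.induction with
  | add a b ha hb => intro x hx; rw [add_mul]; exact S.add_mem (ha x hx) (hb x hx)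
  | mul a b ha hb => intro x hx; rw [mul_assoc]; exact ha _ (hb _ hx)
  | algebraMap r => intro x hx; rw [← Algebra.smul_def]; exact S.smul_mem _ hx
  | lower_ι v => exact lower_ι v
  | mid_of g => exact mid_of g
  | upper_ι f => exact upper_ι f

theorem FreeDouble.mul_mem_right {S : Submodule k (FreeDouble ρ δ)}
    (lower_ι : ∀ v, ∀ x ∈ S, x * lower ρ δ (TensorAlgebra.ι k v) ∈ S)
    (mid_of : ∀ g, ∀ x ∈ S, x * mid ρ δ (MonoidAlgebra.of k G g) ∈ S)
    (upper_ι : ∀ f, ∀ x ∈ S, x * upper ρ δ (TensorAlgebra.ι k f) ∈ S) (y : FreeDouble ρ δ) :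
    ∀ x ∈ S, x * y ∈ S := by
  induction y using FreeDouble.induction with
  | add a b ha hb => intro x hx; rw [mul_add]; exact S.add_mem (ha x hx) (hb x hx)
  | mul a b ha hb => intro x hx; rw [← mul_assoc]; exact hb _ (ha _ hx)
  | algebraMap r =>
    intro x hx; rw [← Algebra.commutes, ← Algebra.smul_def]; exact S.smul_mem _ hx
  | lower_ι v => exact lower_ι v
  | mid_of g => exact mid_of g
  | upper_ι f => exact upper_ι f

/-- The universal property of `Ã(W, δ)`: the homomorphism given by `φ`, `χ` and `ψ` on `W`, `kG`
and `W*`. -/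
def FreeDouble.lift {A : Type*} [Semiring A] [Algebra k A] (φ : W →ₗ[k] A)
    (χ : MonoidAlgebra k G →ₐ[k] A) (ψ : Module.Dual k W →ₗ[k] A)
    (hφ : ∀ g v, χ (MonoidAlgebra.of k G g) * φ v = φ (ρ g v) * χ (MonoidAlgebra.of k G g))
    (hψ : ∀ f g, ψ f * χ (MonoidAlgebra.of k G g) = χ (MonoidAlgebra.of k G g) * ψ (f ∘ₗ ρ g))
    (hφψ : ∀ f v, ψ f * φ v = φ v * ψ f + χ (pairing δ f v)) : FreeDouble ρ δ →ₐ[k] A :=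
  RingQuot.liftAlgHom k ⟨TensorAlgebra.lift k (φ.coprod (χ.toLinearMap.coprod ψ)), by
    intro x y h
    cases h with
    | one => simp [genH]
    | mul a b => simp [genH]
    | left g v => simpa [genH, genV] using hφ g v
    | right f g => simpa [genH, genF] using hψ f g
    | comm f v => simpa [genH, genF, genV] using hφψ f v⟩

section

variable {A : Type*} [Semiring A] [Algebra k A] (φ : W →ₗ[k] A)
  (χ : MonoidAlgebra k G →ₐ[k] A) (ψ : Module.Dual k W →ₗ[k] A)
  (hφ : ∀ g v, χ (MonoidAlgebra.of k G g) * φ v = φ (ρ g v) * χ (MonoidAlgebra.of k G g))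
  (hψ : ∀ f g, ψ f * χ (MonoidAlgebra.of k G g) = χ (MonoidAlgebra.of k G g) * ψ (f ∘ₗ ρ g))
  (hφψ : ∀ f v, ψ f * φ v = φ v * ψ f + χ (pairing δ f v))

@[simp]
theorem FreeDouble.lift_lower_ι (v : W) :
    FreeDouble.lift ρ δ φ χ ψ hφ hψ hφψ (lower ρ δ (TensorAlgebra.ι k v)) = φ v := by
  rw [lower_ι, FreeDouble.lift, FreeDouble.proj, RingQuot.liftAlgHom_mkAlgHom_apply]
  simp [genV]

@[simp]
theorem FreeDouble.lift_mid (h : MonoidAlgebra k G) :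
    FreeDouble.lift ρ δ φ χ ψ hφ hψ hφψ (mid ρ δ h) = χ h := by
  rw [mid_eq, FreeDouble.lift, FreeDouble.proj, RingQuot.liftAlgHom_mkAlgHom_apply]
  simp [genH]

@[simp]
theorem FreeDouble.lift_upper_ι (f : Module.Dual k W) :
    FreeDouble.lift ρ δ φ χ ψ hφ hψ hφψ (upper ρ δ (TensorAlgebra.ι k f)) = ψ f := by
  rw [upper_ι, FreeDouble.lift, FreeDouble.proj, RingQuot.liftAlgHom_mkAlgHom_apply]
  simp [genF]

end

end Relations

/-! ### Triangular decomposition of the free double -/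

section Induced

variable {k G W X : Type*} [Field k] [Group G] [AddCommGroup W] [Module k W] [AddCommGroup X]
  [Module k X]

/-- Left multiplication by `W` on `T(W) ⊗ X`. -/
def inducedMul : W →ₗ[k] Module.End k (TensorAlgebra k W ⊗[k] X) :=
  LinearMap.rTensorHom X ∘ₗ LinearMap.mul k (TensorAlgebra k W) ∘ₗ TensorAlgebra.ι k

@[simp]
theorem inducedMul_tmul (v : W) (a : TensorAlgebra k W) (x : X) :
    inducedMul (X := X) v (a ⊗ₜ[k] x) = (TensorAlgebra.ι k v * a) ⊗ₜ[k] x := by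
  simp [inducedMul]

variable (ρ : Representation k G W) (δ : Quasicoaction k G W)
  (σ : Representation k G X) (F : Module.Dual k W →ₗ[k] Module.End k X)

/-- The diagonal action of `G` on `T(W) ⊗ X`. -/
def inducedRep : Representation k G (TensorAlgebra k W ⊗[k] X) where
  toFun g := TensorProduct.map (tensorMap (ρ g)).toLinearMap (σ g)
  map_one' := TensorProduct.ext' fun a x => by
    rw [TensorProduct.map_tmul, map_one, map_one]
    exact congrArg (· ⊗ₜ[k] x) (tensorMap_id a)
  map_mul' g h := TensorProduct.ext' fun a x => by
    rw [TensorProduct.map_tmul, map_mul, map_mul]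
    exact congrArg (· ⊗ₜ[k] σ g (σ h x)) (tensorMap_tensorMap (ρ h) (ρ g) a).symm

@[simp]
theorem inducedRep_tmul (g : G) (a : TensorAlgebra k W) (x : X) :
    inducedRep ρ σ g (a ⊗ₜ[k] x) = tensorMap (ρ g) a ⊗ₜ[k] σ g x := rfl

theorem inducedRep_mul_inducedMul (g : G) (v : W) :
    inducedRep ρ σ g * inducedMul v = inducedMul (ρ g v) * inducedRep ρ σ g := by
  ext a x
  simp

/-- The recursion step for the action of `W*` on `T(W) ⊗ X`: it turns the pair of `a ⊗ x` and
`f ↦ f · (a ⊗ x)` into the same pair for `v a ⊗ x`, following `f v = v f + β(f, v)`. -/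
def inducedStep : W →ₗ[k] Module.End k
    ((TensorAlgebra k W ⊗[k] X) × (Module.Dual k W →ₗ[k] TensorAlgebra k W ⊗[k] X)) :=
  LinearMap.mk₂ k (fun v p => (inducedMul v p.1, inducedMul v ∘ₗ p.2 +
      ((inducedRep ρ σ).asAlgebraHom.toLinearMap.flip p.1) ∘ₗ (pairingₗ δ).flip v))
    (fun v v' p => by ext1 <;> simp [LinearMap.add_comp, LinearMap.comp_add]; abel)
    (fun r v p => by ext1 <;> simp [LinearMap.smul_comp, LinearMap.comp_smul])
    (fun v p p' => by ext1 <;> simp [LinearMap.add_comp, LinearMap.comp_add]; abel)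
    (fun r v p => by ext1 <;> simp [LinearMap.smul_comp, LinearMap.comp_smul])

theorem inducedStep_apply (v : W)
    (p : (TensorAlgebra k W ⊗[k] X) × (Module.Dual k W →ₗ[k] TensorAlgebra k W ⊗[k] X)) :
    inducedStep ρ δ σ v p = (inducedMul v p.1, inducedMul v ∘ₗ p.2 +
      ((inducedRep ρ σ).asAlgebraHom.toLinearMap.flip p.1) ∘ₗ (pairingₗ δ).flip v) := rfl

/-- The start of the recursion: `1 ⊗ x` and `f ↦ 1 ⊗ f x`. -/
def inducedStart : X →ₗ[k]
    (TensorAlgebra k W ⊗[k] X) × (Module.Dual k W →ₗ[k] TensorAlgebra k W ⊗[k] X) :=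
  (TensorProduct.mk k _ X 1).prod ((LinearMap.llcomp k _ _ _ (TensorProduct.mk k _ X 1)) ∘ₗ F.flip)

/-- The action of `W*` on `T(W) ⊗ X`. -/
def inducedDual : Module.Dual k W →ₗ[k] Module.End k (TensorAlgebra k W ⊗[k] X) :=
  LinearMap.flip (LinearMap.snd k _ _ ∘ₗ TensorProduct.lift
    (LinearMap.lcomp k _ (inducedStart F) ∘ₗ
      (TensorAlgebra.lift k (inducedStep ρ δ σ)).toLinearMap))

theorem inducedDual_one_tmul (f : Module.Dual k W) (x : X) :
    inducedDual ρ δ σ F f (1 ⊗ₜ[k] x) = 1 ⊗ₜ[k] F f x := by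
  simp [inducedDual, inducedStart]

theorem lift_inducedStep_inducedStart_fst (a : TensorAlgebra k W) (x : X) :
    (TensorAlgebra.lift k (inducedStep ρ δ σ) a (inducedStart F x)).1 = a ⊗ₜ[k] x := by
  induction a using tensorAlgebra_induction_left with
  | add a b ha hb => simp [ha, hb, TensorProduct.add_tmul]
  | smul r a ha => simp [ha, TensorProduct.smul_tmul']
  | one => simp [inducedStart]
  | ι_mul v a ha => simp [inducedStep_apply, ha]

theorem inducedDual_ι_mul_tmul (f : Module.Dual k W) (v : W) (a : TensorAlgebra k W) (x : X) :
    inducedDual ρ δ σ F f ((TensorAlgebra.ι k v * a) ⊗ₜ[k] x) =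
      inducedMul v (inducedDual ρ δ σ F f (a ⊗ₜ[k] x)) +
        (inducedRep ρ σ).asAlgebraHom (pairing δ f v) (a ⊗ₜ[k] x) := by
  have := lift_inducedStep_inducedStart_fst ρ δ σ F a x
  simp [inducedDual, inducedStep_apply, this]

variable {ρ δ σ F}

theorem inducedDual_mul_inducedRep (hq : IsQuasiYetterDrinfeld ρ δ)
    (hF : ∀ f g, F f * σ g = σ g * F (f ∘ₗ ρ g)) (f : Module.Dual k W) (g : G) :
    inducedDual ρ δ σ F f * inducedRep ρ σ g =
      inducedRep ρ σ g * inducedDual ρ δ σ F (f ∘ₗ ρ g) := by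
  refine TensorProduct.ext' fun a x => ?_
  simp only [Module.End.mul_apply]
  induction a using tensorAlgebra_induction_left with
  | add a b ha hb => simp only [TensorProduct.add_tmul, map_add, ha, hb]
  | smul r a ha => simp only [← TensorProduct.smul_tmul', map_smul, ha]
  | one =>
    simp only [inducedRep_tmul, map_one, inducedDual_one_tmul]
    exact congrArg _ (LinearMap.congr_fun (hF f g) x)
  | ι_mul v a ha =>
    have hβ := congrArg (fun y => (inducedRep ρ σ).asAlgebraHom y (a ⊗ₜ[k] x))
      (hq.pairing_mul f g v)
    simp only [map_mul, Module.End.mul_apply, Representation.asAlgebraHom_of] at hβ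
    rw [inducedRep_tmul, map_mul, tensorMap_ι, inducedDual_ι_mul_tmul, inducedDual_ι_mul_tmul,
      ← inducedRep_tmul, ha, hβ, map_add]
    congr 1
    exact (LinearMap.congr_fun (inducedRep_mul_inducedMul ρ σ g v) _).symm

/-- The `Ã(W, δ)`-module `T(W) ⊗ X` induced from a module `X` over `G` and `T(W*)`. -/
def inducedModule (hq : IsQuasiYetterDrinfeld ρ δ)
    (hF : ∀ f g, F f * σ g = σ g * F (f ∘ₗ ρ g)) :
    FreeDouble ρ δ →ₐ[k] Module.End k (TensorAlgebra k W ⊗[k] X) :=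
  FreeDouble.lift ρ δ inducedMul (inducedRep ρ σ).asAlgebraHom (inducedDual ρ δ σ F)
    (fun g v => by rw [Representation.asAlgebraHom_of, inducedRep_mul_inducedMul])
    (fun f g => by rw [Representation.asAlgebraHom_of, inducedDual_mul_inducedRep hq hF])
    (fun f v => TensorProduct.ext' fun a x => inducedDual_ι_mul_tmul ρ δ σ F f v a x)

variable (hq : IsQuasiYetterDrinfeld ρ δ) (hF : ∀ f g, F f * σ g = σ g * F (f ∘ₗ ρ g))

theorem inducedModule_lower_tmul (a a' : TensorAlgebra k W) (x : X) :
    inducedModule hq hF (lower ρ δ a) (a' ⊗ₜ[k] x) = (a * a') ⊗ₜ[k] x := by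
  induction a using tensorAlgebra_induction_left with
  | add a b ha hb =>
    simp only [map_add, LinearMap.add_apply, ha, hb, add_mul, TensorProduct.add_tmul]
  | smul r a ha =>
    simp only [map_smul, LinearMap.smul_apply, ha, smul_mul_assoc, TensorProduct.smul_tmul']
  | one => simp
  | ι_mul v a ha =>
    rw [map_mul, map_mul, Module.End.mul_apply, ha, inducedModule, FreeDouble.lift_lower_ι,
      inducedMul_tmul, mul_assoc]

theorem inducedModule_mid_of_one_tmul (g : G) (x : X) :
    inducedModule hq hF (mid ρ δ (MonoidAlgebra.of k G g)) (1 ⊗ₜ[k] x) = 1 ⊗ₜ[k] σ g x := by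
  rw [inducedModule, FreeDouble.lift_mid, Representation.asAlgebraHom_of, inducedRep_tmul, map_one]

theorem inducedModule_upper_ι_one_tmul (f : Module.Dual k W) (x : X) :
    inducedModule hq hF (upper ρ δ (TensorAlgebra.ι k f)) (1 ⊗ₜ[k] x) = 1 ⊗ₜ[k] F f x := by
  rw [inducedModule, FreeDouble.lift_upper_ι, inducedDual_one_tmul]

end Induced

section Regular

variable {k G W : Type*} [Field k] [Group G] [AddCommGroup W] [Module k W]

variable (k G W) in
/-- The left regular action of `G` on `kG ⊗ T(W*)`, realised as the space of finitely supported
functions `G →₀ T(W*)`. -/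
def regularRep : Representation k G (G →₀ TensorAlgebra k (Module.Dual k W)) where
  toFun g := Finsupp.lmapDomain _ k (g * ·)
  map_one' := by ext; simp
  map_mul' g h := by ext; simp [mul_assoc]

/-- The action `f · (g ⊗ b) = g ⊗ (f ∘ g) b` of `W*` on `kG ⊗ T(W*)`, realised as
`G →₀ T(W*)`. -/
def regularDual (ρ : Representation k G W) : Module.Dual k W →ₗ[k]
    Module.End k (G →₀ TensorAlgebra k (Module.Dual k W)) where
  toFun f := Finsupp.lsum k fun g =>
    Finsupp.lsingle g ∘ₗ LinearMap.mulLeft k (TensorAlgebra.ι k (f ∘ₗ ρ g))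
  map_add' f f' := by ext; simp [LinearMap.add_comp, add_mul]
  map_smul' r f := by ext; simp [LinearMap.smul_comp]

theorem regularRep_single (g g' : G) (b : TensorAlgebra k (Module.Dual k W)) :
    regularRep k G W g (Finsupp.single g' b) = Finsupp.single (g * g') b :=
  Finsupp.mapDomain_single

theorem regularDual_single (ρ : Representation k G W) (f : Module.Dual k W) (g : G)
    (b : TensorAlgebra k (Module.Dual k W)) :
    regularDual ρ f (Finsupp.single g b) =
      Finsupp.single g (TensorAlgebra.ι k (f ∘ₗ ρ g) * b) := by
  simp [regularDual]

theorem regularDual_mul_regularRep (ρ : Representation k G W) (f : Module.Dual k W) (g : G) :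
    regularDual ρ f * regularRep k G W g = regularRep k G W g * regularDual ρ (f ∘ₗ ρ g) :=
  Finsupp.lhom_ext fun g' b => by
    simp only [Module.End.mul_apply, regularRep_single, regularDual_single, map_mul]
    rfl

variable {ρ : Representation k G W} {δ : Quasicoaction k G W}

theorem inducedModule_upper_one_tmul_single_one (hq : IsQuasiYetterDrinfeld ρ δ)
    (b b' : TensorAlgebra k (Module.Dual k W)) :
    inducedModule hq (regularDual_mul_regularRep ρ) (upper ρ δ b)
      (1 ⊗ₜ[k] Finsupp.single 1 b') = 1 ⊗ₜ[k] Finsupp.single 1 (b * b') := by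
  induction b using tensorAlgebra_induction_left with
  | add a b ha hb =>
    simp only [map_add, LinearMap.add_apply, ha, hb, add_mul, Finsupp.single_add,
      TensorProduct.tmul_add]
  | smul r a ha =>
    simp only [map_smul, LinearMap.smul_apply, ha, smul_mul_assoc, ← Finsupp.smul_single,
      TensorProduct.tmul_smul]
  | one => simp
  | ι_mul f b hb =>
    rw [map_mul, map_mul, Module.End.mul_apply, hb, inducedModule_upper_ι_one_tmul,
      regularDual_single, map_one ρ, mul_assoc]
    rfl

theorem inducedModule_tri_one_tmul_single_one (hq : IsQuasiYetterDrinfeld ρ δ)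
    (a : TensorAlgebra k W) (g : G) (b : TensorAlgebra k (Module.Dual k W)) :
    inducedModule hq (regularDual_mul_regularRep ρ) (tri ρ δ a (MonoidAlgebra.of k G g) b)
      (1 ⊗ₜ[k] Finsupp.single 1 1) = a ⊗ₜ[k] Finsupp.single g b := by
  rw [tri, map_mul, map_mul, Module.End.mul_apply, Module.End.mul_apply,
    inducedModule_upper_one_tmul_single_one, inducedModule_mid_of_one_tmul, regularRep_single,
    inducedModule_lower_tmul, mul_one, mul_one, mul_one]

end Regular

section FreeDecomposition

variable {k G W : Type*} [Field k] [Group G] [AddCommGroup W] [Module k W]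

variable (ρ : Representation k G W) (δ : Quasicoaction k G W)

/-- The multiplication map `T(W) ⊗ kG ⊗ T(W*) → Ã(W, δ)`. -/
def triMap : (TensorAlgebra k W ⊗[k] MonoidAlgebra k G) ⊗[k] TensorAlgebra k (Module.Dual k W) →ₗ[k]
    FreeDouble ρ δ :=
  LinearMap.mul' k _ ∘ₗ TensorProduct.map
    (LinearMap.mul' k _ ∘ₗ TensorProduct.map (lower ρ δ).toLinearMap (mid ρ δ))
    (upper ρ δ).toLinearMap

@[simp]
theorem triMap_tmul (a : TensorAlgebra k W) (h : MonoidAlgebra k G)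
    (b : TensorAlgebra k (Module.Dual k W)) : triMap ρ δ (a ⊗ₜ h ⊗ₜ b) = tri ρ δ a h b := rfl

variable {ρ δ}

theorem triMap_injective (hq : IsQuasiYetterDrinfeld ρ δ) : Function.Injective (triMap ρ δ) := by
  classical
  let Θ := inducedModule hq (regularDual_mul_regularRep ρ)
  let ev := LinearMap.applyₗ (1 ⊗ₜ[k] Finsupp.single 1 1) ∘ₗ Θ.toLinearMap
  let e := TensorProduct.assoc k (TensorAlgebra k W) (MonoidAlgebra k G)
      (TensorAlgebra k (Module.Dual k W)) ≪≫ₗ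
    ((MonoidAlgebra.coeffLinearEquiv k).rTensor _ ≪≫ₗ
      TensorProduct.finsuppScalarLeft k _ G).lTensor _
  have hev : ev ∘ₗ triMap ρ δ = e.toLinearMap := by
    refine TensorProduct.ext_threefold fun a x b => ?_
    induction x using MonoidAlgebra.induction_on with
    | of g =>
      refine (inducedModule_tri_one_tmul_single_one hq a g b).trans ?_
      simp [e, TensorProduct.finsuppScalarLeft_apply_tmul]
    | add x y hx hy => simp only [TensorProduct.add_tmul, TensorProduct.tmul_add, map_add, hx, hy]
    | smul r x hx => simp only [← TensorProduct.smul_tmul', TensorProduct.tmul_smul, map_smul, hx]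
  refine Function.Injective.of_comp (f := ev) ?_
  rw [← LinearMap.coe_comp, hev]
  exact e.injective

end FreeDecomposition

section TriSpan

variable {k G W : Type*} [Field k] [Group G] [AddCommGroup W] [Module k W]
  {ρ : Representation k G W} {δ : Quasicoaction k G W}

variable (ρ δ) in
/-- The subspace `I⁻ ⊗ kG ⊗ T(W*) + T(W) ⊗ kG ⊗ I⁺` of `Ã(W, δ)`. -/
def triSpan (Im : Submodule k (TensorAlgebra k W))
    (Ip : Submodule k (TensorAlgebra k (Module.Dual k W))) : Submodule k (FreeDouble ρ δ) :=
  Submodule.span k {x | ∃ a h b, (a ∈ Im ∨ b ∈ Ip) ∧ x = tri ρ δ a h b}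

variable {Im : Submodule k (TensorAlgebra k W)}
  {Ip : Submodule k (TensorAlgebra k (Module.Dual k W))}

theorem tri_mem_triSpan {a : TensorAlgebra k W} {b : TensorAlgebra k (Module.Dual k W)}
    (hab : a ∈ Im ∨ b ∈ Ip) (h : MonoidAlgebra k G) : tri ρ δ a h b ∈ triSpan ρ δ Im Ip :=
  Submodule.subset_span ⟨a, h, b, hab, rfl⟩

theorem lower_mem_triSpan {a : TensorAlgebra k W} (ha : a ∈ Im) :
    lower ρ δ a ∈ triSpan ρ δ Im Ip := by
  simpa [tri] using tri_mem_triSpan (ρ := ρ) (δ := δ) (Ip := Ip) (b := 1) (Or.inl ha) 1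

theorem upper_mem_triSpan {b : TensorAlgebra k (Module.Dual k W)} (hb : b ∈ Ip) :
    upper ρ δ b ∈ triSpan ρ δ Im Ip := by
  simpa [tri] using tri_mem_triSpan (ρ := ρ) (δ := δ) (Im := Im) (a := 1) (Or.inr hb) 1

theorem triSpan_le {S : Submodule k (FreeDouble ρ δ)}
    (h : ∀ a g b, a ∈ Im ∨ b ∈ Ip → tri ρ δ a (MonoidAlgebra.of k G g) b ∈ S) :
    triSpan ρ δ Im Ip ≤ S := by
  refine Submodule.span_le.2 ?_
  rintro _ ⟨a, y, b, hab, rfl⟩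
  induction y using MonoidAlgebra.induction_on with
  | of g => exact h a g b hab
  | add y z hy hz =>
    rw [tri, map_add, mul_add, add_mul]
    exact S.add_mem hy hz
  | smul r y hy =>
    rw [tri, map_smul, mul_smul_comm, smul_mul_assoc]
    exact S.smul_mem r hy

theorem triSpan_bot : triSpan ρ δ ⊥ ⊥ = ⊥ := by
  refine le_bot_iff.1 (triSpan_le ?_)
  rintro a g b (rfl | rfl) <;> simp [tri]

theorem lower_mul_tri (a' a : TensorAlgebra k W) (h : MonoidAlgebra k G)
    (b : TensorAlgebra k (Module.Dual k W)) :
    lower ρ δ a' * tri ρ δ a h b = tri ρ δ (a' * a) h b := by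
  simp only [tri, map_mul, mul_assoc]

theorem tri_mul_upper (a : TensorAlgebra k W) (h : MonoidAlgebra k G)
    (b b' : TensorAlgebra k (Module.Dual k W)) :
    tri ρ δ a h b * upper ρ δ b' = tri ρ δ a h (b * b') := by
  rw [tri, tri, map_mul, mul_assoc]

theorem mid_mul_tri (g : G) (a : TensorAlgebra k W) (h : MonoidAlgebra k G)
    (b : TensorAlgebra k (Module.Dual k W)) :
    mid ρ δ (MonoidAlgebra.of k G g) * tri ρ δ a h b =
      tri ρ δ (tensorMap (ρ g) a) (MonoidAlgebra.of k G g * h) b := by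
  rw [tri, tri, mid_mul, ← mul_assoc, ← mul_assoc, mid_mul_lower, ← mul_assoc]

theorem tri_mul_mid (a : TensorAlgebra k W) (h : MonoidAlgebra k G)
    (b : TensorAlgebra k (Module.Dual k W)) (g : G) :
    tri ρ δ a h b * mid ρ δ (MonoidAlgebra.of k G g) =
      tri ρ δ a (h * MonoidAlgebra.of k G g) (dualAct ρ g b) := by
  rw [tri, tri, mid_mul, mul_assoc, upper_mul_mid, mul_assoc, mul_assoc, mul_assoc]

theorem upper_ι_mul_lower_mem_triSpan_top (f : Module.Dual k W) (a : TensorAlgebra k W) :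
    upper ρ δ (TensorAlgebra.ι k f) * lower ρ δ a ∈ triSpan ρ δ ⊤ ⊤ := by
  induction a using tensorAlgebra_induction_left with
  | add a b ha hb => rw [map_add, mul_add]; exact Submodule.add_mem _ ha hb
  | smul r a ha => rw [map_smul, mul_smul_comm]; exact Submodule.smul_mem _ r ha
  | one => rw [map_one, mul_one]; exact upper_mem_triSpan Submodule.mem_top
  | ι_mul v a ha =>
    rw [map_mul, ← mul_assoc, upper_ι_mul_lower_ι, add_mul, mul_assoc]
    refine Submodule.add_mem _ ?_ ?_
    · have : triSpan ρ δ ⊤ ⊤ ≤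
          (triSpan ρ δ ⊤ ⊤).comap (LinearMap.mulLeft k (lower ρ δ (TensorAlgebra.ι k v))) :=
        triSpan_le fun a g b _ => by
          simpa [lower_mul_tri] using tri_mem_triSpan (Or.inl Submodule.mem_top) _
      exact this ha
    · induction pairing δ f v using MonoidAlgebra.induction_on with
      | of g =>
        rw [mid_mul_lower]
        simpa [tri] using tri_mem_triSpan (ρ := ρ) (δ := δ) (Im := ⊤) (Ip := ⊤)
          (a := tensorMap (ρ g) a) (b := 1) (Or.inl Submodule.mem_top) (MonoidAlgebra.of k G g)
      | add x y hx hy => rw [map_add, add_mul]; exact Submodule.add_mem _ hx hy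
      | smul r x hx => rw [map_smul, smul_mul_assoc]; exact Submodule.smul_mem _ r hx

variable (ρ δ) in
theorem triSpan_top : triSpan ρ δ ⊤ ⊤ = ⊤ := by
  have mul_mem : ∀ x, ∀ y ∈ triSpan ρ δ ⊤ ⊤, x * y ∈ triSpan ρ δ ⊤ ⊤ := by
    have of_generator {x : FreeDouble ρ δ}
        (h : ∀ a g b, x * tri ρ δ a (MonoidAlgebra.of k G g) b ∈ triSpan ρ δ ⊤ ⊤) :
        ∀ y ∈ triSpan ρ δ ⊤ ⊤, x * y ∈ triSpan ρ δ ⊤ ⊤ := fun y hy =>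
      (triSpan_le (S := (triSpan ρ δ ⊤ ⊤).comap (LinearMap.mulLeft k x))
        fun a g b _ => h a g b) hy
    refine FreeDouble.mul_mem_left ρ δ (fun v => of_generator fun a g b => ?_)
      (fun h => of_generator fun a g b => ?_) (fun f => of_generator fun a g b => ?_)
    · rw [lower_mul_tri]; exact tri_mem_triSpan (Or.inl Submodule.mem_top) _
    · rw [mid_mul_tri]; exact tri_mem_triSpan (Or.inl Submodule.mem_top) _
    · have : triSpan ρ δ ⊤ ⊤ ≤ (triSpan ρ δ ⊤ ⊤).comap
          (LinearMap.mulRight k (mid ρ δ (MonoidAlgebra.of k G g) * upper ρ δ b)) :=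
        triSpan_le fun a' g' b' _ => by
          rw [Submodule.mem_comap, LinearMap.mulRight_apply, ← mul_assoc, tri_mul_mid,
            tri_mul_upper]
          exact tri_mem_triSpan (Or.inl Submodule.mem_top) _
      simpa [tri, mul_assoc] using this (upper_ι_mul_lower_mem_triSpan_top f a)
  have one_mem : (1 : FreeDouble ρ δ) ∈ triSpan ρ δ ⊤ ⊤ :=
    map_one (lower ρ δ) ▸ lower_mem_triSpan Submodule.mem_top
  exact eq_top_iff.2 fun x _ => mul_one x ▸ mul_mem x 1 one_mem

theorem FreeDouble.tri_induction {P : FreeDouble ρ δ → Prop}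
    (add : ∀ x y, P x → P y → P (x + y)) (smul : ∀ (r : k) x, P x → P (r • x))
    (tri : ∀ a g b, P (tri ρ δ a (MonoidAlgebra.of k G g) b)) (x : FreeDouble ρ δ) : P x := by
  let S : Submodule k (FreeDouble ρ δ) :=
    { carrier := {x | P x}, add_mem' := fun hx hy => add _ _ hx hy
      zero_mem' := by simpa using smul 0 _ (tri 0 1 0), smul_mem' := fun r _ hx => smul r _ hx }
  have : triSpan ρ δ ⊤ ⊤ ≤ S := triSpan_le fun a g b _ => tri a g b
  exact this ((triSpan_top ρ δ).symm ▸ Submodule.mem_top)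

theorem triMap_surjective : Function.Surjective (triMap ρ δ) := by
  intro x
  induction x using FreeDouble.tri_induction with
  | add x y hx hy =>
    obtain ⟨z, rfl⟩ := hx
    obtain ⟨w, rfl⟩ := hy
    exact ⟨z + w, map_add _ z w⟩
  | smul r x hx =>
    obtain ⟨z, rfl⟩ := hx
    exact ⟨r • z, map_smul _ r z⟩
  | tri a g b => exact ⟨a ⊗ₜ MonoidAlgebra.of k G g ⊗ₜ b, rfl⟩

/-- The linear isomorphism `T(W) ⊗ kG ⊗ T(W*) ≅ Ã(W, δ)` given by multiplication. -/
def triEquiv (hq : IsQuasiYetterDrinfeld ρ δ) :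
    (TensorAlgebra k W ⊗[k] MonoidAlgebra k G) ⊗[k] TensorAlgebra k (Module.Dual k W) ≃ₗ[k]
      FreeDouble ρ δ :=
  LinearEquiv.ofBijective (triMap ρ δ) ⟨triMap_injective hq, triMap_surjective⟩

@[simp]
theorem triEquiv_symm_tri (hq : IsQuasiYetterDrinfeld ρ δ) (a : TensorAlgebra k W)
    (h : MonoidAlgebra k G) (b : TensorAlgebra k (Module.Dual k W)) :
    (triEquiv hq).symm (tri ρ δ a h b) = a ⊗ₜ h ⊗ₜ b :=
  (triEquiv hq).symm_apply_apply (a ⊗ₜ h ⊗ₜ b)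

end TriSpan

/-! ### Triangular ideals -/

section TriangularIdeal

variable {k G W : Type*} [Field k] [Group G] [AddCommGroup W] [Module k W]
  {ρ : Representation k G W} {δ : Quasicoaction k G W}
  {Im : Submodule k (TensorAlgebra k W)} {Ip : Submodule k (TensorAlgebra k (Module.Dual k W))}
  {J : TwoSidedIdeal (FreeDouble ρ δ)}

theorem toQuot_surjective (J : TwoSidedIdeal (FreeDouble ρ δ)) :
    Function.Surjective (toQuot ρ δ J) := Quotient.mk_surjective

theorem toQuot_eq_zero {x : FreeDouble ρ δ} : toQuot ρ δ J x = 0 ↔ x ∈ J :=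
  Quotient.eq.trans (TwoSidedIdeal.mem_iff J x).symm

theorem hasTriangularDecomposition (hq : IsQuasiYetterDrinfeld ρ δ)
    (hJ : (J : Set (FreeDouble ρ δ)) = triSpan ρ δ Im Ip) :
    HasTriangularDecomposition ρ δ Im Ip J := by
  have mem_J {x : FreeDouble ρ δ} : x ∈ J ↔ x ∈ triSpan ρ δ Im Ip := Set.ext_iff.1 hJ x
  have lower_mem : Im ≤ LinearMap.ker ((toQuot ρ δ J).toLinearMap ∘ₗ (lower ρ δ).toLinearMap) :=
    fun a ha => toQuot_eq_zero.2 <| mem_J.2 <| lower_mem_triSpan ha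
  have upper_mem : Ip ≤ LinearMap.ker ((toQuot ρ δ J).toLinearMap ∘ₗ (upper ρ δ).toLinearMap) :=
    fun b hb => toQuot_eq_zero.2 <| mem_J.2 <| upper_mem_triSpan hb
  let π := TensorProduct.map (TensorProduct.map Im.mkQ (LinearMap.id (M := MonoidAlgebra k G)))
    Ip.mkQ
  have hπ : Function.Surjective π := TensorProduct.map_surjective
    (TensorProduct.map_surjective Im.mkQ_surjective Function.surjective_id) Ip.mkQ_surjective
  let e := LinearMap.mul' k _ ∘ₗ TensorProduct.map
    (LinearMap.mul' k _ ∘ₗ TensorProduct.map (Im.liftQ _ lower_mem)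
      ((toQuot ρ δ J).toLinearMap ∘ₗ mid ρ δ)) (Ip.liftQ _ upper_mem)
  have he : e ∘ₗ π = (toQuot ρ δ J).toLinearMap ∘ₗ triMap ρ δ :=
    TensorProduct.ext_threefold fun a h b => by simp [e, π, tri]
  have hker : triSpan ρ δ Im Ip ≤ LinearMap.ker (π ∘ₗ (triEquiv hq).symm.toLinearMap) :=
    triSpan_le fun a g b hab => by
      rcases hab with ha | hb
      · simp [π, (Submodule.Quotient.mk_eq_zero Im).2 ha]
      · simp [π, (Submodule.Quotient.mk_eq_zero Ip).2 hb]
  refine ⟨LinearEquiv.ofBijective e ⟨?_, ?_⟩, fun a h b => LinearMap.congr_fun he (a ⊗ₜ h ⊗ₜ b)⟩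
  · intro z z' hz
    obtain ⟨y, rfl⟩ := hπ z
    obtain ⟨y', rfl⟩ := hπ z'
    have hy : toQuot ρ δ J (triEquiv hq (y - y')) = 0 := by
      rw [map_sub, map_sub, sub_eq_zero]
      exact (LinearMap.congr_fun he y).symm.trans (hz.trans (LinearMap.congr_fun he y'))
    simpa [sub_eq_zero] using hker (mem_J.1 (toQuot_eq_zero.1 hy))
  · refine Function.Surjective.of_comp (g := π) ?_
    rw [← LinearMap.coe_comp, he]
    exact (toQuot_surjective J).comp triMap_surjective

theorem IsTriangularIdeal.isBraidedDouble (hq : IsQuasiYetterDrinfeld ρ δ)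
    (hJ : IsTriangularIdeal ρ δ Im Ip J) : IsBraidedDouble ρ δ Im Ip J where
  compat := hq
  free := hasTriangularDecomposition hq (by rw [triSpan_bot, TwoSidedIdeal.coe_bot]; rfl)
  triangular := hJ
  decomposition := hasTriangularDecomposition hq hJ.carrier_eq

end TriangularIdeal

section LowerUpperIdeal

variable {k G W : Type*} [Field k] [Group G] [AddCommGroup W] [Module k W]
  {ρ : Representation k G W} {δ : Quasicoaction k G W}
  {Im : Submodule k (TensorAlgebra k W)} {Ip : Submodule k (TensorAlgebra k (Module.Dual k W))}

variable (ρ δ Im) in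
/-- The right ideal of `Ã(W, δ)` generated by `I⁻ ⊂ T(W)`. -/
def lowerSpan : Submodule k (FreeDouble ρ δ) := Im.map (lower ρ δ).toLinearMap * ⊤

variable (ρ δ Ip) in
/-- The left ideal of `Ã(W, δ)` generated by `I⁺ ⊂ T(W*)`. -/
def upperSpan : Submodule k (FreeDouble ρ δ) := ⊤ * Ip.map (upper ρ δ).toLinearMap

theorem lower_mul_mem_lowerSpan {a : TensorAlgebra k W} (ha : a ∈ Im) (x : FreeDouble ρ δ) :
    lower ρ δ a * x ∈ lowerSpan ρ δ Im :=
  Submodule.mul_mem_mul (Submodule.mem_map_of_mem ha) Submodule.mem_top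

theorem mul_upper_mem_upperSpan {b : TensorAlgebra k (Module.Dual k W)} (hb : b ∈ Ip)
    (x : FreeDouble ρ δ) : x * upper ρ δ b ∈ upperSpan ρ δ Ip :=
  Submodule.mul_mem_mul Submodule.mem_top (Submodule.mem_map_of_mem hb)

theorem lowerSpan_le {S : Submodule k (FreeDouble ρ δ)}
    (h : ∀ a ∈ Im, ∀ x, lower ρ δ a * x ∈ S) : lowerSpan ρ δ Im ≤ S := by
  refine Submodule.mul_le.2 ?_
  rintro _ ⟨a, ha, rfl⟩ x -
  exact h a ha x

theorem upperSpan_le {S : Submodule k (FreeDouble ρ δ)}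
    (h : ∀ b ∈ Ip, ∀ x, x * upper ρ δ b ∈ S) : upperSpan ρ δ Ip ≤ S := by
  refine Submodule.mul_le.2 ?_
  rintro x - _ ⟨b, hb, rfl⟩
  exact h b hb x

theorem mul_mem_lowerSpan {x : FreeDouble ρ δ} (hx : x ∈ lowerSpan ρ δ Im)
    (y : FreeDouble ρ δ) : x * y ∈ lowerSpan ρ δ Im :=
  lowerSpan_le (S := (lowerSpan ρ δ Im).comap (LinearMap.mulRight k y)) (fun a ha z => by
    rw [Submodule.mem_comap, LinearMap.mulRight_apply, mul_assoc]
    exact lower_mul_mem_lowerSpan ha _) hx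

theorem mul_mem_upperSpan {x : FreeDouble ρ δ} (hx : x ∈ upperSpan ρ δ Ip)
    (y : FreeDouble ρ δ) : y * x ∈ upperSpan ρ δ Ip :=
  upperSpan_le (S := (upperSpan ρ δ Ip).comap (LinearMap.mulLeft k y)) (fun b hb z => by
    rw [Submodule.mem_comap, LinearMap.mulLeft_apply, ← mul_assoc]
    exact mul_upper_mem_upperSpan hb _) hx

variable (ρ δ) in
theorem triSpan_eq_sup (hm : ∀ x, ∀ a ∈ Im, a * x ∈ Im) (hp : ∀ x, ∀ b ∈ Ip, x * b ∈ Ip) :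
    triSpan ρ δ Im Ip = lowerSpan ρ δ Im ⊔ upperSpan ρ δ Ip := by
  refine le_antisymm (triSpan_le ?_) (sup_le ?_ ?_)
  · rintro a g b (ha | hb)
    · rw [tri, mul_assoc]
      exact Submodule.mem_sup_left (lower_mul_mem_lowerSpan ha _)
    · exact Submodule.mem_sup_right (mul_upper_mem_upperSpan hb _)
  · refine lowerSpan_le fun a ha x => ?_
    induction x using FreeDouble.tri_induction with
    | add x y hx hy => rw [mul_add]; exact Submodule.add_mem _ hx hy
    | smul r x hx => rw [mul_smul_comm]; exact Submodule.smul_mem _ r hx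
    | tri a' g b => rw [lower_mul_tri]; exact tri_mem_triSpan (Or.inl (hm a' a ha)) _
  · refine upperSpan_le fun b hb x => ?_
    induction x using FreeDouble.tri_induction with
    | add x y hx hy => rw [add_mul]; exact Submodule.add_mem _ hx hy
    | smul r x hx => rw [smul_mul_assoc]; exact Submodule.smul_mem _ r hx
    | tri a g b' => rw [tri_mul_upper]; exact tri_mem_triSpan (Or.inr (hp b' b hb)) _

variable (ρ δ Im) in
/-- `I⁻` is a `G`-stable two-sided ideal of `T(W)` such that the right ideal `I⁻ Ã(W, δ)` is stable
under left multiplication by `W*`. -/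
structure IsLowerIdeal : Prop where
  mul_mem_left : ∀ x, ∀ a ∈ Im, x * a ∈ Im
  mul_mem_right : ∀ x, ∀ a ∈ Im, a * x ∈ Im
  act_mem : ∀ g, ∀ a ∈ Im, tensorMap (ρ g) a ∈ Im
  upper_ι_mul_mem : ∀ f, ∀ a ∈ Im,
    upper ρ δ (TensorAlgebra.ι k f) * lower ρ δ a ∈ lowerSpan ρ δ Im

variable (ρ δ Ip) in
/-- `I⁺` is a `G`-stable two-sided ideal of `T(W*)` such that the left ideal `Ã(W, δ) I⁺` is stable
under right multiplication by `W`. -/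
structure IsUpperIdeal : Prop where
  mul_mem_left : ∀ x, ∀ b ∈ Ip, x * b ∈ Ip
  mul_mem_right : ∀ x, ∀ b ∈ Ip, b * x ∈ Ip
  act_mem : ∀ g, ∀ b ∈ Ip, dualAct ρ g b ∈ Ip
  mul_lower_ι_mem : ∀ v, ∀ b ∈ Ip,
    upper ρ δ b * lower ρ δ (TensorAlgebra.ι k v) ∈ upperSpan ρ δ Ip

theorem mul_mem_lowerSpan_of_generators {y : FreeDouble ρ δ}
    (hy : ∀ a ∈ Im, y * lower ρ δ a ∈ lowerSpan ρ δ Im) {x : FreeDouble ρ δ}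
    (hx : x ∈ lowerSpan ρ δ Im) : y * x ∈ lowerSpan ρ δ Im :=
  lowerSpan_le (S := (lowerSpan ρ δ Im).comap (LinearMap.mulLeft k y)) (fun a ha z => by
    rw [Submodule.mem_comap, LinearMap.mulLeft_apply, ← mul_assoc]
    exact mul_mem_lowerSpan (hy a ha) z) hx

theorem mul_mem_upperSpan_of_generators {y : FreeDouble ρ δ}
    (hy : ∀ b ∈ Ip, upper ρ δ b * y ∈ upperSpan ρ δ Ip) {x : FreeDouble ρ δ}
    (hx : x ∈ upperSpan ρ δ Ip) : x * y ∈ upperSpan ρ δ Ip :=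
  upperSpan_le (S := (upperSpan ρ δ Ip).comap (LinearMap.mulRight k y)) (fun b hb z => by
    rw [Submodule.mem_comap, LinearMap.mulRight_apply, mul_assoc]
    exact mul_mem_upperSpan (hy b hb) z) hx

theorem lower_mul_lower_mem_lowerSpan {c : TensorAlgebra k W} (h : ∀ a ∈ Im, c * a ∈ Im) :
    ∀ a ∈ Im, lower ρ δ c * lower ρ δ a ∈ lowerSpan ρ δ Im := fun a ha => by
  rw [← map_mul, ← mul_one (lower ρ δ _)]
  exact lower_mul_mem_lowerSpan (h a ha) 1

theorem upper_mul_upper_mem_upperSpan {c : TensorAlgebra k (Module.Dual k W)}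
    (h : ∀ b ∈ Ip, b * c ∈ Ip) :
    ∀ b ∈ Ip, upper ρ δ b * upper ρ δ c ∈ upperSpan ρ δ Ip := fun b hb => by
  rw [← map_mul, ← one_mul (upper ρ δ _)]
  exact mul_upper_mem_upperSpan (h b hb) 1

theorem mid_mul_lower_mem_lowerSpan (act_mem : ∀ g, ∀ a ∈ Im, tensorMap (ρ g) a ∈ Im)
    (h : MonoidAlgebra k G) : ∀ a ∈ Im, mid ρ δ h * lower ρ δ a ∈ lowerSpan ρ δ Im := by
  intro a ha
  induction h using MonoidAlgebra.induction_on with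
  | of g => rw [mid_mul_lower]; exact lower_mul_mem_lowerSpan (act_mem g a ha) _
  | add h h' ih ih' => rw [map_add, add_mul]; exact Submodule.add_mem _ ih ih'
  | smul r h ih => rw [map_smul, smul_mul_assoc]; exact Submodule.smul_mem _ r ih

theorem upper_mul_mid_mem_upperSpan (act_mem : ∀ g, ∀ b ∈ Ip, dualAct ρ g b ∈ Ip)
    (h : MonoidAlgebra k G) : ∀ b ∈ Ip, upper ρ δ b * mid ρ δ h ∈ upperSpan ρ δ Ip := by
  intro b hb
  induction h using MonoidAlgebra.induction_on with
  | of g => rw [upper_mul_mid]; exact mul_upper_mem_upperSpan (act_mem g b hb) _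
  | add h h' ih ih' => rw [map_add, mul_add]; exact Submodule.add_mem _ ih ih'
  | smul r h ih => rw [map_smul, mul_smul_comm]; exact Submodule.smul_mem _ r ih

theorem IsLowerIdeal.mul_mem_lowerSpan (h : IsLowerIdeal ρ δ Im) {x : FreeDouble ρ δ}
    (hx : x ∈ lowerSpan ρ δ Im) (y : FreeDouble ρ δ) : y * x ∈ lowerSpan ρ δ Im :=
  FreeDouble.mul_mem_left ρ δ
    (fun _ _ => mul_mem_lowerSpan_of_generators (lower_mul_lower_mem_lowerSpan (h.mul_mem_left _)))
    (fun _ _ => mul_mem_lowerSpan_of_generators (mid_mul_lower_mem_lowerSpan h.act_mem _))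
    (fun f _ => mul_mem_lowerSpan_of_generators (h.upper_ι_mul_mem f)) y x hx

theorem IsUpperIdeal.mul_mem_upperSpan (h : IsUpperIdeal ρ δ Ip) {x : FreeDouble ρ δ}
    (hx : x ∈ upperSpan ρ δ Ip) (y : FreeDouble ρ δ) : x * y ∈ upperSpan ρ δ Ip :=
  FreeDouble.mul_mem_right ρ δ
    (fun v _ => mul_mem_upperSpan_of_generators (h.mul_lower_ι_mem v))
    (fun _ _ => mul_mem_upperSpan_of_generators (upper_mul_mid_mem_upperSpan h.act_mem _))
    (fun _ _ => mul_mem_upperSpan_of_generators (upper_mul_upper_mem_upperSpan (h.mul_mem_right _)))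
    y x hx

/-- The triangular ideal `I⁻ ⊗ kG ⊗ T(W*) + T(W) ⊗ kG ⊗ I⁺`. -/
def triangularIdeal (hm : IsLowerIdeal ρ δ Im) (hp : IsUpperIdeal ρ δ Ip) :
    TwoSidedIdeal (FreeDouble ρ δ) :=
  TwoSidedIdeal.mk' (lowerSpan ρ δ Im ⊔ upperSpan ρ δ Ip : Submodule k (FreeDouble ρ δ))
    (Submodule.zero_mem _) (Submodule.add_mem _) (Submodule.neg_mem _)
    (fun {x y} hy => by
      obtain ⟨a, ha, b, hb, rfl⟩ := Submodule.mem_sup.1 hy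
      exact mul_add x a b ▸ Submodule.add_mem_sup (hm.mul_mem_lowerSpan ha x)
        (mul_mem_upperSpan hb x))
    (fun {x y} hx => by
      obtain ⟨a, ha, b, hb, rfl⟩ := Submodule.mem_sup.1 hx
      exact add_mul a b y ▸ Submodule.add_mem_sup (mul_mem_lowerSpan ha y)
        (hp.mul_mem_upperSpan hb y))

theorem isTriangularIdeal_triangularIdeal (hm : IsLowerIdeal ρ δ Im) (hp : IsUpperIdeal ρ δ Ip)
    (hm' : Im ≤ positivePart k W) (hp' : Ip ≤ positivePart k (Module.Dual k W)) :
    IsTriangularIdeal ρ δ Im Ip (triangularIdeal hm hp) where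
  lower_pos := hm'
  upper_pos := hp'
  carrier_eq := (TwoSidedIdeal.coe_mk' _ _ _ _ _ _).trans
    (congrArg _ (triSpan_eq_sup ρ δ hm.mul_mem_right hp.mul_mem_left).symm)

end LowerUpperIdeal

/-! ### The Harish-Chandra form -/

section Form

variable {k G W : Type*} [Field k] [Group G] [AddCommGroup W] [Module k W]
  {ρ : Representation k G W} {δ : Quasicoaction k G W}

/-- The functional `ε ⊗ ε ⊗ ε` on `Ã(W, δ) = T(W) ⊗ kG ⊗ T(W*)`. -/
def vacuum (hq : IsQuasiYetterDrinfeld ρ δ) : FreeDouble ρ δ →ₗ[k] k :=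
  LinearMap.mul' k k ∘ₗ TensorProduct.map (LinearMap.mul' k k ∘ₗ
    TensorProduct.map TensorAlgebra.algebraMapInv.toLinearMap Coalgebra.counit)
    TensorAlgebra.algebraMapInv.toLinearMap ∘ₗ (triEquiv hq).symm.toLinearMap

variable (hq : IsQuasiYetterDrinfeld ρ δ)

theorem vacuum_tri (a : TensorAlgebra k W) (h : MonoidAlgebra k G)
    (b : TensorAlgebra k (Module.Dual k W)) : vacuum hq (tri ρ δ a h b) =
      TensorAlgebra.algebraMapInv a * Coalgebra.counit (R := k) h *
        TensorAlgebra.algebraMapInv b := by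
  simp [vacuum]

theorem vacuum_tri_of (a : TensorAlgebra k W) (g : G) (b : TensorAlgebra k (Module.Dual k W)) :
    vacuum hq (tri ρ δ a (MonoidAlgebra.of k G g) b) =
      TensorAlgebra.algebraMapInv a * TensorAlgebra.algebraMapInv b := by
  simp [vacuum]

theorem vacuum_lower (a : TensorAlgebra k W) :
    vacuum hq (lower ρ δ a) = TensorAlgebra.algebraMapInv a := by
  simpa [tri] using vacuum_tri hq a 1 1

theorem vacuum_upper (b : TensorAlgebra k (Module.Dual k W)) :
    vacuum hq (upper ρ δ b) = TensorAlgebra.algebraMapInv b := by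
  simpa [tri] using vacuum_tri hq 1 1 b

theorem vacuum_lower_ι_mul (v : W) (x : FreeDouble ρ δ) :
    vacuum hq (lower ρ δ (TensorAlgebra.ι k v) * x) = 0 := by
  induction x using FreeDouble.tri_induction with
  | add x y hx hy => rw [mul_add, map_add, hx, hy, add_zero]
  | smul r x hx => rw [mul_smul_comm, map_smul, hx, smul_zero]
  | tri a g b => rw [lower_mul_tri, vacuum_tri_of, map_mul, algebraMapInv_ι, zero_mul, zero_mul]

theorem vacuum_mul_upper_ι (f : Module.Dual k W) (x : FreeDouble ρ δ) :
    vacuum hq (x * upper ρ δ (TensorAlgebra.ι k f)) = 0 := by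
  induction x using FreeDouble.tri_induction with
  | add x y hx hy => rw [add_mul, map_add, hx, hy, add_zero]
  | smul r x hx => rw [smul_mul_assoc, map_smul, hx, smul_zero]
  | tri a g b => rw [tri_mul_upper, vacuum_tri_of, map_mul, algebraMapInv_ι, mul_zero, mul_zero]

theorem vacuum_mid_mul (g : G) (x : FreeDouble ρ δ) :
    vacuum hq (mid ρ δ (MonoidAlgebra.of k G g) * x) = vacuum hq x := by
  induction x using FreeDouble.tri_induction with
  | add x y hx hy => rw [mul_add, map_add, map_add, hx, hy]
  | smul r x hx => rw [mul_smul_comm, map_smul, map_smul, hx]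
  | tri a h b =>
    rw [mid_mul_tri, ← map_mul, vacuum_tri_of, vacuum_tri_of, algebraMapInv_tensorMap]

theorem vacuum_mul_mid (g : G) (x : FreeDouble ρ δ) :
    vacuum hq (x * mid ρ δ (MonoidAlgebra.of k G g)) = vacuum hq x := by
  induction x using FreeDouble.tri_induction with
  | add x y hx hy => rw [add_mul, map_add, map_add, hx, hy]
  | smul r x hx => rw [smul_mul_assoc, map_smul, map_smul, hx]
  | tri a h b =>
    rw [tri_mul_mid, ← map_mul, vacuum_tri_of, vacuum_tri_of, algebraMapInv_tensorMap]

/-- The Harish-Chandra form `⟨b, a⟩ = (ε ⊗ ε ⊗ ε)(b a)` on `T(W*) × T(W)`. -/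
def form : TensorAlgebra k (Module.Dual k W) →ₗ[k] TensorAlgebra k W →ₗ[k] k :=
  ((LinearMap.mul k (FreeDouble ρ δ)).compl₁₂ (upper ρ δ).toLinearMap
    (lower ρ δ).toLinearMap).compr₂ (vacuum hq)

theorem form_apply (b : TensorAlgebra k (Module.Dual k W)) (a : TensorAlgebra k W) :
    form hq b a = vacuum hq (upper ρ δ b * lower ρ δ a) := rfl

theorem form_one_left (a : TensorAlgebra k W) : form hq 1 a = TensorAlgebra.algebraMapInv a := by
  rw [form_apply, map_one, one_mul, vacuum_lower]

theorem form_one_right (b : TensorAlgebra k (Module.Dual k W)) :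
    form hq b 1 = TensorAlgebra.algebraMapInv b := by
  rw [form_apply, map_one, mul_one, vacuum_upper]

theorem form_dualAct (g : G) (b : TensorAlgebra k (Module.Dual k W)) (a : TensorAlgebra k W) :
    form hq (dualAct ρ g b) a = form hq b (tensorMap (ρ g) a) := by
  rw [form_apply, form_apply, ← vacuum_mid_mul hq g, ← mul_assoc, ← upper_mul_mid, mul_assoc,
    mid_mul_lower, ← mul_assoc, vacuum_mul_mid]

/-- The radical of the Harish-Chandra form in `T(W)`. -/
def lowerRadical : Submodule k (TensorAlgebra k W) := LinearMap.ker (form hq).flip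

/-- The radical of the Harish-Chandra form in `T(W*)`. -/
def upperRadical : Submodule k (TensorAlgebra k (Module.Dual k W)) := LinearMap.ker (form hq)

theorem mem_lowerRadical {a : TensorAlgebra k W} :
    a ∈ lowerRadical hq ↔ ∀ b, form hq b a = 0 := LinearMap.ext_iff

theorem mem_upperRadical {b : TensorAlgebra k (Module.Dual k W)} :
    b ∈ upperRadical hq ↔ ∀ a, form hq b a = 0 := LinearMap.ext_iff

theorem lowerRadical_le_positivePart : lowerRadical hq ≤ positivePart k W := fun a ha =>
  (form_one_left hq a).symm.trans ((mem_lowerRadical hq).1 ha 1)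

theorem upperRadical_le_positivePart : upperRadical hq ≤ positivePart k (Module.Dual k W) :=
  fun b hb => (form_one_right hq b).symm.trans ((mem_upperRadical hq).1 hb 1)

section

variable {Im : Submodule k (TensorAlgebra k W)}
  {Ip : Submodule k (TensorAlgebra k (Module.Dual k W))} {J : TwoSidedIdeal (FreeDouble ρ δ)}

theorem IsTriangularIdeal.vacuum_eq_zero (hJ : IsTriangularIdeal ρ δ Im Ip J) {x : FreeDouble ρ δ}
    (hx : x ∈ J) : vacuum hq x = 0 := by
  have : triSpan ρ δ Im Ip ≤ LinearMap.ker (vacuum hq) := triSpan_le fun a g b hab => by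
    rw [LinearMap.mem_ker, vacuum_tri_of]
    rcases hab with ha | hb
    · exact mul_eq_zero_of_left (hJ.lower_pos ha) _
    · exact mul_eq_zero_of_right _ (hJ.upper_pos hb)
  exact this ((Set.ext_iff.1 hJ.carrier_eq x).1 hx)

theorem IsTriangularIdeal.le_lowerRadical (hJ : IsTriangularIdeal ρ δ Im Ip J) :
    Im ≤ lowerRadical hq := fun a ha => (mem_lowerRadical hq).2 fun _ =>
  hJ.vacuum_eq_zero hq (J.mul_mem_left _ _
    ((Set.ext_iff.1 hJ.carrier_eq (lower ρ δ a)).2 (lower_mem_triSpan ha)))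

theorem IsTriangularIdeal.le_upperRadical (hJ : IsTriangularIdeal ρ δ Im Ip J) :
    Ip ≤ upperRadical hq := fun b hb => (mem_upperRadical hq).2 fun _ =>
  hJ.vacuum_eq_zero hq (J.mul_mem_right _ _
    ((Set.ext_iff.1 hJ.carrier_eq (upper ρ δ b)).2 (upper_mem_triSpan hb)))

theorem maximalTriangularIdeal_eq
    (hJ : IsTriangularIdeal ρ δ (lowerRadical hq) (upperRadical hq) J) :
    maximalTriangularIdeal ρ δ = J := by
  refine le_antisymm (sSup_le ?_) (le_sSup ⟨_, _, hJ⟩)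
  rintro J' ⟨Km, Kp, hJ'⟩
  rw [← SetLike.coe_subset_coe, hJ.carrier_eq, hJ'.carrier_eq]
  refine Submodule.span_mono ?_
  rintro _ ⟨a, h, b, hab, rfl⟩
  exact ⟨a, h, b, hab.imp (hJ'.le_lowerRadical hq ·) (hJ'.le_upperRadical hq ·), rfl⟩

end

end Form

/-! ### Braided integers and braided derivations -/

section BraidedInteger

variable {k M N : Type*} [Field k] [AddCommGroup M] [Module k M] [AddCommGroup N] [Module k N]

/-- The contraction `b ⊗ x ↦ ⟨f, x⟩ b` of the last leg with `f`. -/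
def contract (f : Module.Dual k M) : N ⊗[k] M →ₗ[k] N :=
  (TensorProduct.rid k N).toLinearMap ∘ₗ f.lTensor N

@[simp]
theorem contract_tmul (f : Module.Dual k M) (b : N) (x : M) :
    contract f (b ⊗ₜ[k] x) = f x • b := by
  simp [contract]

theorem contract_add (f f' : Module.Dual k M) (z : N ⊗[k] M) :
    contract (f + f') z = contract f z + contract f' z := by
  simp [contract, LinearMap.lTensor_add]

theorem contract_smul (r : k) (f : Module.Dual k M) (z : N ⊗[k] M) :
    contract (r • f) z = r • contract f z := by
  simp [contract, LinearMap.lTensor_smul]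

theorem eq_zero_of_contract_eq_zero {z : N ⊗[k] M} (h : ∀ f, contract f z = 0) : z = 0 := by
  classical
  let b := Module.Basis.ofVectorSpace k M
  let e := TensorProduct.equivFinsuppOfBasisRight (M := N) b
  have he (z i) : e z i = contract (b.coord i) z := by
    induction z using TensorProduct.induction_on with
    | zero => simp
    | tmul x y => simp [e]
    | add x y hx hy => simp only [map_add, Finsupp.add_apply, hx, hy]
  exact e.injective (Finsupp.ext fun i => by rw [he, h, map_zero, Finsupp.zero_apply])

theorem lastLegs_tmul (Ψ : M ⊗[k] M →ₗ[k] M ⊗[k] M) (b : TensorAlgebra k M) (x y : M) :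
    lastLegs Ψ (b ⊗ₜ[k] x ⊗ₜ[k] y) =
      (LinearMap.mulLeft k b ∘ₗ TensorAlgebra.ι k).rTensor M (Ψ (x ⊗ₜ[k] y)) := by
  simp only [lastLegs, LinearMap.comp_apply, LinearEquiv.coe_coe, TensorProduct.assoc_tmul,
    LinearMap.lTensor_tmul]
  generalize Ψ (x ⊗ₜ[k] y) = z
  induction z using TensorProduct.induction_on with
  | zero => simp
  | tmul x y => simp
  | add x y hx hy => simp only [TensorProduct.tmul_add, map_add, hx, hy]

variable (Ψ : M ⊗[k] M →ₗ[k] M ⊗[k] M)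

@[simp]
theorem braidedInteger_one : braidedInteger Ψ 1 = 0 := by
  simp [braidedInteger]

theorem braidedInteger_mul_ι (a : TensorAlgebra k M) (y : M) :
    braidedInteger Ψ (a * TensorAlgebra.ι k y) =
      a ⊗ₜ[k] y + lastLegs Ψ (braidedInteger Ψ a ⊗ₜ[k] y) := by
  let Λ := TensorAlgebra.lift k ((MulOpposite.opLinearEquiv k).toLinearMap ∘ₗ braidedStep Ψ)
  have step (a : TensorAlgebra k M) (y : M) : (Λ (a * TensorAlgebra.ι k y)).unop (1, 0) =
      braidedStep Ψ y ((Λ a).unop (1, 0)) := by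
    simp [Λ]
  have fst_eq (a : TensorAlgebra k M) : ((Λ a).unop (1, 0)).1 = a := by
    induction a using tensorAlgebra_induction_right with
    | add a b ha hb => simp [ha, hb]
    | smul r a ha => simp [ha]
    | one => simp
    | mul_ι m a ha => rw [step]; exact congrArg (· * TensorAlgebra.ι k m) ha
  have snd_eq := congrArg Prod.snd (step a y)
  have := fst_eq a
  simp only [braidedStep, LinearMap.mk₂_apply, this] at snd_eq
  exact snd_eq

theorem mul_ι_injective : Function.Injective
    (LinearMap.mul' k (TensorAlgebra k M) ∘ₗ (TensorAlgebra.ι k).lTensor (TensorAlgebra k M)) := by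
  -- For the zero braiding, the braided integer is a left inverse.
  have : braidedInteger 0 ∘ₗ (LinearMap.mul' k (TensorAlgebra k M) ∘ₗ
      (TensorAlgebra.ι k).lTensor (TensorAlgebra k M)) = LinearMap.id :=
    TensorProduct.ext' fun a y => by simp [braidedInteger_mul_ι, lastLegs]
  exact Function.LeftInverse.injective (g := braidedInteger 0) (LinearMap.congr_fun this)

/-- The braided derivation `∂_f = (id ⊗ f) ∘ [n]_Ψ`. -/
def braidedDeriv (f : Module.Dual k M) : TensorAlgebra k M →ₗ[k] TensorAlgebra k M :=
  contract f ∘ₗ braidedInteger Ψ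

theorem braidedDeriv_apply (f : Module.Dual k M) (a : TensorAlgebra k M) :
    braidedDeriv Ψ f a = contract f (braidedInteger Ψ a) := rfl

@[simp]
theorem braidedDeriv_one (f : Module.Dual k M) : braidedDeriv Ψ f 1 = 0 := by
  rw [braidedDeriv_apply, braidedInteger_one, map_zero]

theorem braidedFactorial_succ_eq_zero {n : ℕ} {a : TensorAlgebra k M} :
    braidedFactorial Ψ (n + 1) a = 0 ↔ ∀ f, braidedFactorial Ψ n (braidedDeriv Ψ f a) = 0 := by
  have factorial_succ : braidedFactorial Ψ (n + 1) a = (LinearMap.mul' k (TensorAlgebra k M) ∘ₗ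
      (TensorAlgebra.ι k).lTensor (TensorAlgebra k M))
        ((braidedFactorial Ψ n).rTensor M (braidedInteger Ψ a)) := by
    rw [LinearMap.comp_apply, ← LinearMap.comp_apply (LinearMap.lTensor _ _),
      LinearMap.lTensor_comp_rTensor]
    rfl
  have factorial_deriv (f) : braidedFactorial Ψ n (braidedDeriv Ψ f a) =
      contract f ((braidedFactorial Ψ n).rTensor M (braidedInteger Ψ a)) := by
    rw [braidedDeriv_apply]
    generalize braidedInteger Ψ a = z
    induction z using TensorProduct.induction_on with
    | zero => simp
    | tmul x y => simp
    | add x y hx hy => simp only [map_add, hx, hy]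
  rw [factorial_succ, LinearMap.map_eq_zero_iff _ mul_ι_injective]
  refine ⟨fun h f => by rw [factorial_deriv, h, map_zero], fun h => ?_⟩
  exact eq_zero_of_contract_eq_zero fun f => by rw [← factorial_deriv, h]

theorem braidedFactorial_zero_eq_zero {a : TensorAlgebra k M} :
    braidedFactorial Ψ 0 a = 0 ↔ a ∈ positivePart k M :=
  TensorAlgebra.algebraMap_eq_zero_iff M _

theorem worKer_le_positivePart : worKer Ψ ≤ positivePart k M := fun _ ha =>
  (braidedFactorial_zero_eq_zero Ψ).1 ((Submodule.mem_iInf _).1 ha 0)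

variable {Ψ}

theorem braidedDeriv_mem_worKer {a : TensorAlgebra k M} (ha : a ∈ worKer Ψ) (f : Module.Dual k M) :
    braidedDeriv Ψ f a ∈ worKer Ψ :=
  (Submodule.mem_iInf _).2 fun n =>
    (braidedFactorial_succ_eq_zero Ψ).1 ((Submodule.mem_iInf _).1 ha (n + 1)) f

theorem le_worKer {S : Submodule k (TensorAlgebra k M)} (h0 : S ≤ positivePart k M)
    (h : ∀ a ∈ S, ∀ f, braidedDeriv Ψ f a ∈ S) : S ≤ worKer Ψ := by
  intro a ha
  refine (Submodule.mem_iInf _).2 fun n => ?_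
  induction n generalizing a with
  | zero => exact (braidedFactorial_zero_eq_zero Ψ).2 (h0 ha)
  | succ n ih => exact (braidedFactorial_succ_eq_zero Ψ).2 fun f => ih (h a ha f)

theorem mem_worKer_of_braidedInteger_eq_zero {a : TensorAlgebra k M}
    (h0 : a ∈ positivePart k M) (h : braidedInteger Ψ a = 0) : a ∈ worKer Ψ := by
  refine le_worKer (S := positivePart k M ⊓ LinearMap.ker (braidedInteger Ψ)) inf_le_left
    (fun a ha f => ?_) ⟨h0, h⟩
  rw [braidedDeriv_apply, LinearMap.mem_ker.1 ha.2, map_zero]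
  exact zero_mem _

end BraidedInteger

/-! ### Gradings by group elements -/

section Grading

variable {k G W : Type*} [Field k] [Group G] [AddCommGroup W] [Module k W]
  {ρ : Representation k G W} {δ : Quasicoaction k G W}

/-- `x ∈ W` is homogeneous of degree `g` for the coaction `δ`. -/
def IsHomogeneousVec (δ : Quasicoaction k G W) (g : G) (x : W) : Prop :=
  δ x = MonoidAlgebra.of k G g ⊗ₜ[k] x

/-- `f ∈ W*` is homogeneous of degree `g`: it vanishes on the vectors of any other degree. The
condition is phrased through the pairing, so that it does not refer to homogeneous vectors. -/
def IsHomogeneousDual (δ : Quasicoaction k G W) (g : G) (f : Module.Dual k W) : Prop :=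
  ∀ x, pairing δ f x = f x • MonoidAlgebra.of k G g

/-- Homogeneous elements span `W` and `W*`; a coaction on a finite-dimensional space is such a
grading. -/
structure IsGrading (δ : Quasicoaction k G W) : Prop where
  span_vec : Submodule.span k {x | ∃ g, IsHomogeneousVec δ g x} = ⊤
  span_dual : Submodule.span k {f | ∃ g, IsHomogeneousDual δ g f} = ⊤

theorem IsGrading.induction_vec (hδ : IsGrading δ) {P : W → Prop}
    (add : ∀ x y, P x → P y → P (x + y)) (smul : ∀ (r : k) x, P x → P (r • x))
    (homogeneous : ∀ g x, IsHomogeneousVec δ g x → P x) (x : W) : P x := by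
  have hx : x ∈ Submodule.span k {x | ∃ g, IsHomogeneousVec δ g x} :=
    hδ.span_vec ▸ Submodule.mem_top
  induction hx using Submodule.span_induction with
  | mem x hx => obtain ⟨g, hx⟩ := hx; exact homogeneous g x hx
  | zero => exact homogeneous 1 0 (by simp [IsHomogeneousVec])
  | add x y _ _ hx hy => exact add x y hx hy
  | smul r x _ hx => exact smul r x hx

theorem IsGrading.induction_dual (hδ : IsGrading δ) {P : Module.Dual k W → Prop}
    (add : ∀ f f', P f → P f' → P (f + f')) (smul : ∀ (r : k) f, P f → P (r • f))
    (homogeneous : ∀ g f, IsHomogeneousDual δ g f → P f) (f : Module.Dual k W) : P f := by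
  have hf : f ∈ Submodule.span k {f | ∃ g, IsHomogeneousDual δ g f} :=
    hδ.span_dual ▸ Submodule.mem_top
  induction hf using Submodule.span_induction with
  | mem f hf => obtain ⟨g, hf⟩ := hf; exact homogeneous g f hf
  | zero => exact homogeneous 1 0 fun x => by simp [pairing]
  | add f f' _ _ hf hf' => exact add f f' hf hf'
  | smul r f _ hf => exact smul r f hf

theorem IsHomogeneousVec.pairing_eq {g : G} {x : W} (hx : IsHomogeneousVec δ g x)
    (f : Module.Dual k W) : pairing δ f x = f x • MonoidAlgebra.of k G g := by
  rw [pairing, hx]; simp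

theorem IsHomogeneousDual.apply_eq_zero_or {g h : G} {f : Module.Dual k W} {x : W}
    (hf : IsHomogeneousDual δ g f) (hx : IsHomogeneousVec δ h x) : f x = 0 ∨ g = h :=
  or_iff_not_imp_left.2 fun hfx => MonoidAlgebra.of_injective
    (smul_right_injective _ hfx ((hf x).symm.trans (hx.pairing_eq f)))

theorem IsHomogeneousVec.braiding_tmul {g : G} {x : W} (hx : IsHomogeneousVec δ g x) (y : W) :
    braiding ρ δ (x ⊗ₜ[k] y) = ρ g y ⊗ₜ[k] x := by
  have h : δ x = MonoidAlgebra.of k G g ⊗ₜ[k] x := hx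
  simp only [braiding, LinearMap.comp_apply, LinearMap.rTensor_tmul, h, LinearEquiv.coe_coe,
    TensorProduct.assoc_tmul, LinearMap.lTensor_tmul, TensorProduct.comm_tmul,
    TensorProduct.assoc_symm_tmul, TensorProduct.lift.tmul, AlgHom.toLinearMap_apply,
    Representation.asAlgebraHom_of]

theorem braidedDeriv_mul_ι (hδ : IsGrading δ) {g : G} {f : Module.Dual k W}
    (hf : IsHomogeneousDual δ g f) (a : TensorAlgebra k W) (y : W) :
    braidedDeriv (braiding ρ δ) f (a * TensorAlgebra.ι k y) =
      f y • a + braidedDeriv (braiding ρ δ) f a * TensorAlgebra.ι k (ρ g y) := by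
  have contract_lastLegs (z : TensorAlgebra k W ⊗[k] W) :
      contract f (lastLegs (braiding ρ δ) (z ⊗ₜ[k] y)) =
        contract f z * TensorAlgebra.ι k (ρ g y) := by
    induction z using TensorProduct.induction_on with
    | zero => simp
    | add z z' hz hz' => simp only [TensorProduct.add_tmul, map_add, hz, hz', add_mul]
    | tmul a x =>
      induction x using hδ.induction_vec with
      | add x x' hx hx' =>
        simp only [TensorProduct.tmul_add, TensorProduct.add_tmul, map_add, hx, hx', add_mul]
      | smul r x hx =>
        simp only [TensorProduct.tmul_smul, ← TensorProduct.smul_tmul', map_smul, hx,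
          smul_mul_assoc]
      | homogeneous h x hx =>
        rw [lastLegs_tmul, hx.braiding_tmul, LinearMap.rTensor_tmul, contract_tmul, contract_tmul,
          smul_mul_assoc]
        rcases hf.apply_eq_zero_or hx with hfx | rfl
        · rw [hfx, zero_smul, zero_smul]
        · rfl
  rw [braidedDeriv_apply, braidedInteger_mul_ι, map_add, contract_tmul, contract_lastLegs,
    braidedDeriv_apply]

theorem IsHomogeneousDual.upper_ι_mul_lower (hδ : IsGrading δ) {g : G} {f : Module.Dual k W}
    (hf : IsHomogeneousDual δ g f) (a : TensorAlgebra k W) :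
    upper ρ δ (TensorAlgebra.ι k f) * lower ρ δ a =
      lower ρ δ a * upper ρ δ (TensorAlgebra.ι k f) +
        lower ρ δ (braidedDeriv (braiding ρ δ) f a) * mid ρ δ (MonoidAlgebra.of k G g) := by
  induction a using tensorAlgebra_induction_right with
  | add a b ha hb => simp only [map_add, mul_add, add_mul, ha, hb]; abel
  | smul r a ha => simp only [map_smul, mul_smul_comm, smul_mul_assoc, ha, smul_add]
  | one => simp
  | mul_ι y a ha =>
    rw [braidedDeriv_mul_ι hδ hf, map_mul, ← mul_assoc, ha, add_mul, mul_assoc,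
      upper_ι_mul_lower_ι, hf, mul_assoc (lower ρ δ _) (mid ρ δ _), mid_mul_lower_ι]
    simp only [map_add, map_smul, map_mul, mul_add, add_mul, mul_smul_comm, smul_mul_assoc,
      mul_assoc, add_assoc]

theorem IsHomogeneousVec.upper_ι_mul_mul_lower_ι {g : G} {x : W} (hx : IsHomogeneousVec δ g x)
    {b b' : TensorAlgebra k (Module.Dual k W)}
    (h : upper ρ δ b * lower ρ δ (TensorAlgebra.ι k x) =
      lower ρ δ (TensorAlgebra.ι k x) * upper ρ δ b +
        mid ρ δ (MonoidAlgebra.of k G g) * upper ρ δ b') (f : Module.Dual k W) :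
    upper ρ δ (TensorAlgebra.ι k f * b) * lower ρ δ (TensorAlgebra.ι k x) =
      lower ρ δ (TensorAlgebra.ι k x) * upper ρ δ (TensorAlgebra.ι k f * b) +
        mid ρ δ (MonoidAlgebra.of k G g) *
          upper ρ δ (f x • b + TensorAlgebra.ι k (f ∘ₗ ρ g) * b') := by
  rw [map_mul, mul_assoc, h, mul_add, ← mul_assoc, upper_ι_mul_lower_ι, hx.pairing_eq,
    ← mul_assoc, upper_ι_mul_mid]
  simp only [map_add, map_smul, map_mul, mul_add, add_mul, mul_smul_comm, smul_mul_assoc,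
    mul_assoc, add_assoc]

theorem IsHomogeneousVec.exists_upper_mul_lower_ι {g : G} {x : W} (hx : IsHomogeneousVec δ g x)
    (b : TensorAlgebra k (Module.Dual k W)) :
    ∃ b', upper ρ δ b * lower ρ δ (TensorAlgebra.ι k x) =
      lower ρ δ (TensorAlgebra.ι k x) * upper ρ δ b +
        mid ρ δ (MonoidAlgebra.of k G g) * upper ρ δ b' := by
  induction b using tensorAlgebra_induction_left with
  | add b c hb hc =>
    obtain ⟨b', hb⟩ := hb
    obtain ⟨c', hc⟩ := hc
    exact ⟨b' + c', by simp only [map_add, mul_add, add_mul, hb, hc]; abel⟩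
  | smul r b hb =>
    obtain ⟨b', hb⟩ := hb
    exact ⟨r • b', by simp only [map_smul, mul_smul_comm, smul_mul_assoc, hb, smul_add]⟩
  | one => exact ⟨0, by simp⟩
  | ι_mul f b hb =>
    obtain ⟨b', hb⟩ := hb
    exact ⟨_, hx.upper_ι_mul_mul_lower_ι hb f⟩

end Grading

/-! ### The radicals of the Harish-Chandra form -/

section Radical

variable {k G W : Type*} [Field k] [Group G] [AddCommGroup W] [Module k W]
  {ρ : Representation k G W} {δ : Quasicoaction k G W}

theorem form_mul_ι (hδ : IsGrading δ) (hq : IsQuasiYetterDrinfeld ρ δ)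
    (b : TensorAlgebra k (Module.Dual k W)) (f : Module.Dual k W) (a : TensorAlgebra k W) :
    form hq (b * TensorAlgebra.ι k f) a = form hq b (braidedDeriv (braiding ρ δ) f a) := by
  induction f using hδ.induction_dual with
  | add f f' hf hf' =>
    simp only [map_add, mul_add, LinearMap.add_apply, hf, hf', braidedDeriv_apply, contract_add]
  | smul r f hf =>
    simp only [map_smul, mul_smul_comm, LinearMap.smul_apply, hf, braidedDeriv_apply, contract_smul]
  | homogeneous g f hf =>
    rw [form_apply, map_mul (upper ρ δ), mul_assoc, hf.upper_ι_mul_lower hδ, mul_add, map_add,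
      ← mul_assoc, vacuum_mul_upper_ι, zero_add, ← mul_assoc, vacuum_mul_mid, form_apply]

theorem lowerRadical_eq_worKer (hδ : IsGrading δ) (hq : IsQuasiYetterDrinfeld ρ δ) :
    lowerRadical hq = worKer (braiding ρ δ) := by
  refine le_antisymm (le_worKer (lowerRadical_le_positivePart hq) fun a ha f => ?_) fun a ha => ?_
  · refine (mem_lowerRadical hq).2 fun b => ?_
    rw [← form_mul_ι hδ, (mem_lowerRadical hq).1 ha]
  · refine (mem_lowerRadical hq).2 fun b => ?_
    induction b using tensorAlgebra_induction_right generalizing a with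
    | add b b' hb hb' => rw [map_add, LinearMap.add_apply, hb a ha, hb' a ha, add_zero]
    | smul r b hb => rw [map_smul, LinearMap.smul_apply, hb a ha, smul_zero]
    | one => exact (form_one_left hq a).trans (worKer_le_positivePart _ ha)
    | mul_ι f b hb => rw [form_mul_ι hδ]; exact hb _ (braidedDeriv_mem_worKer ha f)

variable {hq : IsQuasiYetterDrinfeld ρ δ} {a : TensorAlgebra k W}
  {b : TensorAlgebra k (Module.Dual k W)}

theorem braidedDeriv_mem_lowerRadical (hδ : IsGrading δ) (ha : a ∈ lowerRadical hq)
    (f : Module.Dual k W) : braidedDeriv (braiding ρ δ) f a ∈ lowerRadical hq := by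
  rw [lowerRadical_eq_worKer hδ] at ha ⊢
  exact braidedDeriv_mem_worKer ha f

theorem tensorMap_mem_lowerRadical (ha : a ∈ lowerRadical hq) (g : G) :
    tensorMap (ρ g) a ∈ lowerRadical hq := (mem_lowerRadical hq).2 fun b => by
  rw [← form_dualAct, (mem_lowerRadical hq).1 ha]

theorem dualAct_mem_upperRadical (hb : b ∈ upperRadical hq) (g : G) :
    dualAct ρ g b ∈ upperRadical hq := (mem_upperRadical hq).2 fun a => by
  rw [form_dualAct, (mem_upperRadical hq).1 hb]

theorem form_ι_mul_of_commute (hq : IsQuasiYetterDrinfeld ρ δ) {g : G} {x : W}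
    {b b' : TensorAlgebra k (Module.Dual k W)}
    (h : upper ρ δ b * lower ρ δ (TensorAlgebra.ι k x) =
      lower ρ δ (TensorAlgebra.ι k x) * upper ρ δ b +
        mid ρ δ (MonoidAlgebra.of k G g) * upper ρ δ b') (a : TensorAlgebra k W) :
    form hq b (TensorAlgebra.ι k x * a) = form hq b' a := by
  rw [form_apply, map_mul (lower ρ δ), ← mul_assoc, h, add_mul, map_add, mul_assoc,
    vacuum_lower_ι_mul, zero_add, mul_assoc, vacuum_mid_mul, form_apply]

theorem mem_upperRadical_of_commute {g : G} {x : W} {b b' : TensorAlgebra k (Module.Dual k W)}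
    (hb : b ∈ upperRadical hq) (h : upper ρ δ b * lower ρ δ (TensorAlgebra.ι k x) =
      lower ρ δ (TensorAlgebra.ι k x) * upper ρ δ b +
        mid ρ δ (MonoidAlgebra.of k G g) * upper ρ δ b') : b' ∈ upperRadical hq :=
  (mem_upperRadical hq).2 fun a => by
    rw [← form_ι_mul_of_commute hq h, (mem_upperRadical hq).1 hb]

theorem ι_mul_mem_lowerRadical (hδ : IsGrading δ) (x : W) (ha : a ∈ lowerRadical hq) :
    TensorAlgebra.ι k x * a ∈ lowerRadical hq := by
  induction x using hδ.induction_vec with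
  | add x y hx hy => rw [map_add, add_mul]; exact add_mem hx hy
  | smul r x hx => rw [map_smul, smul_mul_assoc]; exact Submodule.smul_mem _ r hx
  | homogeneous g x hx =>
    refine (mem_lowerRadical hq).2 fun b => ?_
    obtain ⟨b', hb'⟩ := hx.exists_upper_mul_lower_ι (ρ := ρ) b
    rw [form_ι_mul_of_commute hq hb', (mem_lowerRadical hq).1 ha]

theorem mul_ι_mem_upperRadical (hδ : IsGrading δ) (f : Module.Dual k W)
    (hb : b ∈ upperRadical hq) : b * TensorAlgebra.ι k f ∈ upperRadical hq :=
  (mem_upperRadical hq).2 fun a => by rw [form_mul_ι hδ, (mem_upperRadical hq).1 hb]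

theorem mul_ι_mem_lowerRadical (hδ : IsGrading δ) (x : W) (ha : a ∈ lowerRadical hq) :
    a * TensorAlgebra.ι k x ∈ lowerRadical hq := by
  refine (mem_lowerRadical hq).2 fun b => ?_
  induction b using tensorAlgebra_induction_right generalizing a x with
  | add b b' hb hb' => rw [map_add, LinearMap.add_apply, hb x ha, hb' x ha, add_zero]
  | smul r b hb => rw [map_smul, LinearMap.smul_apply, hb x ha, smul_zero]
  | one =>
    rw [form_one_left, map_mul, algebraMapInv_ι, mul_zero]
  | mul_ι f b hb =>
    induction f using hδ.induction_dual with
    | add f f' hf hf' => rw [map_add, mul_add, map_add, LinearMap.add_apply, hf, hf', add_zero]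
    | smul r f hf => rw [map_smul, mul_smul_comm, map_smul, LinearMap.smul_apply, hf, smul_zero]
    | homogeneous g f hf =>
      rw [form_mul_ι hδ, braidedDeriv_mul_ι hδ hf, map_add, map_smul, (mem_lowerRadical hq).1 ha,
        smul_zero, zero_add, hb _ (braidedDeriv_mem_lowerRadical hδ ha f)]

theorem ι_mul_mem_upperRadical (hδ : IsGrading δ) (f : Module.Dual k W)
    (hb : b ∈ upperRadical hq) : TensorAlgebra.ι k f * b ∈ upperRadical hq := by
  refine (mem_upperRadical hq).2 fun a => ?_
  induction a using tensorAlgebra_induction_left generalizing b f with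
  | add a a' ha ha' => rw [map_add, ha f hb, ha' f hb, add_zero]
  | smul r a ha => rw [map_smul, ha f hb, smul_zero]
  | one => rw [form_one_right, map_mul, algebraMapInv_ι, zero_mul]
  | ι_mul x a ha =>
    induction x using hδ.induction_vec with
    | add x y hx hy => rw [map_add, add_mul, map_add, hx, hy, add_zero]
    | smul r x hx => rw [map_smul, smul_mul_assoc, map_smul, hx, smul_zero]
    | homogeneous g x hx =>
      obtain ⟨b', hb'⟩ := hx.exists_upper_mul_lower_ι (ρ := ρ) b
      rw [form_ι_mul_of_commute hq (hx.upper_ι_mul_mul_lower_ι hb' f), map_add, map_smul,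
        LinearMap.add_apply, LinearMap.smul_apply, (mem_upperRadical hq).1 hb, smul_zero, zero_add,
        ha _ (mem_upperRadical_of_commute hb hb')]

theorem isLowerIdeal_lowerRadical (hδ : IsGrading δ) (hq : IsQuasiYetterDrinfeld ρ δ) :
    IsLowerIdeal ρ δ (lowerRadical hq) where
  mul_mem_left := mul_mem_of_ι_mul_mem fun x _ ha => ι_mul_mem_lowerRadical hδ x ha
  mul_mem_right := mul_mem_of_mul_ι_mem fun x _ ha => mul_ι_mem_lowerRadical hδ x ha
  act_mem := fun g _ ha => tensorMap_mem_lowerRadical ha g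
  upper_ι_mul_mem f a ha := by
    induction f using hδ.induction_dual with
    | add f f' hf hf' => rw [map_add, map_add, add_mul]; exact add_mem hf hf'
    | smul r f hf => rw [map_smul, map_smul, smul_mul_assoc]; exact Submodule.smul_mem _ r hf
    | homogeneous g f hf =>
      rw [hf.upper_ι_mul_lower hδ]
      exact add_mem (lower_mul_mem_lowerSpan ha _)
        (lower_mul_mem_lowerSpan (braidedDeriv_mem_lowerRadical hδ ha f) _)

theorem isUpperIdeal_upperRadical (hδ : IsGrading δ) (hq : IsQuasiYetterDrinfeld ρ δ) :
    IsUpperIdeal ρ δ (upperRadical hq) where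
  mul_mem_left := mul_mem_of_ι_mul_mem fun f _ hb => ι_mul_mem_upperRadical hδ f hb
  mul_mem_right := mul_mem_of_mul_ι_mem fun f _ hb => mul_ι_mem_upperRadical hδ f hb
  act_mem := fun g _ hb => dualAct_mem_upperRadical hb g
  mul_lower_ι_mem x b hb := by
    induction x using hδ.induction_vec with
    | add x y hx hy => rw [map_add, map_add, mul_add]; exact add_mem hx hy
    | smul r x hx => rw [map_smul, map_smul, mul_smul_comm]; exact Submodule.smul_mem _ r hx
    | homogeneous g x hx =>
      obtain ⟨b', hb'⟩ := hx.exists_upper_mul_lower_ι (ρ := ρ) b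
      rw [hb']
      exact add_mem (mul_upper_mem_upperSpan hb _)
        (mul_upper_mem_upperSpan (mem_upperRadical_of_commute hb hb') _)

theorem isTriangularIdeal_maximalTriangularIdeal (hδ : IsGrading δ)
    (hq : IsQuasiYetterDrinfeld ρ δ) : IsTriangularIdeal ρ δ (lowerRadical hq) (upperRadical hq)
      (maximalTriangularIdeal ρ δ) := by
  have := isTriangularIdeal_triangularIdeal (isLowerIdeal_lowerRadical hδ hq)
    (isUpperIdeal_upperRadical hδ hq) (lowerRadical_le_positivePart hq)
    (upperRadical_le_positivePart hq)
  rwa [maximalTriangularIdeal_eq hq this]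

variable [FiniteDimensional k W]

theorem IsHomogeneousDual.dualBraiding_tmul (hδ : IsGrading δ) {g : G} {f : Module.Dual k W}
    (hf : IsHomogeneousDual δ g f) (φ : Module.Dual k W) :
    dualBraiding (braiding ρ δ) (φ ⊗ₜ[k] f) = f ⊗ₜ[k] (φ ∘ₗ ρ g) := by
  rw [dualBraiding, LinearMap.comp_apply, LinearEquiv.coe_coe, LinearEquiv.symm_apply_eq]
  refine TensorProduct.ext' fun x y => ?_
  change TensorProduct.dualDistrib k W W (φ ⊗ₜ[k] f) (braiding ρ δ (x ⊗ₜ y)) =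
    TensorProduct.dualDistrib k W W (f ⊗ₜ[k] (φ ∘ₗ ρ g)) (x ⊗ₜ y)
  induction x using hδ.induction_vec with
  | add x x' hx hx' => simp only [TensorProduct.add_tmul, map_add, hx, hx']
  | smul r x hx => simp only [← TensorProduct.smul_tmul', map_smul, hx]
  | homogeneous h x hx =>
    rw [hx.braiding_tmul, TensorProduct.dualDistrib_apply, TensorProduct.dualDistrib_apply,
      LinearMap.comp_apply, mul_comm]
    rcases hf.apply_eq_zero_or hx with hfx | rfl
    · rw [hfx, zero_mul, zero_mul]
    · rfl

theorem braidedDeriv_dualBraiding_mul_ι (hδ : IsGrading δ) {g : G} {f : Module.Dual k W}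
    (hf : IsHomogeneousDual δ g f) (b : TensorAlgebra k (Module.Dual k W)) (y : W) :
    braidedDeriv (dualBraiding (braiding ρ δ)) (Module.Dual.eval k W y)
        (b * TensorAlgebra.ι k f) =
      f y • b + braidedDeriv (dualBraiding (braiding ρ δ)) (Module.Dual.eval k W (ρ g y)) b *
        TensorAlgebra.ι k f := by
  rw [braidedDeriv_apply, braidedDeriv_apply, braidedInteger_mul_ι, map_add, contract_tmul,
    Module.Dual.eval_apply]
  congr 1
  generalize braidedInteger (dualBraiding (braiding ρ δ)) b = z
  induction z using TensorProduct.induction_on with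
  | zero => simp
  | add z z' hz hz' => simp only [TensorProduct.add_tmul, map_add, hz, hz', add_mul]
  | tmul b φ =>
    rw [lastLegs_tmul, hf.dualBraiding_tmul hδ, LinearMap.rTensor_tmul, contract_tmul,
      contract_tmul, smul_mul_assoc]
    rfl

theorem form_mul_ι_right (hδ : IsGrading δ) (hq : IsQuasiYetterDrinfeld ρ δ)
    (b : TensorAlgebra k (Module.Dual k W)) (a : TensorAlgebra k W) (y : W) :
    form hq b (a * TensorAlgebra.ι k y) =
      form hq (braidedDeriv (dualBraiding (braiding ρ δ)) (Module.Dual.eval k W y) b) a := by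
  induction b using tensorAlgebra_induction_right generalizing a y with
  | add b b' hb hb' => simp only [map_add, LinearMap.add_apply, hb, hb']
  | smul r b hb => simp only [map_smul, LinearMap.smul_apply, hb]
  | one => simp [form_one_left]
  | mul_ι f b ih =>
    induction f using hδ.induction_dual with
    | add f f' hf hf' => simp only [map_add, mul_add, LinearMap.add_apply, hf, hf']
    | smul r f hf => simp only [map_smul, mul_smul_comm, LinearMap.smul_apply, hf]
    | homogeneous g f hf =>
      rw [form_mul_ι hδ, braidedDeriv_mul_ι hδ hf, map_add, map_smul, ih,
        braidedDeriv_dualBraiding_mul_ι hδ hf, map_add, map_smul, LinearMap.add_apply,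
        LinearMap.smul_apply, form_mul_ι hδ]

theorem upperRadical_eq_worKer (hδ : IsGrading δ) (hq : IsQuasiYetterDrinfeld ρ δ) :
    upperRadical hq = worKer (dualBraiding (braiding ρ δ)) := by
  refine le_antisymm (le_worKer (upperRadical_le_positivePart hq) fun b hb F => ?_) fun b hb => ?_
  · obtain ⟨y, rfl⟩ := (Module.evalEquiv k W).surjective F
    refine (mem_upperRadical hq).2 fun a => ?_
    rw [Module.evalEquiv_apply, ← form_mul_ι_right hδ, (mem_upperRadical hq).1 hb]
  · refine (mem_upperRadical hq).2 fun a => ?_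
    induction a using tensorAlgebra_induction_right generalizing b with
    | add a a' ha ha' => rw [map_add, ha b hb, ha' b hb, add_zero]
    | smul r a ha => rw [map_smul, ha b hb, smul_zero]
    | one => exact (form_one_right hq b).trans (worKer_le_positivePart _ hb)
    | mul_ι y a ha => rw [form_mul_ι_right hδ]; exact ha _ (braidedDeriv_mem_worKer hb _)

end Radical

/-! ### The symmetric algebra as a quotient of the tensor algebra -/

section Sym

variable {k : Type*} [Field k] {M : Type*} [AddCommGroup M] [Module k M]

theorem mem_symKer {a : TensorAlgebra k M} :
    a ∈ symKer k M ↔ SymmetricAlgebra.algHom k M a = 0 := Iff.rfl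

theorem commutator_mem_symKer (x y : M) : TensorAlgebra.ι k x * TensorAlgebra.ι k y -
    TensorAlgebra.ι k y * TensorAlgebra.ι k x ∈ symKer k M := by
  rw [mem_symKer, map_sub, map_mul, map_mul, mul_comm, sub_self]

theorem mul_mem_symKer (x : TensorAlgebra k M) {a : TensorAlgebra k M} (ha : a ∈ symKer k M) :
    x * a ∈ symKer k M := by
  rw [mem_symKer] at ha ⊢
  rw [map_mul, ha, mul_zero]

theorem symKer_mul_mem {a : TensorAlgebra k M} (ha : a ∈ symKer k M) (x : TensorAlgebra k M) :
    a * x ∈ symKer k M := by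
  rw [mem_symKer] at ha ⊢
  rw [map_mul, ha, zero_mul]

theorem symKer_le {S : Submodule k (TensorAlgebra k M)}
    (hc : ∀ x y, TensorAlgebra.ι k x * TensorAlgebra.ι k y -
      TensorAlgebra.ι k y * TensorAlgebra.ι k x ∈ S)
    (hl : ∀ x, ∀ a ∈ S, TensorAlgebra.ι k x * a ∈ S)
    (hr : ∀ x, ∀ a ∈ S, a * TensorAlgebra.ι k x ∈ S) : symKer k M ≤ S := by
  intro a ha
  let I : TwoSidedIdeal (TensorAlgebra k M) := TwoSidedIdeal.mk' (S : Set (TensorAlgebra k M))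
    S.zero_mem S.add_mem S.neg_mem (fun {x y} hy => mul_mem_of_ι_mul_mem hl x y hy)
    (fun {x y} hx => mul_mem_of_mul_ι_mem hr y x hx)
  have hI (b c) : I.ringCon b c ↔ b - c ∈ S := by
    rw [TwoSidedIdeal.rel_iff, TwoSidedIdeal.mem_mk', SetLike.mem_coe]
  have hle : TensorAlgebra.symRingCon k M ≤ I.ringCon := by
    refine RingCon.ringConGen_le.2 ?_
    rintro _ _ ⟨x, y⟩
    exact (hI _ _).2 (hc x y)
  have h0 : TensorAlgebra.symRingCon k M a 0 := (RingCon.eq _).1 (mem_symKer.1 ha)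
  exact sub_zero a ▸ (hI a 0).1 (hle h0)

theorem symKer_le_ker {A : Type*} [Ring A] [Algebra k A] (φ : TensorAlgebra k M →ₐ[k] A)
    (h : ∀ x y, Commute (φ (TensorAlgebra.ι k x)) (φ (TensorAlgebra.ι k y))) :
    symKer k M ≤ LinearMap.ker φ.toLinearMap := by
  refine symKer_le (fun x y => ?_) (fun x a ha => ?_) (fun x a ha => ?_)
  · rw [LinearMap.mem_ker, AlgHom.toLinearMap_apply, map_sub, map_mul, map_mul, (h x y).eq,
      sub_self]
  all_goals rw [LinearMap.mem_ker, AlgHom.toLinearMap_apply] at ha ⊢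
  · rw [map_mul, ha, mul_zero]
  · rw [map_mul, ha, zero_mul]

theorem symKer_le_positivePart : symKer k M ≤ positivePart k M :=
  symKer_le_ker _ fun _ _ => Commute.all _ _

theorem tensorMap_mem_symKer {N : Type*} [AddCommGroup N] [Module k N] (φ : M →ₗ[k] N)
    {a : TensorAlgebra k M} (ha : a ∈ symKer k M) : tensorMap φ a ∈ symKer k N :=
  symKer_le_ker ((SymmetricAlgebra.algHom k N).comp (tensorMap φ)) (fun _ _ => Commute.all _ _) ha

theorem symKer_le_comap_tensorMap {N : Type*} [AddCommGroup N] [Module k N] (φ : M →ₗ[k] N)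
    {S : Submodule k (TensorAlgebra k N)}
    (hc : ∀ x y, TensorAlgebra.ι k (φ x) * TensorAlgebra.ι k (φ y) -
      TensorAlgebra.ι k (φ y) * TensorAlgebra.ι k (φ x) ∈ S)
    (hl : ∀ x, ∀ a ∈ S, TensorAlgebra.ι k x * a ∈ S)
    (hr : ∀ x, ∀ a ∈ S, a * TensorAlgebra.ι k x ∈ S) :
    symKer k M ≤ S.comap (tensorMap φ).toLinearMap := by
  refine symKer_le (fun x y => ?_) (fun x a ha => ?_) (fun x a ha => ?_)
  all_goals rw [Submodule.mem_comap, AlgHom.toLinearMap_apply]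
  · simpa only [map_sub, map_mul, tensorMap_ι] using hc x y
  · rw [map_mul, tensorMap_ι]
    exact hl _ _ ha
  · rw [map_mul, tensorMap_ι]
    exact hr _ _ ha

variable {G : Type*} [Group G] {ρ : Representation k G M} {δ : Quasicoaction k G M}

theorem isLowerIdeal_symKer (h : ∀ f x y, Commute (upper ρ δ (TensorAlgebra.ι k f))
    (lower ρ δ (TensorAlgebra.ι k x * TensorAlgebra.ι k y -
      TensorAlgebra.ι k y * TensorAlgebra.ι k x))) : IsLowerIdeal ρ δ (symKer k M) where
  mul_mem_left x _ ha := mul_mem_symKer x ha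
  mul_mem_right x _ ha := symKer_mul_mem ha x
  act_mem _ _ ha := tensorMap_mem_symKer _ ha
  upper_ι_mul_mem f a ha := by
    let S : Submodule k (TensorAlgebra k M) := symKer k M ⊓
      (lowerSpan ρ δ (symKer k M)).comap
        (LinearMap.mulLeft k (upper ρ δ (TensorAlgebra.ι k f)) ∘ₗ (lower ρ δ).toLinearMap)
    suffices H : symKer k M ≤ S from (H ha).2
    refine symKer_le (fun x y => ⟨commutator_mem_symKer x y, ?_⟩)
      (fun x a ha => ⟨mul_mem_symKer _ ha.1, ?_⟩) (fun x a ha => ⟨symKer_mul_mem ha.1 _, ?_⟩)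
    all_goals change upper ρ δ _ * lower ρ δ _ ∈ lowerSpan ρ δ _
    · rw [(h f x y).eq]
      exact lower_mul_mem_lowerSpan (commutator_mem_symKer x y) _
    · rw [map_mul, ← mul_assoc, upper_ι_mul_lower_ι, add_mul, mul_assoc]
      exact Submodule.add_mem _
        (mul_mem_lowerSpan_of_generators
          (lower_mul_lower_mem_lowerSpan fun _ => mul_mem_symKer _) ha.2)
        (mid_mul_lower_mem_lowerSpan (fun _ _ => tensorMap_mem_symKer _) _ a ha.1)
    · rw [map_mul, ← mul_assoc]
      exact mul_mem_lowerSpan ha.2 _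

theorem dualAct_mem_symKer (g : G) :
    ∀ b ∈ symKer k (Module.Dual k M), dualAct ρ g b ∈ symKer k (Module.Dual k M) :=
  fun _ hb => tensorMap_mem_symKer (ρ g).dualMap hb

theorem isUpperIdeal_symKer (h : ∀ x f f', Commute
    (upper ρ δ (TensorAlgebra.ι k f * TensorAlgebra.ι k f' -
      TensorAlgebra.ι k f' * TensorAlgebra.ι k f)) (lower ρ δ (TensorAlgebra.ι k x))) :
    IsUpperIdeal ρ δ (symKer k (Module.Dual k M)) where
  mul_mem_left x _ hb := mul_mem_symKer x hb
  mul_mem_right x _ hb := symKer_mul_mem hb x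
  act_mem := dualAct_mem_symKer
  mul_lower_ι_mem v b hb := by
    let S : Submodule k (TensorAlgebra k (Module.Dual k M)) := symKer k (Module.Dual k M) ⊓
      (upperSpan ρ δ (symKer k (Module.Dual k M))).comap
        (LinearMap.mulRight k (lower ρ δ (TensorAlgebra.ι k v)) ∘ₗ (upper ρ δ).toLinearMap)
    suffices H : symKer k (Module.Dual k M) ≤ S from (H hb).2
    refine symKer_le (fun f f' => ⟨commutator_mem_symKer f f', ?_⟩)
      (fun f b hb => ⟨mul_mem_symKer _ hb.1, ?_⟩) (fun f b hb => ⟨symKer_mul_mem hb.1 _, ?_⟩)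
    all_goals change upper ρ δ _ * lower ρ δ _ ∈ upperSpan ρ δ _
    · rw [(h v f f').eq]
      exact mul_upper_mem_upperSpan (commutator_mem_symKer f f') _
    · rw [map_mul, mul_assoc]
      exact mul_mem_upperSpan hb.2 _
    · have hbv : upper ρ δ b * lower ρ δ (TensorAlgebra.ι k v) ∈
          upperSpan ρ δ (symKer k (Module.Dual k M)) := hb.2
      rw [map_mul, mul_assoc, upper_ι_mul_lower_ι, mul_add, ← mul_assoc]
      refine Submodule.add_mem _ (mul_mem_upperSpan_of_generators ?_ hbv)
        (upper_mul_mid_mem_upperSpan dualAct_mem_symKer _ b hb.1)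
      exact upper_mul_upper_mem_upperSpan fun _ hc => symKer_mul_mem hc _

theorem IsTriangularIdeal.le {Im : Submodule k (TensorAlgebra k M)}
    {Ip : Submodule k (TensorAlgebra k (Module.Dual k M))} {I J : TwoSidedIdeal (FreeDouble ρ δ)}
    (hI : IsTriangularIdeal ρ δ Im Ip I) (hm : ∀ a ∈ Im, lower ρ δ a ∈ J)
    (hp : ∀ b ∈ Ip, upper ρ δ b ∈ J) : I ≤ J := by
  have hle : triSpan ρ δ Im Ip ≤ LinearMap.ker (toQuot ρ δ J).toLinearMap :=
    triSpan_le fun a g b hab => toQuot_eq_zero.2 <| hab.elim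
      (fun ha => J.mul_mem_right _ _ (J.mul_mem_right _ _ (hm a ha)))
      (fun hb => J.mul_mem_left _ _ (hp b hb))
  exact fun x hx => toQuot_eq_zero.1 (hle ((Set.ext_iff.1 hI.carrier_eq x).1 hx))

theorem isTriangularIdeal_span_commutators
    (hm : ∀ f x y, Commute (upper ρ δ (TensorAlgebra.ι k f))
      (lower ρ δ (TensorAlgebra.ι k x * TensorAlgebra.ι k y -
        TensorAlgebra.ι k y * TensorAlgebra.ι k x)))
    (hp : ∀ x f f', Commute (upper ρ δ (TensorAlgebra.ι k f * TensorAlgebra.ι k f' -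
      TensorAlgebra.ι k f' * TensorAlgebra.ι k f)) (lower ρ δ (TensorAlgebra.ι k x))) :
    IsTriangularIdeal ρ δ (symKer k M) (symKer k (Module.Dual k M)) (TwoSidedIdeal.span
    ({x | ∃ v v' : M, x = lower ρ δ (TensorAlgebra.ι k v * TensorAlgebra.ι k v' -
        TensorAlgebra.ι k v' * TensorAlgebra.ι k v)} ∪
      {x | ∃ f f' : Module.Dual k M, x = upper ρ δ (TensorAlgebra.ι k f * TensorAlgebra.ι k f' -
        TensorAlgebra.ι k f' * TensorAlgebra.ι k f)})) := by
  set J : TwoSidedIdeal (FreeDouble ρ δ) := TwoSidedIdeal.span _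
  have hI := isTriangularIdeal_triangularIdeal (isLowerIdeal_symKer hm) (isUpperIdeal_symKer hp)
    symKer_le_positivePart symKer_le_positivePart
  have commute_of_sub_mem {x y} (h : x * y - y * x ∈ J) :
      Commute (toQuot ρ δ J x) (toQuot ρ δ J y) := by
    rw [commute_iff_eq, ← sub_eq_zero, ← map_mul, ← map_mul, ← map_sub]
    exact toQuot_eq_zero.2 h
  suffices he : J = triangularIdeal (isLowerIdeal_symKer hm) (isUpperIdeal_symKer hp) from he ▸ hI
  refine le_antisymm (TwoSidedIdeal.span_le.2 ?_) (hI.le (fun a ha => ?_) (fun b hb => ?_))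
  · rw [hI.carrier_eq]
    rintro _ (⟨v, v', rfl⟩ | ⟨f, f', rfl⟩)
    · exact lower_mem_triSpan (commutator_mem_symKer v v')
    · exact upper_mem_triSpan (commutator_mem_symKer f f')
  · refine toQuot_eq_zero.1 (symKer_le_ker ((toQuot ρ δ J).comp (lower ρ δ)) (fun x y => ?_) ha)
    refine commute_of_sub_mem (TwoSidedIdeal.subset_span (Or.inl ⟨x, y, ?_⟩))
    rw [map_sub, map_mul, map_mul]; rfl
  · refine toQuot_eq_zero.1 (symKer_le_ker ((toQuot ρ δ J).comp (upper ρ δ)) (fun x y => ?_) hb)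
    refine commute_of_sub_mem (TwoSidedIdeal.subset_span (Or.inr ⟨x, y, ?_⟩))
    rw [map_sub, map_mul, map_mul]; rfl

end Sym

/-! ### Rational Cherednik algebras -/

section Reflections

variable {k G W ι : Type*} [Field k] [Group G] [AddCommGroup W] [Module k W] [Fintype ι]

/-- The `i`-th element `s i` of the family acts on `W` by `v ↦ v - ⟨α i, v⟩ β i`, and `δ` is the
quasicoaction `v ↦ 1 ⊗ t v + ∑ i, c i s i ⊗ (v - s i (v))`, expressed by its pairing with `W*`. -/
structure IsReflectionCoaction (ρ : Representation k G W) (δ : Quasicoaction k G W) (s : ι → G)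
    (α : ι → Module.Dual k W) (β : ι → W) (t : k) (c : ι → k) : Prop where
  apply (i : ι) (v : W) : ρ (s i) v = v - α i v • β i
  pairing_eq (f : Module.Dual k W) (v : W) : pairing δ f v =
    (t * f v) • (1 : MonoidAlgebra k G) +
      ∑ i, (c i * α i v * f (β i)) • MonoidAlgebra.of k G (s i)

variable {ρ : Representation k G W} {δ : Quasicoaction k G W} {s : ι → G}
  {α : ι → Module.Dual k W} {β : ι → W} {t : k} {c : ι → k}

namespace IsReflectionCoaction

theorem mid_pairing_mul_lower_ι (h : IsReflectionCoaction ρ δ s α β t c)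
    (f : Module.Dual k W) (v w : W) :
    mid ρ δ (pairing δ f v) * lower ρ δ (TensorAlgebra.ι k w) =
      lower ρ δ (TensorAlgebra.ι k w) * mid ρ δ (pairing δ f v) -
        ∑ i, (c i * f (β i) * (α i v * α i w)) •
          (lower ρ δ (TensorAlgebra.ι k (β i)) * mid ρ δ (MonoidAlgebra.of k G (s i))) := by
  rw [h.pairing_eq]
  simp only [map_add, map_sum, map_smul, add_mul, mul_add, Finset.sum_mul, Finset.mul_sum,
    smul_mul_assoc, mul_smul_comm, mid_one, one_mul, mul_one, mid_mul_lower_ι, h.apply, map_sub,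
    sub_mul, smul_sub, Finset.sum_sub_distrib, smul_smul, add_sub_assoc]
  refine congrArg₂ _ rfl (congrArg₂ _ rfl (Finset.sum_congr rfl fun i _ => congrArg₂ _ ?_ rfl))
  ring

theorem upper_ι_mul_lower_mul (h : IsReflectionCoaction ρ δ s α β t c)
    (f : Module.Dual k W) (v w : W) :
    upper ρ δ (TensorAlgebra.ι k f) * lower ρ δ (TensorAlgebra.ι k v * TensorAlgebra.ι k w) =
      lower ρ δ (TensorAlgebra.ι k v * TensorAlgebra.ι k w) * upper ρ δ (TensorAlgebra.ι k f) +
        (lower ρ δ (TensorAlgebra.ι k v) * mid ρ δ (pairing δ f w) +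
          lower ρ δ (TensorAlgebra.ι k w) * mid ρ δ (pairing δ f v)) -
        ∑ i, (c i * f (β i) * (α i v * α i w)) •
          (lower ρ δ (TensorAlgebra.ι k (β i)) * mid ρ δ (MonoidAlgebra.of k G (s i))) := by
  rw [map_mul, ← mul_assoc, upper_ι_mul_lower_ι, add_mul, mul_assoc, upper_ι_mul_lower_ι,
    h.mid_pairing_mul_lower_ι, mul_add]
  simp only [mul_assoc]
  abel

theorem commute_upper_ι_commutator (h : IsReflectionCoaction ρ δ s α β t c)
    (f : Module.Dual k W) (v w : W) :
    Commute (upper ρ δ (TensorAlgebra.ι k f)) (lower ρ δ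
      (TensorAlgebra.ι k v * TensorAlgebra.ι k w - TensorAlgebra.ι k w * TensorAlgebra.ι k v)) := by
  rw [commute_iff_eq, map_sub, mul_sub, sub_mul, h.upper_ι_mul_lower_mul f v w,
    h.upper_ι_mul_lower_mul f w v]
  simp only [mul_comm (α _ v)]
  abel

theorem upper_ι_mul_mid_pairing (h : IsReflectionCoaction ρ δ s α β t c)
    (f f' : Module.Dual k W) (v : W) :
    upper ρ δ (TensorAlgebra.ι k f) * mid ρ δ (pairing δ f' v) =
      mid ρ δ (pairing δ f' v) * upper ρ δ (TensorAlgebra.ι k f) -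
        ∑ i, (c i * α i v * (f (β i) * f' (β i))) •
          (mid ρ δ (MonoidAlgebra.of k G (s i)) * upper ρ δ (TensorAlgebra.ι k (α i))) := by
  have comp_apply (i : ι) : f ∘ₗ ρ (s i) = f - f (β i) • α i := by
    ext x; simp [h.apply, mul_comm]
  rw [h.pairing_eq]
  simp only [map_add, map_sum, map_smul, add_mul, mul_add, Finset.sum_mul, Finset.mul_sum,
    smul_mul_assoc, mul_smul_comm, mid_one, one_mul, mul_one, upper_ι_mul_mid, comp_apply, map_sub,
    mul_sub, smul_sub, Finset.sum_sub_distrib, smul_smul, add_sub_assoc]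
  refine congrArg₂ _ rfl (congrArg₂ _ rfl (Finset.sum_congr rfl fun i _ => congrArg₂ _ ?_ rfl))
  ring

theorem upper_mul_mul_lower_ι (h : IsReflectionCoaction ρ δ s α β t c)
    (f f' : Module.Dual k W) (v : W) :
    upper ρ δ (TensorAlgebra.ι k f * TensorAlgebra.ι k f') * lower ρ δ (TensorAlgebra.ι k v) =
      lower ρ δ (TensorAlgebra.ι k v) * upper ρ δ (TensorAlgebra.ι k f * TensorAlgebra.ι k f') +
        (mid ρ δ (pairing δ f v) * upper ρ δ (TensorAlgebra.ι k f') +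
          mid ρ δ (pairing δ f' v) * upper ρ δ (TensorAlgebra.ι k f)) -
        ∑ i, (c i * α i v * (f (β i) * f' (β i))) •
          (mid ρ δ (MonoidAlgebra.of k G (s i)) * upper ρ δ (TensorAlgebra.ι k (α i))) := by
  rw [map_mul, mul_assoc, upper_ι_mul_lower_ι, mul_add, ← mul_assoc, upper_ι_mul_lower_ι,
    h.upper_ι_mul_mid_pairing, add_mul]
  simp only [mul_assoc]
  abel

theorem commute_commutator_lower_ι (h : IsReflectionCoaction ρ δ s α β t c)
    (v : W) (f f' : Module.Dual k W) :
    Commute (upper ρ δ (TensorAlgebra.ι k f * TensorAlgebra.ι k f' -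
      TensorAlgebra.ι k f' * TensorAlgebra.ι k f)) (lower ρ δ (TensorAlgebra.ι k v)) := by
  rw [commute_iff_eq, map_sub, mul_sub, sub_mul, h.upper_mul_mul_lower_ι f f' v,
    h.upper_mul_mul_lower_ι f' f v]
  simp only [mul_comm (f (β _))]
  abel

end IsReflectionCoaction

end Reflections

section Cherednik

variable {k V : Type*} [Field k] [AddCommGroup V] [Module k V]
  {G : Subgroup (LinearMap.GeneralLinearGroup k V)}

theorem cherednikCoaction_apply [Fintype (Refl G)] (t : k) (c : Refl G → k) (v : V) :
    cherednikCoaction G t c v = t • (1 : MonoidAlgebra k G) ⊗ₜ[k] v +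
      ∑ s : Refl G, c s • MonoidAlgebra.of k G s.1 ⊗ₜ[k] (v - tautRep G s.1 v) := by
  rw [cherednikCoaction, finsum_eq_sum_of_fintype]
  simp only [LinearMap.add_apply, LinearMap.sum_apply]
  rfl

theorem RootData.isReflectionCoaction [Fintype (Refl G)] (R : RootData G) (t : k)
    (c : Refl G → k) : IsReflectionCoaction (tautRep G) (cherednikCoaction G t c) (·.1) R.root
      R.coroot t c where
  apply := R.refl_apply
  pairing_eq f v := by
    rw [pairing, cherednikCoaction_apply]
    simp only [map_add, map_sum, map_smul, LinearMap.lTensor_tmul, TensorProduct.rid_tmul,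
      R.refl_apply, sub_sub_cancel, smul_eq_mul, smul_smul, mul_assoc]

/-- Conjugation by `g` as a permutation of the reflections. -/
def Refl.conjEquiv (g : G) : Refl G ≃ Refl G where
  toFun := Refl.conj g
  invFun := Refl.conj g⁻¹
  left_inv s := by rw [← Refl.conj_mul, inv_mul_cancel, Refl.conj_one]
  right_inv s := by rw [← Refl.conj_mul, mul_inv_cancel, Refl.conj_one]

theorem isQuasiYetterDrinfeld_cherednik [Finite (Refl G)] (t : k) {c : Refl G → k}
    (hc : ∀ (g : G) (s : Refl G), c (s.conj g) = c s) :
    IsQuasiYetterDrinfeld (tautRep G) (cherednikCoaction G t c) := by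
  have := Fintype.ofFinite (Refl G)
  intro g v
  rw [cherednikCoaction_apply, cherednikCoaction_apply]
  simp only [map_add, map_sum, map_smul, TensorProduct.map_tmul, LinearMap.mulRight_apply,
    LinearMap.mulLeft_apply, one_mul, mul_one, LinearMap.id_apply]
  refine congrArg _ (Fintype.sum_equiv (Refl.conjEquiv g) _ _ fun s => ?_).symm
  change c s • _ = c (s.conj g) • (MonoidAlgebra.of k G (g * s.1 * g⁻¹) * MonoidAlgebra.of k G g)
    ⊗ₜ[k] (tautRep G g v - tautRep G (g * s.1 * g⁻¹) (tautRep G g v))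
  rw [hc, ← map_mul, ← map_mul, inv_mul_cancel_right, tautRep_mul_apply, tautRep_inv_apply,
    tautRep_mul_apply, map_sub]

theorem isTriangularIdeal_cherednik [Finite (Refl G)] (t : k) (c : Refl G → k) :
    IsTriangularIdeal (tautRep G) (cherednikCoaction G t c) (symKer k V)
      (symKer k (Module.Dual k V)) (cherednikIdeal G t c) := by
  have := Fintype.ofFinite (Refl G)
  obtain ⟨R⟩ := RootData.nonempty (G := G)
  exact isTriangularIdeal_span_commutators (R.isReflectionCoaction t c).commute_upper_ι_commutator
    (R.isReflectionCoaction t c).commute_commutator_lower_ι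

end Cherednik

/-! ### The Yetter–Drinfeld module `Y_S(G)` -/

theorem isYetterDrinfeld_of_isHomogeneousVec {k G W : Type*} [Field k] [Group G] [AddCommGroup W]
    [Module k W] {ρ : Representation k G W} {δ : Quasicoaction k G W}
    (h : Submodule.span k {x | ∃ g, ∀ a, IsHomogeneousVec δ (a * g * a⁻¹) (ρ a x)} = ⊤) :
    IsYetterDrinfeld ρ δ := by
  have coaction_apply {g : G} {x : W} (hx : IsHomogeneousVec δ g x) :
      δ x = MonoidAlgebra.of k G g ⊗ₜ[k] x := hx
  have homogeneous {g : G} {x : W} (hx : ∀ a, IsHomogeneousVec δ (a * g * a⁻¹) (ρ a x)) :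
      IsHomogeneousVec δ g x := by
    simpa only [one_mul, inv_one, mul_one, map_one, Module.End.one_apply] using hx 1
  refine ⟨fun a => LinearMap.congr_fun
      (f := TensorProduct.map (LinearMap.mulRight k (MonoidAlgebra.of k G a)) .id ∘ₗ δ ∘ₗ ρ a)
      (g := TensorProduct.map (LinearMap.mulLeft k (MonoidAlgebra.of k G a)) (ρ a) ∘ₗ δ)
      (LinearMap.ext_on h fun x ⟨g, hx⟩ => ?_),
    LinearMap.congr_fun
      (f := (TensorProduct.assoc k _ _ W).toLinearMap ∘ₗ Coalgebra.comul.rTensor W ∘ₗ δ)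
      (g := δ.lTensor (MonoidAlgebra k G) ∘ₗ δ) (LinearMap.ext_on h fun x ⟨g, hx⟩ => ?_),
    LinearMap.congr_fun (f := Coalgebra.counit.rTensor W ∘ₗ δ) (g := TensorProduct.mk k k W 1)
      (LinearMap.ext_on h fun x ⟨g, hx⟩ => ?_)⟩
  · simp only [LinearMap.comp_apply, coaction_apply (homogeneous hx), coaction_apply (hx a)]
    simp
  · simp only [LinearMap.comp_apply, coaction_apply (homogeneous hx)]
    simp [coaction_apply (homogeneous hx)]
  · simp only [LinearMap.comp_apply, coaction_apply (homogeneous hx)]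
    simp

section Y

variable {k V : Type*} [Field k] [AddCommGroup V] [Module k V]
  {G : Subgroup (LinearMap.GeneralLinearGroup k V)}

@[elab_as_elim]
theorem YSpace.induction {P : YSpace G → Prop} (add : ∀ x y, P x → P y → P (x + y))
    (vec : ∀ v : V, P (v, 0)) (single : ∀ s r, P (0, Finsupp.single s r)) (y : YSpace G) :
    P y := by
  obtain ⟨v, φ⟩ := y
  suffices hφ : P (0, φ) by simpa using add _ _ (vec v) hφ
  induction φ using Finsupp.induction_linear with
  | zero => exact vec 0
  | add φ ψ hφ hψ => simpa using add _ _ hφ hψ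
  | single s r => exact single s r

@[simp]
theorem RootData.yRep_vec (R : RootData G) (g : G) (v : V) :
    R.yRep g (v, 0) = (tautRep G g v, 0) := by
  change ((tautRep G g).prodMap _) (v, 0) = _
  simp

@[simp]
theorem RootData.yRep_single (R : RootData G) (g : G) (s : Refl G) (r : k) :
    R.yRep g (0, Finsupp.single s r) = (0, Finsupp.single (s.conj g) (R.cocycle g s * r)) := by
  change ((tautRep G g).prodMap _) (0, Finsupp.single s r) = _
  simp

theorem isHomogeneousVec_vec (v : V) : IsHomogeneousVec (yCoaction G) 1 (v, 0) := by
  simp [IsHomogeneousVec, yCoaction, MonoidAlgebra.one_def]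

theorem isHomogeneousVec_single (s : Refl G) (r : k) :
    IsHomogeneousVec (yCoaction G) s.1 (0, Finsupp.single s r) := by
  rw [IsHomogeneousVec, yCoaction, LinearMap.coprod_apply, map_zero, zero_add,
    Finsupp.lsum_single]
  rfl

theorem isYetterDrinfeld_y (R : RootData G) : IsYetterDrinfeld R.yRep (yCoaction G) := by
  refine isYetterDrinfeld_of_isHomogeneousVec (eq_top_iff.2 fun y _ => ?_)
  induction y using YSpace.induction with
  | add x y hx hy => exact Submodule.add_mem _ (hx trivial) (hy trivial)
  | vec v =>
    refine Submodule.subset_span ⟨1, fun a => ?_⟩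
    rw [mul_one, mul_inv_cancel, R.yRep_vec]
    exact isHomogeneousVec_vec _
  | single s r =>
    refine Submodule.subset_span ⟨s.1, fun a => ?_⟩
    rw [R.yRep_single]
    exact isHomogeneousVec_single (s.conj a) _

theorem isHomogeneousDual_vec (f : Module.Dual k V) :
    IsHomogeneousDual (yCoaction G) 1 (f ∘ₗ LinearMap.fst k V (Refl G →₀ k)) := by
  intro y
  induction y using YSpace.induction with
  | add x y hx hy =>
    rw [← pairingₗ_apply, map_add, map_add, add_smul, pairingₗ_apply, pairingₗ_apply, hx, hy]
  | vec v => exact (isHomogeneousVec_vec v).pairing_eq _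
  | single s r => rw [(isHomogeneousVec_single s r).pairing_eq]; simp

theorem isHomogeneousDual_single (s : Refl G) :
    IsHomogeneousDual (yCoaction G) s.1 (Finsupp.lapply s ∘ₗ LinearMap.snd k V (Refl G →₀ k)) := by
  intro y
  induction y using YSpace.induction with
  | add x y hx hy =>
    rw [← pairingₗ_apply, map_add, map_add, add_smul, pairingₗ_apply, pairingₗ_apply, hx, hy]
  | vec v => rw [(isHomogeneousVec_vec v).pairing_eq]; simp
  | single s' r =>
    rw [(isHomogeneousVec_single s' r).pairing_eq]
    obtain rfl | h := eq_or_ne s' s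
    · rfl
    · simp [h]

theorem dual_y_eq [Fintype (Refl G)] (f : Module.Dual k (YSpace G)) :
    f = (f ∘ₗ LinearMap.inl k V (Refl G →₀ k)) ∘ₗ LinearMap.fst k V (Refl G →₀ k) +
      ∑ s : Refl G, f (0, Finsupp.single s 1) •
        (Finsupp.lapply s ∘ₗ LinearMap.snd k V (Refl G →₀ k)) := by
  classical
  ext
  · simp
  · simp [LinearMap.sum_apply, Finsupp.single_apply, Prod.mk_zero_zero]

theorem isGrading_y [Finite (Refl G)] : IsGrading (yCoaction G) where
  span_vec := by
    refine eq_top_iff.2 fun y _ => ?_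
    induction y using YSpace.induction with
    | add x y hx hy => exact Submodule.add_mem _ (hx trivial) (hy trivial)
    | vec v => exact Submodule.subset_span ⟨1, isHomogeneousVec_vec v⟩
    | single s r => exact Submodule.subset_span ⟨s.1, isHomogeneousVec_single s r⟩
  span_dual := by
    have := Fintype.ofFinite (Refl G)
    refine eq_top_iff.2 fun f _ => ?_
    rw [dual_y_eq f]
    exact Submodule.add_mem _ (Submodule.subset_span ⟨1, isHomogeneousDual_vec _⟩)
      (Submodule.sum_mem _ fun s _ => Submodule.smul_mem _ _
        (Submodule.subset_span ⟨s.1, isHomogeneousDual_single s⟩))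

end Y

/-! ### Morphisms of braided doubles -/

section Morphism

variable {k G V W : Type*} [Field k] [Group G] [AddCommGroup V] [Module k V] [AddCommGroup W]
  [Module k W] {ρV : Representation k G V} {δV : Quasicoaction k G V}
  {ρW : Representation k G W} {δW : Quasicoaction k G W}
  {μ : V →ₗ[k] W} {η : Module.Dual k V →ₗ[k] Module.Dual k W}

/-- `μ : V → W` and `η : V* → W*` are equivariant and preserve the `kG`-valued pairings; such a
pair induces a homomorphism between the free doubles. -/
structure IsCompatible (ρV : Representation k G V) (δV : Quasicoaction k G V)
    (ρW : Representation k G W) (δW : Quasicoaction k G W) (μ : V →ₗ[k] W)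
    (η : Module.Dual k V →ₗ[k] Module.Dual k W) : Prop where
  map_act : ∀ g v, μ (ρV g v) = ρW g (μ v)
  map_dual : ∀ f g, η (f ∘ₗ ρV g) = η f ∘ₗ ρW g
  pairing_eq : ∀ f v, pairing δW (η f) (μ v) = pairing δV f v

/-- The homomorphism `T(μ) ⊗ id ⊗ T(η)` of free doubles. -/
def FreeDouble.map (h : IsCompatible ρV δV ρW δW μ η) : FreeDouble ρV δV →ₐ[k] FreeDouble ρW δW :=
  FreeDouble.lift ρV δV ((lower ρW δW).toLinearMap ∘ₗ TensorAlgebra.ι k ∘ₗ μ)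
    (AlgHom.ofLinearMap (mid ρW δW) (mid_one ρW δW) (mid_mul ρW δW))
    ((upper ρW δW).toLinearMap ∘ₗ TensorAlgebra.ι k ∘ₗ η)
    (fun g v => (mid_mul_lower_ι ρW δW g (μ v)).trans <| by rw [← h.map_act]; rfl)
    (fun f g => (upper_ι_mul_mid ρW δW (η f) g).trans <| by rw [← h.map_dual]; rfl)
    (fun f v => (upper_ι_mul_lower_ι ρW δW (η f) (μ v)).trans <| by rw [h.pairing_eq]; rfl)

theorem FreeDouble.map_lower (h : IsCompatible ρV δV ρW δW μ η) (a : TensorAlgebra k V) :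
    FreeDouble.map h (lower ρV δV a) = lower ρW δW (tensorMap μ a) :=
  have : (FreeDouble.map h).comp (lower ρV δV) = (lower ρW δW).comp (tensorMap μ) := by
    ext v
    exact (FreeDouble.lift_lower_ι ..).trans (congrArg (lower ρW δW) (tensorMap_ι μ v).symm)
  DFunLike.congr_fun this a

theorem FreeDouble.map_upper (h : IsCompatible ρV δV ρW δW μ η)
    (b : TensorAlgebra k (Module.Dual k V)) :
    FreeDouble.map h (upper ρV δV b) = upper ρW δW (tensorMap η b) :=
  have : (FreeDouble.map h).comp (upper ρV δV) = (upper ρW δW).comp (tensorMap η) := by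
    ext f
    exact (FreeDouble.lift_upper_ι ..).trans (congrArg (upper ρW δW) (tensorMap_ι η f).symm)
  DFunLike.congr_fun this b

theorem FreeDouble.map_tri (h : IsCompatible ρV δV ρW δW μ η)
    (a : TensorAlgebra k V) (y : MonoidAlgebra k G) (b : TensorAlgebra k (Module.Dual k V)) :
    FreeDouble.map h (tri ρV δV a y b) = tri ρW δW (tensorMap μ a) y (tensorMap η b) := by
  have map_mid : FreeDouble.map h (mid ρV δV y) = mid ρW δW y := FreeDouble.lift_mid ..
  rw [tri, map_mul, map_mul, FreeDouble.map_lower, FreeDouble.map_upper, map_mid, tri]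

variable {Im : Submodule k (TensorAlgebra k V)}
  {Ip : Submodule k (TensorAlgebra k (Module.Dual k V))}
  {J : TwoSidedIdeal (FreeDouble ρV δV)} {Km : Submodule k (TensorAlgebra k W)}
  {Kp : Submodule k (TensorAlgebra k (Module.Dual k W))} {L : TwoSidedIdeal (FreeDouble ρW δW)}

theorem FreeDouble.map_mem (h : IsCompatible ρV δV ρW δW μ η)
    (hJ : IsTriangularIdeal ρV δV Im Ip J) (hL : IsTriangularIdeal ρW δW Km Kp L)
    (hm : ∀ a ∈ Im, tensorMap μ a ∈ Km) (hp : ∀ b ∈ Ip, tensorMap η b ∈ Kp)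
    {x : FreeDouble ρV δV} (hx : x ∈ J) : FreeDouble.map h x ∈ L := by
  rw [← SetLike.mem_coe, hJ.carrier_eq] at hx
  rw [← SetLike.mem_coe, hL.carrier_eq]
  have : triSpan ρV δV Im Ip ≤
      (triSpan ρW δW Km Kp).comap (FreeDouble.map h).toLinearMap := triSpan_le fun a g b hab => by
    simpa [FreeDouble.map_tri h] using tri_mem_triSpan (hab.imp (hm a) (hp b)) _
  exact this hx

theorem exists_isMorphism (h : IsCompatible ρV δV ρW δW μ η)
    (hJ : IsBraidedDouble ρV δV Im Ip J) (hL : IsBraidedDouble ρW δW Km Kp L)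
    (hν : ∃ ν : W →ₗ[k] V, (∀ g, ν ∘ₗ ρW g = ρV g ∘ₗ ν) ∧ ν.dualMap = η)
    (hm : ∀ a ∈ Im, tensorMap μ a ∈ Km) (hp : ∀ b ∈ Ip, tensorMap η b ∈ Kp) :
    ∃ Φ, IsMorphism ρV δV Im Ip J ρW δW Km Kp L μ η Φ := by
  let F := (toQuot ρW δW L).comp (FreeDouble.map h)
  have hF (x) (hx : x ∈ J) : F x = 0 :=
    toQuot_eq_zero.2 (FreeDouble.map_mem h hJ.triangular hL.triangular hm hp hx)
  refine ⟨J.ringCon.liftₐ F fun x y hxy => ?_, hJ, hL, fun g => LinearMap.ext (h.map_act g), hν, hm,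
    hp, fun a y b => congrArg (toQuot ρW δW L) (FreeDouble.map_tri h a y b)⟩
  exact sub_eq_zero.1 ((map_sub F x y).symm.trans (hF _ ((TwoSidedIdeal.rel_iff J x y).1 hxy)))

theorem mapQ_injective {k M N : Type*} [Ring k] [AddCommGroup M] [Module k M] [AddCommGroup N]
    [Module k N] {p : Submodule k M} {q : Submodule k N} {φ : M →ₗ[k] N} (h : p ≤ q.comap φ)
    (h' : q.comap φ ≤ p) : Function.Injective (p.mapQ q φ h) := by
  rw [← LinearMap.ker_eq_bot, Submodule.mapQ, Submodule.ker_liftQ, LinearMap.ker_comp,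
    Submodule.ker_mkQ, ← le_bot_iff, Submodule.map_le_iff_le_comap, Submodule.comap_bot,
    Submodule.ker_mkQ]
  exact h'

theorem IsMorphism.injective {Φ : QuotAlg ρV δV J →ₐ[k] QuotAlg ρW δW L}
    (hΦ : IsMorphism ρV δV Im Ip J ρW δW Km Kp L μ η Φ)
    (hm : ∀ a, tensorMap μ a ∈ Km → a ∈ Im) (hp : ∀ b, tensorMap η b ∈ Kp → b ∈ Ip) :
    Function.Injective Φ := by
  obtain ⟨e, he⟩ := hΦ.source.decomposition
  obtain ⟨e', he'⟩ := hΦ.target.decomposition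
  let T := TensorProduct.map
    (TensorProduct.map (Im.mapQ Km (tensorMap μ).toLinearMap hΦ.map_lower)
      (LinearMap.id (M := MonoidAlgebra k G)))
    (Ip.mapQ Kp (tensorMap η).toLinearMap hΦ.map_upper)
  have hT : Function.Injective T :=
    TensorProduct.map_injective_of_flat_flat _ _
      (TensorProduct.map_injective_of_flat_flat _ _ (mapQ_injective hΦ.map_lower hm)
        Function.injective_id) (mapQ_injective hΦ.map_upper hp)
  have comm : Φ.toLinearMap ∘ₗ e.toLinearMap = e'.toLinearMap ∘ₗ T := by
    refine TensorProduct.ext_threefold fun x y z => ?_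
    obtain ⟨a, rfl⟩ := Im.mkQ_surjective x
    obtain ⟨b, rfl⟩ := Ip.mkQ_surjective z
    change Φ (e _) = e' (Km.mkQ (tensorMap μ a) ⊗ₜ y ⊗ₜ Kp.mkQ (tensorMap η b))
    rw [he, he', hΦ.map_tri]
  have : ⇑Φ ∘ e = e' ∘ T := congrArg DFunLike.coe comm
  exact (EquivLike.injective_comp e Φ).1 (this ▸ e'.injective.comp hT)

end Morphism

/-! ### The morphism from the Cherednik algebra to the Heisenberg double -/

section Quadratic

variable {k M : Type*} [Field k] [AddCommGroup M] [Module k M]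

theorem commutator_mem_worKer {Ψ : M ⊗[k] M →ₗ[k] M ⊗[k] M} {x y : M} {z : M ⊗[k] M}
    (hxy : Ψ (x ⊗ₜ[k] y) + z = y ⊗ₜ[k] x) (hyx : Ψ (y ⊗ₜ[k] x) + z = x ⊗ₜ[k] y) :
    TensorAlgebra.ι k x * TensorAlgebra.ι k y - TensorAlgebra.ι k y * TensorAlgebra.ι k x ∈
      worKer Ψ := by
  have braidedInteger_ι (x : M) : braidedInteger Ψ (TensorAlgebra.ι k x) = 1 ⊗ₜ[k] x := by
    rw [← one_mul (TensorAlgebra.ι k x), braidedInteger_mul_ι, braidedInteger_one,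
      TensorProduct.zero_tmul, map_zero, add_zero]
  have braidedInteger_ι_mul_ι (x y : M) :
      braidedInteger Ψ (TensorAlgebra.ι k x * TensorAlgebra.ι k y) =
        (TensorAlgebra.ι k).rTensor M (x ⊗ₜ[k] y + Ψ (x ⊗ₜ[k] y)) := by
    rw [braidedInteger_mul_ι, braidedInteger_ι, lastLegs_tmul, map_add, LinearMap.rTensor_tmul,
      LinearMap.mulLeft_one, LinearMap.id_comp]
  have symmetrized : x ⊗ₜ[k] y + Ψ (x ⊗ₜ[k] y) = y ⊗ₜ[k] x + Ψ (y ⊗ₜ[k] x) :=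
    calc x ⊗ₜ[k] y + Ψ (x ⊗ₜ[k] y) = Ψ (y ⊗ₜ[k] x) + z + Ψ (x ⊗ₜ[k] y) := by rw [hyx]
      _ = Ψ (x ⊗ₜ[k] y) + z + Ψ (y ⊗ₜ[k] x) := by abel
      _ = y ⊗ₜ[k] x + Ψ (y ⊗ₜ[k] x) := by rw [hxy]
  refine mem_worKer_of_braidedInteger_eq_zero
    (symKer_le_positivePart (commutator_mem_symKer x y)) ?_
  rw [map_sub, braidedInteger_ι_mul_ι, braidedInteger_ι_mul_ι, symmetrized, sub_self]

end Quadratic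

section CherednikMorphism

variable {k V : Type*} [Field k] [AddCommGroup V] [Module k V]
  {G : Subgroup (LinearMap.GeneralLinearGroup k V)} (R : RootData G)

theorem YSpace.single_eq_smul (s : Refl G) (r : k) :
    ((0, Finsupp.single s r) : YSpace G) = r • (0, Finsupp.single s 1) := by
  simp

theorem RootData.root_conj (g : G) (s : Refl G) (v : V) :
    R.root (s.conj g) (tautRep G g v) = R.cocycle g s * R.root s v := by
  have h := R.refl_apply (s.conj g) (tautRep G g v)
  change tautRep G (g * s.1 * g⁻¹) (tautRep G g v) = _ at h
  rw [tautRep_mul_apply, tautRep_inv_apply, tautRep_mul_apply, R.refl_apply s v, map_sub, map_smul,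
    sub_right_inj, R.cocycle_spec, smul_smul, mul_comm] at h
  exact (smul_left_injective k (R.coroot_ne _) h).symm

@[simp]
theorem RootData.nuStar_vec (f : Module.Dual k V) (v : V) : R.nuStar f (v, 0) = f v := by
  simp [RootData.nuStar]

@[simp]
theorem RootData.nuStar_single (f : Module.Dual k V) (s : Refl G) (r : k) :
    R.nuStar f (0, Finsupp.single s r) = r * f (R.coroot s) := by
  simp [RootData.nuStar]

theorem RootData.exists_nu : ∃ ν : YSpace G →ₗ[k] V, (∀ g, ν ∘ₗ R.yRep g = tautRep G g ∘ₗ ν) ∧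
    ν.dualMap = R.nuStar := by
  refine ⟨LinearMap.coprod LinearMap.id (Finsupp.linearCombination k R.coroot), fun g => ?_, ?_⟩
  · refine LinearMap.ext fun y => ?_
    induction y using YSpace.induction with
    | add x y hx hy => rw [map_add, map_add, hx, hy]
    | vec v => simp
    | single s r =>
      rw [LinearMap.comp_apply, R.yRep_single, LinearMap.comp_apply, LinearMap.coprod_apply,
        LinearMap.coprod_apply]
      simp only [map_zero, zero_add, Finsupp.linearCombination_single, map_smul, R.cocycle_spec,
        smul_smul, mul_comm]
  · ext f y
    · simp
    · simp

theorem RootData.nuStar_comp (f : Module.Dual k V) (g : G) :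
    R.nuStar (f ∘ₗ tautRep G g) = R.nuStar f ∘ₗ R.yRep g := by
  obtain ⟨ν, h, h'⟩ := R.exists_nu
  rw [← h']
  exact congrArg (f ∘ₗ ·) (h g).symm

theorem RootData.dualBraiding_nuStar_tmul [Fintype (Refl G)] [FiniteDimensional k V]
    (f : Module.Dual k V) (φ : Module.Dual k (YSpace G)) :
    dualBraiding R.yBraiding (R.nuStar f ⊗ₜ[k] φ) +
      ∑ s : Refl G, (f (R.coroot s) * φ (0, Finsupp.single s 1)) •
        (Finsupp.lapply s ∘ₗ LinearMap.snd k V (Refl G →₀ k)) ⊗ₜ[k] R.nuStar (R.root s) =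
      φ ⊗ₜ[k] R.nuStar f := by
  have tmul_vec (f' : Module.Dual k V) : dualBraiding R.yBraiding
      (R.nuStar f ⊗ₜ[k] (f' ∘ₗ LinearMap.fst k V (Refl G →₀ k))) =
        (f' ∘ₗ LinearMap.fst k V (Refl G →₀ k)) ⊗ₜ[k] R.nuStar f := by
    rw [RootData.yBraiding, (isHomogeneousDual_vec f').dualBraiding_tmul (isGrading_y (G := G)),
      map_one]
    rfl
  have tmul_single (s : Refl G) : dualBraiding R.yBraiding
      (R.nuStar f ⊗ₜ[k] (Finsupp.lapply s ∘ₗ LinearMap.snd k V (Refl G →₀ k))) +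
        f (R.coroot s) • (Finsupp.lapply s ∘ₗ LinearMap.snd k V (Refl G →₀ k)) ⊗ₜ[k]
          R.nuStar (R.root s) =
        (Finsupp.lapply s ∘ₗ LinearMap.snd k V (Refl G →₀ k)) ⊗ₜ[k] R.nuStar f := by
    have hf : f ∘ₗ tautRep G s.1 + f (R.coroot s) • R.root s = f := by
      ext x
      simp [R.refl_apply, mul_comm]
    rw [RootData.yBraiding, (isHomogeneousDual_single s).dualBraiding_tmul (isGrading_y (G := G)),
      ← R.nuStar_comp, ← TensorProduct.tmul_smul, ← TensorProduct.tmul_add, ← map_smul, ← map_add,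
      hf]
  conv_lhs => enter [1]; rw [dual_y_eq φ]
  conv_rhs => rw [dual_y_eq φ]
  simp only [TensorProduct.tmul_add, TensorProduct.add_tmul, TensorProduct.tmul_sum,
    TensorProduct.sum_tmul, TensorProduct.tmul_smul, ← TensorProduct.smul_tmul', map_add, map_sum,
    map_smul, tmul_vec, ← tmul_single, smul_add, Finset.sum_add_distrib, smul_smul, mul_comm (φ _),
    add_assoc]

theorem RootData.nuStar_commutator_mem_worKer [Finite (Refl G)] [FiniteDimensional k V]
    (f f' : Module.Dual k V) :
    TensorAlgebra.ι k (R.nuStar f) * TensorAlgebra.ι k (R.nuStar f') -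
      TensorAlgebra.ι k (R.nuStar f') * TensorAlgebra.ι k (R.nuStar f) ∈
        worKer (dualBraiding R.yBraiding) := by
  have := Fintype.ofFinite (Refl G)
  refine commutator_mem_worKer (R.dualBraiding_nuStar_tmul f (R.nuStar f')) ?_
  simpa only [R.nuStar_single, one_mul, mul_comm (f (R.coroot _))] using
    R.dualBraiding_nuStar_tmul f' (R.nuStar f)

theorem RootData.yRep_snd_conj (g : G) (y : YSpace G) (s : Refl G) :
    (R.yRep g y).2 (s.conj g) = R.cocycle g s * y.2 s := by
  classical
  induction y using YSpace.induction with
  | add x y hx hy =>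
    rw [map_add, Prod.snd_add, Finsupp.add_apply, hx, hy, Prod.snd_add, Finsupp.add_apply, mul_add]
  | vec v => simp
  | single s' r =>
    have conj_eq_iff : s'.conj g = s.conj g ↔ s' = s := (Refl.conjEquiv g).injective.eq_iff
    simp only [R.yRep_single, Finsupp.single_apply, conj_eq_iff]
    obtain rfl | h := eq_or_ne s' s
    · simp
    · simp [h]

theorem pairing_yCoaction [Fintype (Refl G)] (f : Module.Dual k (YSpace G)) (y : YSpace G) :
    pairing (yCoaction G) f y = f (y.1, 0) • (1 : MonoidAlgebra k G) +
      ∑ s : Refl G, (y.2 s * f (0, Finsupp.single s 1)) • MonoidAlgebra.of k G s.1 := by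
  classical
  induction y using YSpace.induction with
  | add x y hx hy =>
    rw [← pairingₗ_apply, map_add, pairingₗ_apply, pairingₗ_apply, hx, hy,
      add_add_add_comm, ← add_smul, ← map_add, ← Finset.sum_add_distrib]
    simp [add_mul, add_smul]
  | vec v => simp [(isHomogeneousVec_vec v).pairing_eq, MonoidAlgebra.one_def]
  | single s r =>
    rw [(isHomogeneousVec_single s r).pairing_eq, Finset.sum_eq_single s]
    · rw [YSpace.single_eq_smul s r, map_smul]
      simp [Prod.mk_zero_zero]
    · intro s' _ h
      simp [h]
    · simp

variable [Finite G] (t : k) {c : Refl G → k}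

theorem RootData.mu_act (hc : ∀ (g : G) (s : Refl G), c (s.conj g) = c s) (g : G) (v : V) :
    R.mu t c (tautRep G g v) = R.yRep g (R.mu t c v) := by
  refine Prod.ext (map_smul (tautRep G g) t v).symm (Finsupp.ext fun s => ?_)
  obtain ⟨s, rfl⟩ := (Refl.conjEquiv g).surjective s
  change c (s.conj g) * R.root (s.conj g) (tautRep G g v) = (R.yRep g _).2 (s.conj g)
  rw [R.yRep_snd_conj, hc, R.root_conj, mul_left_comm]
  rfl

theorem RootData.isCompatible (hc : ∀ (g : G) (s : Refl G), c (s.conj g) = c s) :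
    IsCompatible (tautRep G) (cherednikCoaction G t c) R.yRep (yCoaction G) (R.mu t c)
      R.nuStar where
  map_act := R.mu_act t hc
  map_dual := R.nuStar_comp
  pairing_eq f v := by
    have := Fintype.ofFinite (Refl G)
    rw [pairing_yCoaction, (R.isReflectionCoaction t c).pairing_eq]
    simp [RootData.mu]

theorem RootData.yBraiding_tmul_mu [Fintype (Refl G)]
    (hc : ∀ (g : G) (s : Refl G), c (s.conj g) = c s) (y : YSpace G) (v : V) :
    R.yBraiding (y ⊗ₜ[k] R.mu t c v) +
      ∑ s : Refl G, (y.2 s * R.root s v) •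
        R.mu t c (R.coroot s) ⊗ₜ[k] ((0, Finsupp.single s 1) : YSpace G) =
      R.mu t c v ⊗ₜ[k] y := by
  induction y using YSpace.induction with
  | add x y hx hy =>
    rw [TensorProduct.tmul_add, ← hx, ← hy, TensorProduct.add_tmul, map_add, add_add_add_comm,
      ← Finset.sum_add_distrib]
    simp only [Prod.snd_add, Finsupp.add_apply, add_mul, add_smul]
  | vec x =>
    rw [RootData.yBraiding, (isHomogeneousVec_vec x).braiding_tmul, map_one]
    simp
  | single s r =>
    rw [RootData.yBraiding, (isHomogeneousVec_single s r).braiding_tmul, ← R.mu_act t hc,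
      Finset.sum_eq_single s (fun s' _ h => by simp [h]) (by simp)]
    have h : tautRep G s.1 v + R.root s v • R.coroot s = v := by simp [R.refl_apply]
    conv_rhs => rw [← h]
    rw [map_add, TensorProduct.add_tmul, map_smul, ← TensorProduct.smul_tmul',
      YSpace.single_eq_smul s r, TensorProduct.tmul_smul, TensorProduct.tmul_smul, smul_smul,
      mul_comm (R.root s v)]
    simp

theorem RootData.mu_commutator_mem_worKer (hc : ∀ (g : G) (s : Refl G), c (s.conj g) = c s)
    (v v' : V) : TensorAlgebra.ι k (R.mu t c v) * TensorAlgebra.ι k (R.mu t c v') -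
      TensorAlgebra.ι k (R.mu t c v') * TensorAlgebra.ι k (R.mu t c v) ∈ worKer R.yBraiding := by
  have := Fintype.ofFinite (Refl G)
  have mu_snd (v : V) (s : Refl G) : (R.mu t c v).2 s = c s * R.root s v := rfl
  refine commutator_mem_worKer (R.yBraiding_tmul_mu t hc (R.mu t c v) v') ?_
  simpa only [mu_snd, mul_right_comm _ (R.root _ v')] using
    R.yBraiding_tmul_mu t hc (R.mu t c v') v

end CherednikMorphism

/-! ### Nondegeneracy in characteristic zero -/

section Polynomial

variable {k M I : Type*} [Field k] [AddCommGroup M] [Module k M] (B : Module.Basis I k M)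

/-- The homomorphism `T(M) → k[x_i]` that sends the basis vectors of `M` to the variables; it is
the coordinate form of the projection `T(M) → S(M)`. -/
def toMvPolynomial : TensorAlgebra k M →ₐ[k] MvPolynomial I k :=
  (SymmetricAlgebra.equivMvPolynomial B).toAlgHom.comp (SymmetricAlgebra.algHom k M)

theorem toMvPolynomial_eq_zero {a : TensorAlgebra k M} :
    toMvPolynomial B a = 0 ↔ a ∈ symKer k M :=
  map_eq_zero_iff _ (SymmetricAlgebra.equivMvPolynomial B).injective

theorem toMvPolynomial_basis (i : I) :
    toMvPolynomial B (TensorAlgebra.ι k (B i)) = MvPolynomial.X i :=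
  SymmetricAlgebra.equivMvPolynomial_ι_apply B i

theorem constantCoeff_toMvPolynomial (a : TensorAlgebra k M) :
    MvPolynomial.constantCoeff (toMvPolynomial B a) = TensorAlgebra.algebraMapInv (R := k) a := by
  have : (MvPolynomial.aeval (0 : I → k)).comp (toMvPolynomial B) =
      TensorAlgebra.algebraMapInv (R := k) :=
    TensorAlgebra.hom_ext <| B.ext fun i => by simp [toMvPolynomial_basis]
  rw [← this]
  simp

theorem pderiv_toMvPolynomial_ι (i : I) (x : M) :
    MvPolynomial.pderiv i (toMvPolynomial B (TensorAlgebra.ι k x)) =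
      MvPolynomial.C (B.coord i x) := by
  classical
  have : (MvPolynomial.pderiv (R := k) i).toLinearMap ∘ₗ (toMvPolynomial B).toLinearMap ∘ₗ
      TensorAlgebra.ι k = Algebra.linearMap k (MvPolynomial I k) ∘ₗ B.coord i :=
    B.ext fun j => by
      simp [toMvPolynomial_basis, Pi.single_apply, Finsupp.single_apply, MvPolynomial.pderiv_X,
        eq_comm]
  exact LinearMap.congr_fun this x

theorem le_symKer_of_pderiv [CharZero k] {S : Submodule k (TensorAlgebra k M)}
    (h0 : S ≤ positivePart k M)
    (h : ∀ a ∈ S, ∀ i, ∃ a' ∈ S, toMvPolynomial B a' = MvPolynomial.pderiv i (toMvPolynomial B a)) :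
    S ≤ symKer k M := by
  suffices coeff_eq_zero : ∀ m, ∀ a ∈ S, MvPolynomial.coeff m (toMvPolynomial B a) = 0 from
    fun a ha => (toMvPolynomial_eq_zero B).1 (MvPolynomial.ext _ _ fun m => coeff_eq_zero m a ha)
  intro m
  induction m using WellFoundedLT.induction with
  | ind m ih =>
    intro a ha
    obtain rfl | hm := eq_or_ne m 0
    · exact (constantCoeff_toMvPolynomial B a).trans (h0 ha)
    obtain ⟨i, hi⟩ := Finsupp.ne_iff.1 hm
    obtain ⟨n, rfl⟩ : ∃ n, m = n + Finsupp.single i 1 :=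
      ⟨m - Finsupp.single i 1, (tsub_add_cancel_of_le <|
        Finsupp.single_le_iff.2 (Nat.one_le_iff_ne_zero.2 hi)).symm⟩
    obtain ⟨a', ha', he⟩ := h a ha i
    have hn := ih n (lt_add_of_pos_right n (by simp [pos_iff_ne_zero])) a' ha'
    rw [he, MvPolynomial.coeff_pderiv] at hn
    exact (mul_eq_zero.1 hn).resolve_right (Nat.cast_add_one_ne_zero _)

end Polynomial

section Weyl

variable {k G V W I : Type*} [Field k] [Group G] [AddCommGroup V] [Module k V] [AddCommGroup W]
  [Module k W] {ρ : Representation k G W} {δ : Quasicoaction k G W}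

theorem exists_lower_pderiv (B : Module.Basis I k V) {i : I} {μ : V →ₗ[k] W}
    {f : Module.Dual k W} (hf : ∀ v, pairing δ f (μ v) = B.coord i v • 1)
    (a : TensorAlgebra k V) :
    ∃ a', upper ρ δ (TensorAlgebra.ι k f) * lower ρ δ (tensorMap μ a) =
        lower ρ δ (tensorMap μ a) * upper ρ δ (TensorAlgebra.ι k f) +
          lower ρ δ (tensorMap μ a') ∧
      toMvPolynomial B a' = MvPolynomial.pderiv i (toMvPolynomial B a) := by
  induction a using tensorAlgebra_induction_left with
  | add x y hx hy =>
    obtain ⟨x', hx, hx'⟩ := hx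
    obtain ⟨y', hy, hy'⟩ := hy
    refine ⟨x' + y', ?_, by simp only [map_add, hx', hy']⟩
    rw [map_add, map_add, mul_add, add_mul, hx, hy, map_add, map_add, add_add_add_comm]
  | smul r x hx =>
    obtain ⟨x', hx, hx'⟩ := hx
    refine ⟨r • x', ?_, by rw [map_smul, hx', map_smul, Derivation.map_smul]⟩
    rw [map_smul, map_smul, mul_smul_comm, smul_mul_assoc, hx, smul_add, map_smul, map_smul]
  | one => exact ⟨0, by simp, by simp⟩
  | ι_mul v a ha =>
    obtain ⟨a', ha, ha'⟩ := ha
    refine ⟨TensorAlgebra.ι k v * a' + B.coord i v • a, ?_, ?_⟩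
    · rw [map_mul, tensorMap_ι, map_mul, ← mul_assoc, upper_ι_mul_lower_ι, hf, map_smul, mid_one,
        add_mul, mul_assoc, ha, map_add, map_mul, tensorMap_ι, map_add, map_mul, map_smul, map_smul,
        smul_mul_assoc, one_mul, mul_add]
      simp only [mul_assoc, add_assoc]
    · rw [map_add, map_mul, map_smul, ha', map_mul, Derivation.leibniz, pderiv_toMvPolynomial_ι,
        smul_eq_mul, smul_eq_mul, mul_comm (toMvPolynomial B a), ← MvPolynomial.smul_eq_C_mul]

theorem exists_upper_pderiv (B : Module.Basis I k V) {i : I} {η : V →ₗ[k] Module.Dual k W}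
    {x : W} (hx : ∀ v, pairing δ (η v) x = B.coord i v • 1) (b : TensorAlgebra k V) :
    ∃ b', upper ρ δ (tensorMap η b) * lower ρ δ (TensorAlgebra.ι k x) =
        lower ρ δ (TensorAlgebra.ι k x) * upper ρ δ (tensorMap η b) +
          upper ρ δ (tensorMap η b') ∧
      toMvPolynomial B b' = MvPolynomial.pderiv i (toMvPolynomial B b) := by
  induction b using tensorAlgebra_induction_right with
  | add x y hx hy =>
    obtain ⟨x', hx, hx'⟩ := hx
    obtain ⟨y', hy, hy'⟩ := hy
    refine ⟨x' + y', ?_, by simp only [map_add, hx', hy']⟩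
    rw [map_add, map_add, mul_add, add_mul, hx, hy, map_add, map_add, add_add_add_comm]
  | smul r x hx =>
    obtain ⟨x', hx, hx'⟩ := hx
    refine ⟨r • x', ?_, by rw [map_smul, hx', map_smul, Derivation.map_smul]⟩
    rw [map_smul, map_smul, mul_smul_comm, smul_mul_assoc, hx, smul_add, map_smul, map_smul]
  | one => exact ⟨0, by simp, by simp⟩
  | mul_ι v b hb =>
    obtain ⟨b', hb, hb'⟩ := hb
    refine ⟨b' * TensorAlgebra.ι k v + B.coord i v • b, ?_, ?_⟩
    · rw [map_mul, tensorMap_ι, map_mul, mul_assoc, upper_ι_mul_lower_ι, hx, map_smul, mid_one,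
        mul_add, ← mul_assoc, hb, map_add, map_mul, tensorMap_ι, map_add, map_mul, map_smul,
        map_smul, mul_smul_comm, mul_one, add_mul]
      simp only [mul_assoc, add_assoc]
    · rw [map_add, map_mul, map_smul, hb', map_mul, Derivation.leibniz, pderiv_toMvPolynomial_ι,
        smul_eq_mul, smul_eq_mul, add_comm, mul_comm (MvPolynomial.pderiv i _),
        MvPolynomial.smul_eq_C_mul, mul_comm (MvPolynomial.C _)]

variable [CharZero k] (hq : IsQuasiYetterDrinfeld ρ δ)

theorem comap_lowerRadical_le_symKer (B : Module.Basis I k V) {μ : V →ₗ[k] W}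
    {f : I → Module.Dual k W} (hf : ∀ i v, pairing δ (f i) (μ v) = B.coord i v • 1) :
    (lowerRadical hq).comap (tensorMap μ).toLinearMap ≤ symKer k V := by
  refine le_symKer_of_pderiv B (fun a ha => ?_) fun a ha i => ?_
  · exact (algebraMapInv_tensorMap μ a).symm.trans (lowerRadical_le_positivePart hq ha)
  · obtain ⟨a', h, h'⟩ := exists_lower_pderiv (ρ := ρ) B (hf i) a
    refine ⟨a', (mem_lowerRadical hq).2 fun b => ?_, h'⟩
    have hb := (mem_lowerRadical hq).1 ha (b * TensorAlgebra.ι k (f i))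
    rwa [AlgHom.toLinearMap_apply, form_apply, map_mul (upper ρ δ), mul_assoc, h, mul_add, map_add,
      ← mul_assoc, vacuum_mul_upper_ι, zero_add] at hb

theorem comap_upperRadical_le_symKer (B : Module.Basis I k V) {η : V →ₗ[k] Module.Dual k W}
    {x : I → W} (hx : ∀ i v, pairing δ (η v) (x i) = B.coord i v • 1) :
    (upperRadical hq).comap (tensorMap η).toLinearMap ≤ symKer k V := by
  refine le_symKer_of_pderiv B (fun b hb => ?_) fun b hb i => ?_
  · exact (algebraMapInv_tensorMap η b).symm.trans (upperRadical_le_positivePart hq hb)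
  · obtain ⟨b', h, h'⟩ := exists_upper_pderiv (ρ := ρ) B (hx i) b
    refine ⟨b', (mem_upperRadical hq).2 fun a => ?_, h'⟩
    have ha := (mem_upperRadical hq).1 hb (TensorAlgebra.ι k (x i) * a)
    rwa [AlgHom.toLinearMap_apply, form_apply, map_mul (lower ρ δ), ← mul_assoc, h, add_mul,
      map_add, mul_assoc, vacuum_lower_ι_mul, zero_add] at ha

end Weyl

section Faithful

variable {k V : Type*} [Field k] [CharZero k] [AddCommGroup V] [Module k V]
  [FiniteDimensional k V] {G : Subgroup (LinearMap.GeneralLinearGroup k V)} (R : RootData G)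
  (hq : IsQuasiYetterDrinfeld R.yRep (yCoaction G))

theorem RootData.comap_mu_lowerRadical_le_symKer [Finite G] {t : k} (ht : t ≠ 0)
    (c : Refl G → k) :
    (lowerRadical hq).comap (tensorMap (R.mu t c)).toLinearMap ≤ symKer k V := by
  let B := Module.finBasis k V
  refine comap_lowerRadical_le_symKer hq B
    (f := fun i => (t⁻¹ • B.coord i) ∘ₗ LinearMap.fst k V (Refl G →₀ k)) fun i v => ?_
  rw [isHomogeneousDual_vec, map_one]
  simp [RootData.mu, ht]

theorem RootData.comap_nuStar_upperRadical_le_symKer :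
    (upperRadical hq).comap (tensorMap R.nuStar).toLinearMap ≤ symKer k (Module.Dual k V) := by
  let B := Module.finBasis k V
  refine comap_upperRadical_le_symKer hq B.dualBasis (x := fun i => (B i, 0)) fun i f => ?_
  rw [(isHomogeneousVec_vec (B i)).pairing_eq, map_one, R.nuStar_vec]
  simp [Module.Basis.coord_apply]

end Faithful

end BraidedDouble

end

open BraidedDouble in
theorem theoremG {k : Type*} [Field k] {V : Type*} [AddCommGroup V] [Module k V]
    [FiniteDimensional k V] (G : Subgroup (LinearMap.GeneralLinearGroup k V)) [Finite G]
    (R : RootData G) (t : k) (c : Refl G → k) (hc : ∀ (g : G) (s : Refl G), c (s.conj g) = c s) :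
    IsYetterDrinfeld R.yRep (yCoaction G) ∧
    ∃ Φ : CherednikAlgebra G t c →ₐ[k] R.HeisenbergDouble,
      IsMorphism
        (tautRep G) (cherednikCoaction G t c)
        (symKer k V) (symKer k (Module.Dual k V)) (cherednikIdeal G t c)
        R.yRep (yCoaction G)
        (worKer R.yBraiding) (worKer (dualBraiding R.yBraiding))
        (maximalTriangularIdeal R.yRep (yCoaction G))
        (R.mu t c) R.nuStar Φ ∧
      (t ≠ 0 → CharZero k → Function.Injective Φ) := by
  have hY : IsYetterDrinfeld R.yRep (yCoaction G) := isYetterDrinfeld_y R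
  have grading : IsGrading (yCoaction G) := isGrading_y
  have lower_eq : lowerRadical hY.compat = worKer R.yBraiding :=
    lowerRadical_eq_worKer grading hY.compat
  have upper_eq : upperRadical hY.compat = worKer (dualBraiding R.yBraiding) :=
    upperRadical_eq_worKer grading hY.compat
  have source := (isTriangularIdeal_cherednik t c).isBraidedDouble
    (isQuasiYetterDrinfeld_cherednik t hc)
  have target := (isTriangularIdeal_maximalTriangularIdeal grading hY.compat).isBraidedDouble
    hY.compat
  have map_lower := symKer_le_comap_tensorMap (R.mu t c) (S := lowerRadical hY.compat)
    (lower_eq ▸ R.mu_commutator_mem_worKer t hc) (fun x _ => ι_mul_mem_lowerRadical grading x)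
    (fun x _ => mul_ι_mem_lowerRadical grading x)
  have map_upper := symKer_le_comap_tensorMap R.nuStar (S := upperRadical hY.compat)
    (upper_eq ▸ R.nuStar_commutator_mem_worKer) (fun f _ => ι_mul_mem_upperRadical grading f)
    (fun f _ => mul_ι_mem_upperRadical grading f)
  rw [← lower_eq, ← upper_eq]
  obtain ⟨Φ, hΦ⟩ :=
    exists_isMorphism (R.isCompatible t hc) source target R.exists_nu map_lower map_upper
  exact ⟨hY, Φ, hΦ, fun ht _ => hΦ.injective
    (R.comap_mu_lowerRadical_le_symKer hY.compat ht c)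
    (R.comap_nuStar_upperRadical_le_symKer hY.compat)⟩
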